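/- **Problem.** Let $H\in\mathbb R^{n\times n}$ be symmetric positive semidefinite, $A\in\mathbb R^{m\times n}$ with rows $a_i^T$, $m>0$, $b\in\mathbb R^m$, $c\in\mathbb R^n$, and consider $$\text{(P)}\quad \min_x\ f(x)=\tfrac12x^THx+c^Tx\ \text{ s.t. } Ax\ge b,\qquad \text{(D)}\quad \max_{x,\lambda}\ -\tfrac12x^THx+b^T\lambda\ \text{ s.t. } Hx+c-A^T\lambda=0,\ \lambda\ge0 .$$ Let $\mathcal F_P=\{x:Ax\ge b\}$, $\mathcal F_P^o=\{x:Ax>b\}$, let $\mathcal F_P^*$ be the set of minimizers of $f$ over $\mathcal F_P$, and let $\mathcal F^*$ be the set of pairs $(x,\lambda)$ satisfying the KKT conditions $Hx+c-A^T\lambda=0$, $s=Ax-b\ge 0$, $\lambda\ge 0$, $s_i\lambda_i=0$ for all $i$. A point $x\in\mathcal F_P$ is stationary if some $\lambda\in\mathbb R^m$ satisfies these conditions except possibly $\lambda\ge0$. Let $\mathcal A(x)=\{i:a_i^Tx=b_i\}$. Put $E(x,\lambda)=\|(\|v\|,\|w\|)\|$ with $v=Hx+c-A^T\lambda$, $w_i=\min\{|(Ax-b)_i|,|\lambda_i|\}$.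 All norms, here and below, are arbitrary fixed norms. For vectors, $[\cdot]_+$ and $[\cdot]_-$ are the componentwise maximum and minimum with $0$. **Algorithm CR-MPC.** Parameters: $\varepsilon\ge0$, $\tau\in[0,1)$, $\omega,\varkappa\in(0,1)$, $\nu\ge2$, $\lambda^{\max}>0$, $\underline\lambda\in(0,\lambda^{\max})$, $\bar E>0$, and a symmetric $R\succeq0$ with $H+R\succ0$. Start from $x\in\mathcal F_P^o$, $\lambda>0$, $\tilde\lambda=\lambda$; throughout $s=Ax-b$. One iteration is as follows. 1. Stop if $\nabla f(x)=0$ or $\min\{E(x,\lambda),E(x,[\tilde\lambda]_+)\}<\varepsilon$. 2. The constraint-selection rule, which may use all iterates constructed so far, selects a working set $Q\subseteq\{1,\dots,m\}$. Set $\varrho=\min\{1,E(x,\lambda)/\bar E\}$, $W=H+\varrho R$. 3. Set $M=W+\sum_{i\in Q}\frac{\lambda_i}{s_i}a_ia_i^T$. 4. Solve $M\Delta x^{a}=-\nabla f(x)$; set $\Delta s^{a}=A\Delta x^{a}$ and $\Delta\lambda_i^{a}=-\lambda_i-\frac{\lambda_i}{s_i}\Delta s_i^{a}$ for $i\in Q$.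 5. Let $\alpha^{a}$ be the largest $\alpha\in[0,1]$ with $s+\alpha\Delta s^{a}\ge0$ and $\lambda_Q+\alpha\Delta\lambda_Q^{a}\ge0$. 6. Set $\mu=s_Q^T\lambda_Q/|Q|$ ($\mu=0$ if $Q=\emptyset$) and $\sigma=(1-\alpha^{a})^3$. 7. Let $(\Delta x^{c},\Delta\lambda_Q^{c},\Delta s_Q^c)$ solve $W\Delta x^{c}-A_Q^T\Delta\lambda^{c}_Q=0$, $\Delta s_Q^c=A_Q\Delta x^{c}$, $s_i\Delta\lambda_i^{c}+\lambda_i\Delta s_i^{c}=\sigma\mu-\Delta s_i^{a}\Delta\lambda_i^{a}$ ($i\in Q$), and set $\Delta s^{c}=A\Delta x^{c}$. 8. Set $\gamma=0$ if $Q=\emptyset$; otherwise $\gamma=1$ if $\Delta x^{c}=0$; otherwise $\gamma=\min\{\gamma_1,\ \tau\|\Delta x^{a}\|/\|\Delta x^{c}\|,\ \tau\|\Delta x^{a}\|/(\sigma\mu)\}$ (the last term being $+\infty$ if $\sigma\mu=0$), where $\gamma_1$ is the largest $g\in[0,1]$ with $f(x)-f(x+\Delta x^{a}+g\Delta x^{c})\ge\omega(f(x)-f(x+\Delta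 x^{a}))$. Set $(\Delta x,\Delta\lambda_Q,\Delta s)=(\Delta x^{a},\Delta\lambda_Q^{a},\Delta s^{a})+\gamma(\Delta x^{c},\Delta\lambda_Q^{c},\Delta s^{c})$, $\tilde\lambda_i^+=\lambda_i+\Delta\lambda_i$ for $i\in Q$, and $\tilde\lambda_i^+=0$ for $i\notin Q$. 9. Let $\bar\alpha_p$ be the largest $\alpha$ with $s+\alpha\Delta s\ge0$ and $\bar\alpha_d$ the largest $\alpha$ with $\lambda_Q+\alpha\Delta\lambda_Q\ge0$ ($+\infty$ if there is no largest one), and for $j\in\{p,d\}$ set $\alpha_j=\min\{1,\max\{\varkappa\bar\alpha_j,\bar\alpha_j-\|\Delta x\|\}\}$. 10. Set $x^+=x+\alpha_p\Delta x$, $s^+=s+\alpha_p\Delta s$, $\chi=\|\Delta x^{a}\|^\nu+\|[\lambda_Q+\Delta\lambda_Q^{a}]_-\|^\nu$ (the norm of the subvector being that of its extension by zero to $\mathbb R^m$), $\lambda_i^+=\max\{\min\{\lambda_i+\alpha_d\Delta\lambda_i,\lambda^{\max}\},\min\{\chi,\underline\lambda\}\}$ for $i\in Q$, $\mu^+=(s_Q^+)^T\lambda_Q^+/|Q|$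 ($\mu^+=0$ if $Q=\emptyset$), and $\lambda_i^+=\max\{\min\{\mu^+/s_i^+,\lambda^{\max}\},\min\{\chi,\underline\lambda\}\}$ for $i\notin Q$. Write $x^k,\lambda^k,\tilde\lambda^k,Q_k$ for the quantities of iteration $k$. **Condition CSR** on the constraint-selection rule. For every infinite sequence constructed by the algorithm with this rule: (a) if $\{(x^k,\lambda^k)\}$ is bounded away from $\mathcal F^*$ and $x^k\to x'$ on an infinite index set $K$, then $\mathcal A(x')\subseteq Q_k$ for all large enough $k\in K$; (b) if $\mathcal F^*=\{(x^*,\lambda^*)\}$ is a singleton, strict complementarity holds there, and $x^k\to x^*$, then $\mathcal A(x^*)\subseteq Q_k$ for all large enough $k$. **Theorem.** Suppose that the constraint-selection rule satisfies Condition CSR, that $\mathcal F_P^o$ is nonempty, that $\mathcal F_P^*$ is nonempty and bounded, and that at every stationary point $x$ the vectors $a_i$, $i\in\mathcal A(x)$, are linearly independent. First suppose that $\varepsilon=0$ and that the algorithm never stops. Then (i) $\{x^k\}$ converges to $\mathcal F_P^*$, i.e. the distance of $x^k$ to $\mathcal F_P^*$ tends to $0$. If in addition the second-order sufficient condition of optimality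 with strict complementarity holds at some $x^*$ with multiplier vector $\lambda^*$, then $(x^*,\lambda^*)$ is the unique primal-dual solution, i.e. $\mathcal F^*=\{(x^*,\lambda^*)\}$, and (ii) $(x^k,\tilde\lambda^k)\to(x^*,\lambda^*)$ and $(x^k,\lambda^k)\to(x^*,\xi^*)$, where $\xi_i^*=\min\{\lambda_i^*,\lambda^{\max}\}$ for all $i$; (iii) $\mathcal A(x^*)\subseteq Q_k$ for all sufficiently large $k$. (iv) If instead $\varepsilon>0$, the algorithm stops (in Step 1) after finitely many iterations. -/

import Mathlib

open Filter Topology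
open scoped Matrix

noncomputable section

/-! ### The convex quadratic program -/

/-- Data of the convex quadratic program
`minimize f(x) = (1/2) xᵀHx + cᵀx  subject to  Ax ≥ b`, with `x ∈ ℝⁿ`, `m > 0` constraints and
`H` symmetric positive semidefinite. -/
structure CQP (n m : ℕ) where
  H : Matrix (Fin n) (Fin n) ℝ
  A : Matrix (Fin m) (Fin n) ℝ
  b : Fin m → ℝ
  c : Fin n → ℝ
  H_posSemidef : H.PosSemidef
  m_pos : 0 < m

namespace CQP

variable {n m : ℕ} (P : CQP n m)

/-- The objective function. -/
def f (x : Fin n → ℝ) : ℝ := (1 / 2) * (x ⬝ᵥ (P.H *ᵥ x)) + P.c ⬝ᵥ x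

/-- The gradient of the objective function. -/
def grad (x : Fin n → ℝ) : Fin n → ℝ := P.H *ᵥ x + P.c

/-- The slack vector `s = Ax - b`. -/
def slack (x : Fin n → ℝ) : Fin m → ℝ := P.A *ᵥ x - P.b

/-- The primal feasible set. -/
def feasible : Set (Fin n → ℝ) := {x | ∀ i, P.b i ≤ (P.A *ᵥ x) i}

/-- The primal strictly feasible set. -/
def strictlyFeasible : Set (Fin n → ℝ) := {x | ∀ i, P.b i < (P.A *ᵥ x) i}

/-- The primal solution set. -/
def primalSolutions : Set (Fin n → ℝ) := {x | x ∈ P.feasible ∧ ∀ y ∈ P.feasible, P.f x ≤ P.f y}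

/-- The KKT conditions. -/
def KKT (x : Fin n → ℝ) (lam : Fin m → ℝ) : Prop :=
  P.H *ᵥ x - P.Aᵀ *ᵥ lam + P.c = 0 ∧ (∀ i, P.slack x i * lam i = 0) ∧
    (∀ i, 0 ≤ P.slack x i) ∧ ∀ i, 0 ≤ lam i

/-- The primal-dual solution set. -/
def primalDualSolutions : Set ((Fin n → ℝ) × (Fin m → ℝ)) := {p | P.KKT p.1 p.2}

/-- Stationary points: feasible points that satisfy the KKT conditions for some multiplier vector,
except possibly for nonnegativity of the multipliers. -/
def IsStationary (x : Fin n → ℝ) : Prop :=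
  x ∈ P.feasible ∧ ∃ lam : Fin m → ℝ,
    P.H *ᵥ x - P.Aᵀ *ᵥ lam + P.c = 0 ∧ ∀ i, P.slack x i * lam i = 0

/-- The set of (indices of) constraints that are active at `x`. -/
def active (x : Fin n → ℝ) : Set (Fin m) := {i | (P.A *ᵥ x) i = P.b i}

/-- There is a strictly feasible point, and the primal solution set is nonempty and bounded. -/
def StrictlyFeasibleBoundedSolutions : Prop :=
  P.strictlyFeasible.Nonempty ∧ P.primalSolutions.Nonempty ∧
    Bornology.IsBounded P.primalSolutions

/-- At every stationary point the active rows of `A` are linearly independent. -/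
def StationaryLinearlyIndependent : Prop :=
  ∀ x, P.IsStationary x → LinearIndependent ℝ (fun i : P.active x => P.A i)

/-- Strict complementarity of a primal-dual pair. -/
def StrictComplementarity (x : Fin n → ℝ) (lam : Fin m → ℝ) : Prop :=
  ∀ i, 0 < P.slack x i + lam i

/-- The critical cone at `x` for the multiplier vector `lam`. -/
def criticalCone (x : Fin n → ℝ) (lam : Fin m → ℝ) : Set (Fin n → ℝ) :=
  {d | ∀ i ∈ P.active x, 0 ≤ (P.A *ᵥ d) i ∧ (0 < lam i → (P.A *ᵥ d) i = 0)}

/-- The second-order sufficient condition of optimality with strict complementarity. -/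
def SecondOrderSufficientStrict (x : Fin n → ℝ) (lam : Fin m → ℝ) : Prop :=
  P.KKT x lam ∧ (∀ d ∈ P.criticalCone x lam, d ≠ 0 → 0 < d ⬝ᵥ (P.H *ᵥ d)) ∧
    P.StrictComplementarity x lam

end CQP

/-! ### Parameters of the algorithm and the error function -/

/-- An arbitrary norm on `ℝᵏ`. -/
structure VecNorm (k : ℕ) where
  toSeminorm : Seminorm ℝ (Fin k → ℝ)
  eq_zero_of_map_eq_zero : ∀ v, toSeminorm v = 0 → v = 0

instance {k : ℕ} : CoeFun (VecNorm k) (fun _ => (Fin k → ℝ) → ℝ) := ⟨fun N => N.toSeminorm⟩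

/-- Parameters of the algorithm. All norms that occur in it are arbitrary: `normX` and `normL` are
the norms on `ℝⁿ` and `ℝᵐ` used in the iteration, `normV`, `normW`, `normE` are those that define
the error function. -/
structure Params {n m : ℕ} (P : CQP n m) where
  ε : ℝ
  τ : ℝ
  ω : ℝ
  κ : ℝ
  ν : ℝ
  lamMax : ℝ
  lamLow : ℝ
  Ebar : ℝ
  R : Matrix (Fin n) (Fin n) ℝ
  normX : VecNorm n
  normL : VecNorm m
  normV : VecNorm n
  normW : VecNorm m
  normE : VecNorm 2
  ε_nonneg : 0 ≤ ε
  τ_mem : 0 ≤ τ ∧ τ < 1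
  ω_mem : 0 < ω ∧ ω < 1
  κ_mem : 0 < κ ∧ κ < 1
  ν_ge : 2 ≤ ν
  lamMax_pos : 0 < lamMax
  lamLow_mem : 0 < lamLow ∧ lamLow < lamMax
  Ebar_pos : 0 < Ebar
  R_posSemidef : R.PosSemidef
  HR_posDef : (P.H + R).PosDef

/-- An iterate `(x, λ, λ̃)` of the algorithm; the slack variable is always `s = Ax - b`. -/
structure Iterate (n m : ℕ) where
  x : Fin n → ℝ
  lam : Fin m → ℝ
  lamT : Fin m → ℝ

namespace CRMPC

variable {n m : ℕ} (P : CQP n m) (prm : Params P)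

/-- The error function `E(x, λ) = ‖(‖v‖, ‖w‖)‖`, with `v = Hx + c - Aᵀλ` and
`wᵢ = min {|sᵢ|, |λᵢ|}`. -/
def err (x : Fin n → ℝ) (lam : Fin m → ℝ) : ℝ :=
  prm.normE ![prm.normV (P.H *ᵥ x + P.c - P.Aᵀ *ᵥ lam),
    prm.normW (fun i => min |P.slack x i| |lam i|)]

/-- Step 1: the stopping test. -/
def Stops (z : Iterate n m) : Prop :=
  P.grad z.x = 0 ∨
    min (err P prm z.x z.lam) (err P prm z.x (fun i => max (z.lamT i) 0)) < prm.ε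

/-- The duality measure `s_Qᵀλ_Q / |Q|` of the reduced problem (`0` if `Q` is empty). -/
def dualityMeasure (Q : Finset (Fin m)) (s lam : Fin m → ℝ) : ℝ :=
  if Q = ∅ then 0 else (∑ i ∈ Q, s i * lam i) / (Q.card : ℝ)

open Classical in
/-- With `S` a set of step sizes and `ᾱ := max S` (`ᾱ = ∞` if `S` is unbounded above), this is
`min {1, max {κ ᾱ, ᾱ - δ}}`. -/
def stepSize (κ δ : ℝ) (S : Set ℝ) : ℝ :=
  if BddAbove S then min 1 (max (κ * sSup S) (sSup S - δ)) else 1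

/-! ### One iteration

`Q` is the working set. Vectors indexed by `Q` are represented by vectors in `ℝᵐ` that vanish
outside `Q`. -/

section Iteration

variable (Q : Finset (Fin m)) (z : Iterate n m)

/-- Step 2: the regularization parameter `ϱ`. -/
def rho : ℝ := min 1 (err P prm z.x z.lam / prm.Ebar)

/-- Step 2: the regularized Hessian `W = H + ϱR`. -/
def W : Matrix (Fin n) (Fin n) ℝ := P.H + rho P prm z • prm.R

/-- Step 3: the approximate normal matrix `M_(Q) = W + ∑_{i ∈ Q} (λᵢ/sᵢ) aᵢaᵢᵀ`. -/
def M : Matrix (Fin n) (Fin n) ℝ :=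
  W P prm z + ∑ i ∈ Q, (z.lam i / P.slack z.x i) • Matrix.vecMulVec (P.A i) (P.A i)

/-- Step 4: `M_(Q) Δxᵃ = -∇f(x)`. -/
def dxAff : Fin n → ℝ := (M P prm Q z)⁻¹ *ᵥ (-P.grad z.x)

/-- Step 4: `Δsᵃ = A Δxᵃ`. -/
def dsAff : Fin m → ℝ := P.A *ᵥ dxAff P prm Q z

/-- Step 4: `Δλᵃ_Q = -λ_Q - S_Q⁻¹ Λ_Q Δsᵃ_Q`. -/
def dlamAff : Fin m → ℝ := fun i =>
  if i ∈ Q then -z.lam i - z.lam i / P.slack z.x i * dsAff P prm Q z i else 0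

/-- Step 5: the affine-scaling step. -/
def alphaAff : ℝ :=
  sSup {α : ℝ | 0 ≤ α ∧ α ≤ 1 ∧ (∀ i, 0 ≤ P.slack z.x i + α * dsAff P prm Q z i) ∧
    ∀ i ∈ Q, 0 ≤ z.lam i + α * dlamAff P prm Q z i}

/-- Step 6: `μ_(Q)`. -/
def mu : ℝ := dualityMeasure Q (P.slack z.x) z.lam

/-- Step 6: the centering parameter. -/
def sigma : ℝ := (1 - alphaAff P prm Q z) ^ 3

/-- The vector `σ μ_(Q) 1 - ΔSᵃ_Q Δλᵃ_Q` (only its components in `Q` are used). -/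
def corRhs : Fin m → ℝ := fun i =>
  sigma P prm Q z * mu P Q z - dsAff P prm Q z i * dlamAff P prm Q z i

/-- Step 7: the corrector direction, through the normal equations
`M_(Q) Δxᶜ = A_Qᵀ S_Q⁻¹ (σ μ_(Q) 1 - ΔSᵃ_Q Δλᵃ_Q)`. -/
def dxCor : Fin n → ℝ :=
  (M P prm Q z)⁻¹ *ᵥ (∑ i ∈ Q, (corRhs P prm Q z i / P.slack z.x i) • P.A i)

/-- Step 7: `Δsᶜ = A Δxᶜ`. -/
def dsCor : Fin m → ℝ := P.A *ᵥ dxCor P prm Q z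

/-- Step 7: `Δλᶜ_Q = S_Q⁻¹ (-Λ_Q Δsᶜ_Q + σ μ_(Q) 1 - ΔSᵃ_Q Δλᵃ_Q)`. -/
def dlamCor : Fin m → ℝ := fun i =>
  if i ∈ Q then (-(z.lam i * dsCor P prm Q z i) + corRhs P prm Q z i) / P.slack z.x i else 0

/-- Step 8: the parameter `γ₁`. -/
def gamma1 : ℝ :=
  sSup {g : ℝ | 0 ≤ g ∧ g ≤ 1 ∧
    prm.ω * (P.f z.x - P.f (z.x + dxAff P prm Q z)) ≤
      P.f z.x - P.f (z.x + dxAff P prm Q z + g • dxCor P prm Q z)}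

open Classical in
/-- Step 8: the mixing parameter `γ`; the term `τ‖Δxᵃ‖ / (σ μ_(Q))` is `+∞`, hence dropped, when
`σ μ_(Q) = 0`. -/
def gamma : ℝ :=
  if Q = ∅ then 0
  else if dxCor P prm Q z = 0 then 1
  else if sigma P prm Q z * mu P Q z = 0 then
    min (gamma1 P prm Q z)
      (prm.τ * prm.normX (dxAff P prm Q z) / prm.normX (dxCor P prm Q z))
  else
    min (gamma1 P prm Q z)
      (min (prm.τ * prm.normX (dxAff P prm Q z) / prm.normX (dxCor P prm Q z))
        (prm.τ * prm.normX (dxAff P prm Q z) / (sigma P prm Q z * mu P Q z)))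

/-- Step 8: the search direction in `x`. -/
def dx : Fin n → ℝ := dxAff P prm Q z + gamma P prm Q z • dxCor P prm Q z

/-- Step 8: the search direction in `λ_Q`. -/
def dlam : Fin m → ℝ := dlamAff P prm Q z + gamma P prm Q z • dlamCor P prm Q z

/-- Step 8: the search direction in `s`. -/
def ds : Fin m → ℝ := dsAff P prm Q z + gamma P prm Q z • dsCor P prm Q z

/-- Step 9: the primal step size. -/
def alphaPrimal : ℝ :=
  stepSize prm.κ (prm.normX (dx P prm Q z))
    {α : ℝ | ∀ i, 0 ≤ P.slack z.x i + α * ds P prm Q z i}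

/-- Step 9: the dual step size. -/
def alphaDual : ℝ :=
  stepSize prm.κ (prm.normX (dx P prm Q z))
    {α : ℝ | ∀ i ∈ Q, 0 ≤ z.lam i + α * dlam P prm Q z i}

/-- Step 10: the next primal iterate. -/
def xNext : Fin n → ℝ := z.x + alphaPrimal P prm Q z • dx P prm Q z

/-- Step 10: `χ = ‖Δxᵃ‖^ν + ‖[λ_Q + Δλᵃ_Q]₋‖^ν`. -/
def chi : ℝ :=
  prm.normX (dxAff P prm Q z) ^ prm.ν +
    prm.normL (fun i => if i ∈ Q then min (z.lam i + dlamAff P prm Q z i) 0 else 0) ^ prm.ν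

/-- Step 10: the update of the components of `λ` in `Q`. -/
def lamNextIn (i : Fin m) : ℝ :=
  max (min (z.lam i + alphaDual P prm Q z * dlam P prm Q z i) prm.lamMax)
    (min (chi P prm Q z) prm.lamLow)

/-- Step 10: `μ⁺_(Q)`, computed from the updated `s⁺_Q` and `λ⁺_Q`. -/
def muNext : ℝ := dualityMeasure Q (P.slack (xNext P prm Q z)) (lamNextIn P prm Q z)

/-- Step 10: the update of the components of `λ` outside `Q`. -/
def lamNextOut (i : Fin m) : ℝ :=
  max (min (muNext P prm Q z / P.slack (xNext P prm Q z) i) prm.lamMax)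
    (min (chi P prm Q z) prm.lamLow)

/-- One full iteration with working set `Q`. -/
def next : Iterate n m where
  x := xNext P prm Q z
  lam := fun i => if i ∈ Q then lamNextIn P prm Q z i else lamNextOut P prm Q z i
  lamT := fun i => if i ∈ Q then z.lam i + dlam P prm Q z i else 0

/-- The corrector direction solves the reduced Newton-KKT system with right-hand side
`(0, 0, σ μ_(Q) 1 - ΔSᵃ_Q Δλᵃ_Q)`. -/
theorem corrector_solves (hM : IsUnit (M P prm Q z).det)
    (hs : ∀ i ∈ Q, P.slack z.x i ≠ 0) :
    W P prm z *ᵥ dxCor P prm Q z - P.Aᵀ *ᵥ dlamCor P prm Q z = 0 ∧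
    (∀ i ∈ Q, (P.A *ᵥ dxCor P prm Q z) i - dsCor P prm Q z i = 0) ∧
    ∀ i ∈ Q, P.slack z.x i * dlamCor P prm Q z i + z.lam i * dsCor P prm Q z i =
      sigma P prm Q z * mu P Q z - dsAff P prm Q z i * dlamAff P prm Q z i := by
  refine ⟨?_, fun i _ => by simp [dsCor], fun i hi => ?_⟩
  · have h1 : M P prm Q z *ᵥ dxCor P prm Q z =
        ∑ i ∈ Q, (corRhs P prm Q z i / P.slack z.x i) • P.A i := by
      rw [dxCor, Matrix.mulVec_mulVec, Matrix.mul_nonsing_inv _ hM, Matrix.one_mulVec]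
    have h2 : W P prm z *ᵥ dxCor P prm Q z +
        ∑ i ∈ Q, (z.lam i / P.slack z.x i * dsCor P prm Q z i) • P.A i =
        ∑ i ∈ Q, (corRhs P prm Q z i / P.slack z.x i) • P.A i := by
      rw [← h1, M, Matrix.add_mulVec, Matrix.sum_mulVec]
      congr 1
      refine Finset.sum_congr rfl fun i _ => ?_
      rw [Matrix.smul_mulVec, Matrix.vecMulVec_mulVec]
      ext j
      simp only [dsCor, Matrix.mulVec, Pi.smul_apply, smul_eq_mul, MulOpposite.smul_eq_mul_unop,
        MulOpposite.unop_op]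
      ring
    have h3 : P.Aᵀ *ᵥ dlamCor P prm Q z = ∑ i ∈ Q, dlamCor P prm Q z i • P.A i := by
      rw [Matrix.mulVec_transpose, Matrix.vecMul_eq_sum]
      refine (Finset.sum_subset (Finset.subset_univ Q) fun i _ hi => ?_).symm
      simp [dlamCor, hi]
    rw [h3, sub_eq_zero, eq_sub_of_add_eq h2, ← Finset.sum_sub_distrib]
    refine Finset.sum_congr rfl fun i hi => ?_
    rw [← sub_smul]
    congr 1
    simp only [dlamCor, hi, if_true]
    ring
  · simp only [dlamCor, hi, if_true, corRhs]
    field_simp [hs i hi]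
    ring

end Iteration

/-! ### Constraint-selection rules and runs of the algorithm -/

/-- A constraint-selection rule: the working set may depend on all the iterates constructed so
far (listed from the current one back to the initial one). -/
abbrev SelectionRule (n m : ℕ) : Type := List (Iterate n m) → Finset (Fin m)

section Run

variable (rule : SelectionRule n m) (x0 : Fin n → ℝ) (lam0 : Fin m → ℝ)

/-- The initial iterate, with `λ̃ = λ`. -/
def initial : Iterate n m := ⟨x0, lam0, lam0⟩

/-- The list of iterates `k, k - 1, …, 0`; the stopping test is kept separate. -/
def history : ℕ → List (Iterate n m)
  | 0 => [initial x0 lam0]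
  | k + 1 =>
    next P prm (rule (history k)) ((history k).headD (initial x0 lam0)) :: history k

/-- The `k`-th iterate. -/
def iter (k : ℕ) : Iterate n m :=
  (history P prm rule x0 lam0 k).headD (initial x0 lam0)

/-- The working set `Q_k` selected at iteration `k`. -/
def workingSet (k : ℕ) : Finset (Fin m) := rule (history P prm rule x0 lam0 k)

theorem iter_zero : iter P prm rule x0 lam0 0 = initial x0 lam0 := rfl

theorem iter_succ (k : ℕ) : iter P prm rule x0 lam0 (k + 1) =
    next P prm (workingSet P prm rule x0 lam0 k) (iter P prm rule x0 lam0 k) := rfl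

/-- The algorithm never stops in Step 1. -/
def NeverStops : Prop := ∀ k, ¬ Stops P prm (iter P prm rule x0 lam0 k)

/-- The sequence `(x^k, λ^k)` stays at a positive distance from the primal-dual solution set. -/
def BoundedAwayFromSolutions : Prop :=
  ∃ δ > 0, ∀ k, ∀ p ∈ P.primalDualSolutions,
    δ ≤ dist ((iter P prm rule x0 lam0 k).x, (iter P prm rule x0 lam0 k).lam) p

end Run

/-- Condition CSR on the constraint-selection rule: for every infinite sequence constructed by the
algorithm, (i) if `(x^k, λ^k)` is bounded away from the primal-dual solution set and `x^k → x'` on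
an infinite index set `K`, then `Q_k` contains the constraints active at `x'` for all large `k ∈ K`;
(ii) if the primal-dual solution `(x*, λ*)` is unique and strictly complementary and `x^k → x*`,
then `Q_k` contains the constraints active at `x*` for all large `k`. -/
def SatisfiesCSR (rule : SelectionRule n m) : Prop :=
  ∀ (x0 : Fin n → ℝ) (lam0 : Fin m → ℝ), x0 ∈ P.strictlyFeasible → (∀ i, 0 < lam0 i) →
    NeverStops P prm rule x0 lam0 →
    (BoundedAwayFromSolutions P prm rule x0 lam0 →
      ∀ (x' : Fin n → ℝ) (K : Set ℕ), K.Infinite →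
        Tendsto (fun k => (iter P prm rule x0 lam0 k).x) (atTop ⊓ 𝓟 K) (𝓝 x') →
        ∀ᶠ k in atTop ⊓ 𝓟 K, P.active x' ⊆ workingSet P prm rule x0 lam0 k) ∧
    (∀ (xs : Fin n → ℝ) (lams : Fin m → ℝ), P.primalDualSolutions = {(xs, lams)} →
      P.StrictComplementarity xs lams →
      Tendsto (fun k => (iter P prm rule x0 lam0 k).x) atTop (𝓝 xs) →
      ∀ᶠ k in atTop, P.active xs ⊆ workingSet P prm rule x0 lam0 k)

end CRMPC

end

/-! ### Homogeneous functions and norms on `ℝᵏ` -/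

/-! Level sets of `f` on the feasible set are compact, by convexity and boundedness of the solution
set, and the active rows are independent at every feasible point, not only at stationary ones. One
iteration lowers `f` by at least `α_p · (ω/2) · ΔxᵃᵀMΔxᵃ`. Hence, when the matrices `M` are
uniformly positive definite and the primal steps do not collapse, `Δxᵃ → 0`, and at every limit
point the estimates `λ_Q + Δλᵃ_Q` then approach the unique multiplier vector. The steps do not
collapse while the `λᵢ` of the active constraints stay away from zero (`exists_le_alphaPrimal`),
which the floor `min {χ, λ_low}` guarantees as long as `χ` stays away from zero.

The heart is `mapClusterPt_chi`: `χ` clusters at zero. Otherwise `Δxᵃ → 0`, so at every large `k`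
some component of the estimates is at most a fixed `-η`. Stationary points have finitely many
multiplier vectors in all (`finite_multipliers`), so some level `-c`, with `0 < c < η`, is avoided
by all their components. Successive estimates have the same limits, hence cannot cross that level,
and one fixed component remains below it. From then on the slack of this constraint never decreases;
yet its limiting multiplier is nonzero, so by complementarity the slack has limit zero, a
contradiction. Where `χ → 0`, both `Δxᵃ` and the negative parts of the estimates vanish, and the
limit is a KKT pair (`exists_kkt_limit`).

If the iterates are bounded away from the primal-dual solutions, then `E`, hence `ϱ`, is bounded
below, so `M` is coercive and a KKT limit exists. If they are not, the objective values come close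
to the minimum anyway. Monotonicity of `f` gives (i) in both cases. Under the second-order condition
`x^k → x*`, and Condition CSR gives (iii). Coercivity now comes either from `ϱ` or from ratios
`λᵢ/sᵢ ≥ 1` on the active constraints (`isCoerciveRun_of_strict`); then `Δxᵃ → 0` along the whole
sequence, which gives (ii). For (iv), a run that never stops would be bounded away from the
solutions, yet `E(x, [λ̃]₊)` would have limit zero along an ultrafilter. -/

theorem exists_pos_mul_norm_pow_le {k : ℕ} (p : ℕ) (hp : p ≠ 0) (g : (Fin k → ℝ) → ℝ)
    (hg : Continuous g) (hhom : ∀ (t : ℝ) v, 0 ≤ t → g (t • v) = t ^ p * g v)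
    (hpos : ∀ v, v ≠ 0 → 0 < g v) : ∃ c > 0, ∀ v, c * ‖v‖ ^ p ≤ g v := by
  have h0 : g 0 = 0 := by simpa [hp] using hhom 0 0 le_rfl
  by_cases hne : (Metric.sphere (0 : Fin k → ℝ) 1).Nonempty
  · obtain ⟨u, hu, hmin⟩ := (isCompact_sphere (0 : Fin k → ℝ) 1).exists_isMinOn hne hg.continuousOn
    have hu1 : ‖u‖ = 1 := by simpa using hu
    -- The constant is the minimum of `g` on the unit sphere; homogeneity carries the bound to all
    -- vectors.
    refine ⟨g u, hpos u (by rintro rfl; simp at hu1), fun v => ?_⟩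
    by_cases hv : v = 0
    · simp [hv, h0, hp]
    have hnv : 0 < ‖v‖ := norm_pos_iff.2 hv
    have h1 : g u ≤ g (‖v‖⁻¹ • v) := hmin (by simp [norm_smul, hnv.ne'])
    have h2 : g v = ‖v‖ ^ p * g (‖v‖⁻¹ • v) := by
      rw [← hhom _ _ hnv.le, smul_smul, mul_inv_cancel₀ hnv.ne', one_smul]
    rw [h2, mul_comm]
    gcongr
  -- An empty unit sphere means that the space is trivial, so any constant works.
  · refine ⟨1, one_pos, fun v => ?_⟩
    have hv : v = 0 := by
      by_contra hv
      exact hne ⟨‖v‖⁻¹ • v, by simp [norm_smul, norm_ne_zero_iff.2 hv]⟩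
    simp [hv, h0, hp]

namespace VecNorm

variable {k : ℕ} (N : VecNorm k)

theorem nonneg (v : Fin k → ℝ) : 0 ≤ N v := apply_nonneg _ _

theorem map_zero' : N 0 = 0 := map_zero N.toSeminorm

theorem pos_of_ne_zero {v : Fin k → ℝ} (hv : v ≠ 0) : 0 < N v :=
  lt_of_le_of_ne (N.nonneg v) fun h => hv (N.eq_zero_of_map_eq_zero v h.symm)

theorem map_smul (t : ℝ) (v : Fin k → ℝ) : N (t • v) = |t| * N v :=
  map_smul_eq_mul N.toSeminorm _ _

theorem map_add_le (v w : Fin k → ℝ) : N (v + w) ≤ N v + N w :=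
  map_add_le_add N.toSeminorm v w

theorem exists_le_mul_norm : ∃ C : ℝ, 0 < C ∧ ∀ v, N v ≤ C * ‖v‖ := by
  -- The summand `1` only makes the constant positive when `k = 0`.
  refine ⟨∑ i, N (Pi.single i 1) + 1, ?_, fun v => ?_⟩
  · have : 0 ≤ ∑ i, N (Pi.single i 1) := Finset.sum_nonneg fun i _ => N.nonneg _
    linarith
  · have h : N v ≤ ∑ i, N (v i • Pi.single i (1 : ℝ)) := by
      conv_lhs => rw [pi_eq_sum_univ' v]
      exact Finset.le_sum_of_subadditive N N.map_zero'.le N.map_add_le _ _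
    refine h.trans ?_
    rw [add_mul, Finset.sum_mul]
    have : ∑ i, N (v i • Pi.single i (1 : ℝ)) ≤ ∑ i, N (Pi.single i 1) * ‖v‖ := by
      refine Finset.sum_le_sum fun i _ => ?_
      rw [N.map_smul, mul_comm]
      exact mul_le_mul_of_nonneg_left (norm_le_pi_norm v i) (N.nonneg _)
    have := norm_nonneg v
    linarith

theorem continuous : Continuous N := by
  obtain ⟨C, hC, h⟩ := N.exists_le_mul_norm
  refine Seminorm.continuous (p := N.toSeminorm) (r := 1) ?_
  refine Filter.mem_of_superset (Metric.ball_mem_nhds 0 (inv_pos.2 hC)) fun v hv => ?_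
  have hv' : ‖v‖ < C⁻¹ := by simpa using hv
  rw [Seminorm.mem_ball_zero]
  calc N v ≤ C * ‖v‖ := h v
    _ < C * C⁻¹ := by gcongr
    _ = 1 := mul_inv_cancel₀ hC.ne'

theorem exists_mul_norm_le : ∃ c : ℝ, 0 < c ∧ ∀ v, c * ‖v‖ ≤ N v := by
  obtain ⟨c, hc, h⟩ := exists_pos_mul_norm_pow_le 1 one_ne_zero N N.continuous
    (fun t v ht => by rw [N.map_smul, abs_of_nonneg ht, pow_one]) fun v hv => N.pos_of_ne_zero hv
  exact ⟨c, hc, fun v => by simpa using h v⟩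

theorem tendsto_zero_iff {ι : Type*} {l : Filter ι} {u : ι → Fin k → ℝ} :
    Tendsto (fun i => N (u i)) l (𝓝 0) ↔ Tendsto u l (𝓝 0) := by
  constructor
  · intro h
    obtain ⟨c, hc, hcN⟩ := N.exists_mul_norm_le
    rw [tendsto_zero_iff_norm_tendsto_zero]
    refine squeeze_zero (fun _ => norm_nonneg _) (fun i => ?_)
      (by simpa using h.const_mul c⁻¹ : Tendsto (fun i => c⁻¹ * N (u i)) l (𝓝 0))
    rw [le_inv_mul_iff₀ hc]
    exact hcN _
  · intro h
    simpa [N.map_zero', Function.comp_def] using (N.continuous.tendsto 0).comp h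

end VecNorm

/-! ### The convex quadratic program -/

namespace CQP

variable {n m : ℕ} (P : CQP n m)

theorem H_quad_nonneg (d : Fin n → ℝ) : 0 ≤ d ⬝ᵥ (P.H *ᵥ d) := by
  simpa using P.H_posSemidef.dotProduct_mulVec_nonneg d

theorem H_transpose : P.Hᵀ = P.H := by
  simpa [Matrix.IsHermitian, Matrix.conjTranspose_eq_transpose_of_trivial] using
    P.H_posSemidef.isHermitian

theorem H_symm (x y : Fin n → ℝ) : x ⬝ᵥ (P.H *ᵥ y) = y ⬝ᵥ (P.H *ᵥ x) := by
  rw [Matrix.dotProduct_mulVec, ← Matrix.mulVec_transpose, P.H_transpose, dotProduct_comm]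

theorem f_add (x d : Fin n → ℝ) :
    P.f (x + d) = P.f x + P.grad x ⬝ᵥ d + 1 / 2 * (d ⬝ᵥ (P.H *ᵥ d)) := by
  simp only [f, grad, Matrix.mulVec_add, dotProduct_add, add_dotProduct]
  rw [P.H_symm x d, dotProduct_comm (P.H *ᵥ x) d]
  ring

theorem f_add_smul (x d : Fin n → ℝ) (t : ℝ) :
    P.f (x + t • d) = P.f x + t * (P.grad x ⬝ᵥ d) + 1 / 2 * t ^ 2 * (d ⬝ᵥ (P.H *ᵥ d)) := by
  rw [f_add, Matrix.mulVec_smul, dotProduct_smul, smul_dotProduct, dotProduct_smul]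
  simp only [smul_eq_mul]
  ring

theorem f_add_smul_le (x d : Fin n → ℝ) {t : ℝ} (h0 : 0 ≤ t) (h1 : t ≤ 1) :
    P.f (x + t • d) ≤ (1 - t) * P.f x + t * P.f (x + d) := by
  rw [f_add_smul, f_add]
  nlinarith [mul_nonneg (mul_nonneg h0 (sub_nonneg.2 h1)) (P.H_quad_nonneg d)]

theorem continuous_mulVec {k l : ℕ} (B : Matrix (Fin k) (Fin l) ℝ) :
    Continuous fun x : Fin l → ℝ => B *ᵥ x :=
  Continuous.matrix_mulVec continuous_const continuous_id

theorem continuous_grad : Continuous P.grad := (continuous_mulVec P.H).add continuous_const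

theorem continuous_slack : Continuous P.slack := (continuous_mulVec P.A).sub continuous_const

theorem continuous_f : Continuous P.f := by
  unfold f
  have h1 : Continuous fun x : Fin n → ℝ => x ⬝ᵥ (P.H *ᵥ x) :=
    Continuous.dotProduct continuous_id (continuous_mulVec P.H)
  have h2 : Continuous fun x : Fin n → ℝ => P.c ⬝ᵥ x :=
    Continuous.dotProduct continuous_const continuous_id
  fun_prop

theorem slack_add_smul (x d : Fin n → ℝ) (t : ℝ) :
    P.slack (x + t • d) = P.slack x + t • (P.A *ᵥ d) := by
  simp only [slack, Matrix.mulVec_add, Matrix.mulVec_smul]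
  abel

theorem mem_feasible_iff {x : Fin n → ℝ} : x ∈ P.feasible ↔ ∀ i, 0 ≤ P.slack x i := by
  simp [feasible, slack]

theorem mem_strictlyFeasible_iff {x : Fin n → ℝ} :
    x ∈ P.strictlyFeasible ↔ ∀ i, 0 < P.slack x i := by
  simp [strictlyFeasible, slack]

theorem mem_active_iff {x : Fin n → ℝ} {i : Fin m} : i ∈ P.active x ↔ P.slack x i = 0 := by
  simp [active, slack, sub_eq_zero]

theorem isClosed_feasible : IsClosed P.feasible := by
  have : P.feasible = ⋂ i, {x | 0 ≤ P.slack x i} := by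
    ext x; simp [mem_feasible_iff]
  rw [this]
  exact isClosed_iInter fun i =>
    isClosed_le continuous_const ((continuous_apply i).comp P.continuous_slack)

/-- The vector `lam` satisfies the stationarity and complementarity conditions at `x`. -/
def IsMultiplier (x : Fin n → ℝ) (lam : Fin m → ℝ) : Prop :=
  P.Aᵀ *ᵥ lam = P.grad x ∧ ∀ i ∉ P.active x, lam i = 0

variable {P}

theorem isMultiplier_iff {x : Fin n → ℝ} {lam : Fin m → ℝ} :
    P.IsMultiplier x lam ↔
      P.H *ᵥ x - P.Aᵀ *ᵥ lam + P.c = 0 ∧ ∀ i, P.slack x i * lam i = 0 := by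
  unfold IsMultiplier grad
  refine and_congr ⟨fun h => by rw [h]; abel, fun h => ?_⟩ (forall_congr' fun i => ?_)
  · rw [eq_comm, ← sub_eq_zero, ← h]; abel
  · rw [mem_active_iff, mul_eq_zero]; tauto

theorem isStationary_iff {x : Fin n → ℝ} :
    P.IsStationary x ↔ x ∈ P.feasible ∧ ∃ lam, P.IsMultiplier x lam := by
  simp only [IsStationary, isMultiplier_iff]

theorem kkt_iff {x : Fin n → ℝ} {lam : Fin m → ℝ} :
    P.KKT x lam ↔ P.IsMultiplier x lam ∧ x ∈ P.feasible ∧ ∀ i, 0 ≤ lam i := by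
  simp only [KKT, isMultiplier_iff, mem_feasible_iff, and_assoc]

theorem dotProduct_transpose_mulVec (lam : Fin m → ℝ) (d : Fin n → ℝ) :
    (P.Aᵀ *ᵥ lam) ⬝ᵥ d = lam ⬝ᵥ (P.A *ᵥ d) := by
  rw [Matrix.mulVec_transpose, Matrix.dotProduct_mulVec]

theorem transpose_mulVec_eq_sum (lam : Fin m → ℝ) : P.Aᵀ *ᵥ lam = ∑ i, lam i • P.A i := by
  rw [Matrix.mulVec_transpose, Matrix.vecMul_eq_sum]

theorem mulVec_sub_eq_slack (x y : Fin n → ℝ) : P.A *ᵥ (y - x) = P.slack y - P.slack x := by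
  simp [slack, Matrix.mulVec_sub]

/-- The first-order term `∇f(x)ᵀ(y - x)` equals `∑ λᵢ (sᵢ(y) - sᵢ(x))`, which is nonnegative by
complementarity; convexity does the rest. -/
theorem KKT.mem_primalSolutions {x : Fin n → ℝ} {lam : Fin m → ℝ} (h : P.KKT x lam) :
    x ∈ P.primalSolutions := by
  obtain ⟨⟨hg, hc⟩, hf, hl⟩ := kkt_iff.1 h
  refine ⟨hf, fun y hy => ?_⟩
  have h1 := P.f_add x (y - x)
  rw [add_sub_cancel] at h1
  have h2 : 0 ≤ P.grad x ⬝ᵥ (y - x) := by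
    rw [← hg, dotProduct_transpose_mulVec, mulVec_sub_eq_slack]
    refine Finset.sum_nonneg fun i _ => ?_
    by_cases hi : i ∈ P.active x
    · have := P.mem_active_iff.1 hi
      have := P.mem_feasible_iff.1 hy i
      simp only [Pi.sub_apply]
      exact mul_nonneg (hl i) (by linarith)
    · simp [hc i hi]
  have := P.H_quad_nonneg (y - x)
  linarith

theorem isClosed_primalDualSolutions : IsClosed P.primalDualSolutions := by
  have h1 : Continuous fun p : (Fin n → ℝ) × (Fin m → ℝ) => P.slack p.1 :=
    P.continuous_slack.comp continuous_fst
  have h2 : Continuous fun p : (Fin n → ℝ) × (Fin m → ℝ) =>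
      P.H *ᵥ p.1 - P.Aᵀ *ᵥ p.2 + P.c :=
    (((continuous_mulVec P.H).comp continuous_fst).sub
      ((continuous_mulVec P.Aᵀ).comp continuous_snd)).add continuous_const
  have h3 : ∀ i, Continuous fun p : (Fin n → ℝ) × (Fin m → ℝ) => P.slack p.1 i := fun i =>
    (continuous_apply i).comp h1
  have h4 : ∀ i, Continuous fun p : (Fin n → ℝ) × (Fin m → ℝ) => p.2 i := fun i =>
    (continuous_apply i).comp continuous_snd
  have : P.primalDualSolutions = {p | P.H *ᵥ p.1 - P.Aᵀ *ᵥ p.2 + P.c = 0} ∩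
      ((⋂ i, {p | P.slack p.1 i * p.2 i = 0}) ∩
      ((⋂ i, {p | 0 ≤ P.slack p.1 i}) ∩ ⋂ i, {p | 0 ≤ p.2 i})) := by
    ext p
    simp only [primalDualSolutions, KKT, Set.mem_ofPred_eq, Set.mem_inter_iff, Set.mem_iInter]
  rw [this]
  refine (isClosed_eq h2 continuous_const).inter
    ((isClosed_iInter fun i => isClosed_eq ((h3 i).mul (h4 i)) continuous_const).inter
    ((isClosed_iInter fun i => isClosed_le continuous_const (h3 i)).inter
      (isClosed_iInter fun i => isClosed_le continuous_const (h4 i))))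

/-! ### Level sets -/

variable (P) in
/-- A sublevel set of the objective on the feasible set. -/
def level (r : ℝ) : Set (Fin n → ℝ) := {x | x ∈ P.feasible ∧ P.f x ≤ r}

theorem isClosed_level (r : ℝ) : IsClosed (P.level r) :=
  P.isClosed_feasible.inter (isClosed_le P.continuous_f continuous_const)

theorem convex_comb_mem_feasible {x y : Fin n → ℝ} (hx : x ∈ P.feasible) (hy : y ∈ P.feasible)
    {t : ℝ} (h0 : 0 ≤ t) (h1 : t ≤ 1) : x + t • (y - x) ∈ P.feasible := by
  rw [mem_feasible_iff] at *
  intro i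
  rw [slack_add_smul, mulVec_sub_eq_slack]
  simp only [Pi.add_apply, Pi.smul_apply, Pi.sub_apply, smul_eq_mul]
  nlinarith [mul_nonneg (sub_nonneg.2 h1) (hx i), mul_nonneg h0 (hy i)]

/-- On a sphere around a minimizer that encloses all minimizers, `f` exceeds its minimum by some `η
> 0`. By convexity `f` then grows at least linearly along rays that leave the ball, so a bound on
`f` bounds the distance. -/
theorem isBounded_level (hne : P.primalSolutions.Nonempty)
    (hb : Bornology.IsBounded P.primalSolutions) (r : ℝ) : Bornology.IsBounded (P.level r) := by
  obtain ⟨xs, hxs⟩ := hne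
  obtain ⟨ρ, hρ0, hρ⟩ : ∃ ρ > 0, P.primalSolutions ⊆ Metric.ball xs ρ := by
    obtain ⟨ρ, hρ⟩ := hb.subset_ball xs
    exact ⟨max ρ 1, by positivity, hρ.trans (Metric.ball_subset_ball (le_max_left _ _))⟩
  have hcomp : IsCompact (Metric.sphere xs ρ ∩ P.feasible) :=
    (isCompact_sphere xs ρ).inter_right P.isClosed_feasible
  obtain ⟨η, hη, hsph⟩ : ∃ η > 0, ∀ z ∈ Metric.sphere xs ρ ∩ P.feasible,
      P.f xs + η ≤ P.f z := by
    by_cases hemp : (Metric.sphere xs ρ ∩ P.feasible).Nonempty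
    · obtain ⟨z, hz, hmin⟩ := hcomp.exists_isMinOn hemp P.continuous_f.continuousOn
      refine ⟨P.f z - P.f xs, ?_, fun y hy => ?_⟩
      · have h1 := hxs.2 z hz.2
        rcases h1.lt_or_eq with h | h
        · linarith
        · exfalso
          have hzs : z ∈ P.primalSolutions := ⟨hz.2, fun y hy => h ▸ hxs.2 y hy⟩
          have := hρ hzs
          have h2 := hz.1
          rw [Metric.mem_ball] at this
          rw [Metric.mem_sphere] at h2
          linarith
      · have : P.f z ≤ P.f y := hmin hy
        linarith
    · exact ⟨1, one_pos, fun z hz => (hemp ⟨z, hz⟩).elim⟩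
  refine (Metric.isBounded_closedBall (x := xs) (r := max ρ (ρ * (r - P.f xs) / η))).subset ?_
  rintro x ⟨hx, hxr⟩
  rw [Metric.mem_closedBall]
  by_cases hd : dist x xs ≤ ρ
  · exact hd.trans (le_max_left _ _)
  push Not at hd
  refine le_trans ?_ (le_max_right _ _)
  have hd0 : 0 < dist x xs := hρ0.trans hd
  have ht0 : 0 ≤ ρ / dist x xs := by positivity
  have ht1 : ρ / dist x xs ≤ 1 := (div_le_one hd0).2 hd.le
  -- The point where the segment from `xs` to `x` crosses the sphere.
  have hz := hsph (xs + (ρ / dist x xs) • (x - xs)) ⟨by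
    rw [mem_sphere_iff_norm, add_sub_cancel_left, norm_smul, ← dist_eq_norm, Real.norm_eq_abs,
      abs_of_nonneg ht0, div_mul_cancel₀ _ hd0.ne'], convex_comb_mem_feasible hxs.1 hx ht0 ht1⟩
  have h2 := P.f_add_smul_le xs (x - xs) ht0 ht1
  rw [add_sub_cancel] at h2
  have h3 : η ≤ ρ / dist x xs * (r - P.f xs) := by
    have : ρ / dist x xs * P.f x ≤ ρ / dist x xs * r := by gcongr
    linarith
  rw [div_mul_eq_mul_div, le_div_iff₀ hd0] at h3
  rw [le_div_iff₀ hη]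
  linarith

theorem isCompact_level (hne : P.primalSolutions.Nonempty)
    (hb : Bornology.IsBounded P.primalSolutions) (r : ℝ) : IsCompact (P.level r) :=
  Metric.isCompact_of_isClosed_isBounded (isClosed_level r) (isBounded_level hne hb r)

/-! ### Linear independence of active constraints -/

theorem sum_smul_eq_sum_subtype {k : ℕ} {E : Type*} [AddCommMonoid E] [Module ℝ E]
    (J : Set (Fin k)) [Fintype J] (y : Fin k → ℝ) (v : Fin k → E) (hy : ∀ i ∉ J, y i = 0) :
    ∑ i, y i • v i = ∑ i : J, y i • v i := by
  classical
  rw [← Finset.sum_subtype (Finset.univ.filter (· ∈ J)) (by simp) fun i => y i • v i]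
  refine (Finset.sum_subset (Finset.subset_univ _) fun i _ hi => ?_).symm
  rw [hy i (by simpa using hi), zero_smul]

/-- A linear form that vanishes wherever the forms `a_i`, `i ∈ J`, do is a combination of these. -/
theorem exists_transpose_mulVec_eq (J : Set (Fin m)) (g : Fin n → ℝ)
    (h : ∀ d, (∀ i ∈ J, (P.A *ᵥ d) i = 0) → g ⬝ᵥ d = 0) :
    ∃ lam : Fin m → ℝ, P.Aᵀ *ᵥ lam = g ∧ ∀ i ∉ J, lam i = 0 := by
  classical
  let φ : (Fin n → ℝ) →ₗ[ℝ] ((Fin n → ℝ) →ₗ[ℝ] ℝ) := dotProductBilin ℝ ℝ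
  have hφ : ∀ v d, φ v d = v ⬝ᵥ d := fun v d => rfl
  have key : φ g ∈ Submodule.span ℝ (Set.range fun i : J => φ (P.A i)) := by
    refine mem_span_of_iInf_ker_le_ker fun d hd => ?_
    rw [LinearMap.mem_ker, hφ]
    refine h d fun i hi => ?_
    have := (Submodule.mem_iInf _).1 hd ⟨i, hi⟩
    rwa [LinearMap.mem_ker, hφ] at this
  obtain ⟨c, hc⟩ := (Submodule.mem_span_range_iff_exists_fun ℝ).1 key
  refine ⟨fun i => if hi : i ∈ J then c ⟨i, hi⟩ else 0, ?_, fun i hi => by simp [hi]⟩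
  rw [transpose_mulVec_eq_sum]
  refine (sum_smul_eq_sum_subtype J (fun i => if hi : i ∈ J then c ⟨i, hi⟩ else 0)
    (fun i => P.A i) fun i hi => by simp [hi]).trans ?_
  ext j
  have h1 : (∑ i, c i • φ (P.A i)) (Pi.single j 1) = φ g (Pi.single j 1) := by rw [hc]
  simpa [hφ] using h1

/-- Minimizing `f` over the feasible points at which the constraints active at `x` remain active
yields a stationary point `z` whose active set contains that of `x`. Independence at `z` is
inherited by the subfamily. -/
theorem licq_of_feasible (hne : P.primalSolutions.Nonempty)
    (hb : Bornology.IsBounded P.primalSolutions) (hind : P.StationaryLinearlyIndependent)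
    {x : Fin n → ℝ} (hx : x ∈ P.feasible) : LinearIndependent ℝ (fun i : P.active x => P.A i) := by
  have hcl : IsClosed {y | ∀ i ∈ P.active x, P.slack y i = 0} := by
    simp only [Set.ofPred_forall]
    exact isClosed_iInter fun i => isClosed_iInter fun _ =>
      isClosed_eq ((continuous_apply i).comp P.continuous_slack) continuous_const
  obtain ⟨z, ⟨hz, hzx⟩, hmin⟩ := ((isCompact_level hne hb (P.f x)).inter_right hcl).exists_isMinOn
    ⟨x, ⟨hx, le_rfl⟩, fun i hi => P.mem_active_iff.1 hi⟩ P.continuous_f.continuousOn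
  have hsub : P.active x ⊆ P.active z := fun i hi => P.mem_active_iff.2 (hzx i hi)
  have hstat : P.IsStationary z := by
    refine isStationary_iff.2 ⟨hz.1, exists_transpose_mulVec_eq _ _ fun d hd => ?_⟩
    have hfeas : ∀ᶠ t in 𝓝 (0 : ℝ), z + t • d ∈ P.feasible := by
      simp only [mem_feasible_iff, eventually_all]
      intro i
      by_cases hi : i ∈ P.active z
      · refine Eventually.of_forall fun t => ?_
        rw [slack_add_smul, Pi.add_apply, Pi.smul_apply, hd i hi, P.mem_active_iff.1 hi]
        simp
      · have h0 : 0 < P.slack z i := lt_of_le_of_ne (P.mem_feasible_iff.1 hz.1 i)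
          fun h => hi (P.mem_active_iff.2 h.symm)
        have hcont : Continuous fun t : ℝ => P.slack (z + t • d) i :=
          (continuous_apply i).comp (P.continuous_slack.comp (by fun_prop))
        have := hcont.tendsto 0
        simp only [zero_smul, add_zero] at this
        filter_upwards [this.eventually (lt_mem_nhds h0)] with t ht using ht.le
    -- A nearby point with a smaller value would lie in the level set and in the face over which `z`
    -- is minimal. Thus `f` has a local minimum along each direction that annihilates the active
    -- rows.
    have hloc : ∀ᶠ t in 𝓝 (0 : ℝ), P.f z ≤ P.f (z + t • d) := by
      filter_upwards [hfeas] with t ht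
      by_contra hlt
      push Not at hlt
      refine absurd (hmin ⟨⟨ht, hlt.le.trans hz.2⟩, fun i hi => ?_⟩) (not_le.2 hlt)
      rw [slack_add_smul, Pi.add_apply, Pi.smul_apply, hd i (hsub hi), hzx i hi]
      simp
    have hder : HasDerivAt (fun t : ℝ => P.f (z + t • d)) (P.grad z ⬝ᵥ d) 0 := by
      have h1 : HasDerivAt (fun t : ℝ => P.f z + t * (P.grad z ⬝ᵥ d) +
          1 / 2 * t ^ 2 * (d ⬝ᵥ (P.H *ᵥ d))) (P.grad z ⬝ᵥ d) 0 := by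
        refine ((((hasDerivAt_id (0 : ℝ)).mul_const (P.grad z ⬝ᵥ d)).const_add (P.f z)).add
          ((((hasDerivAt_id (0 : ℝ)).pow 2).const_mul (1 / 2)).mul_const
            (d ⬝ᵥ (P.H *ᵥ d)))).congr_deriv ?_
        simp
      exact h1.congr_of_eventuallyEq (Eventually.of_forall fun t => P.f_add_smul z d t)
    exact IsLocalMin.hasDerivAt_eq_zero (f := fun t : ℝ => P.f (z + t • d))
      (by simpa [IsLocalMin, IsMinFilter] using hloc) hder
  exact (hind z hstat).comp (fun i : P.active x => (⟨i, hsub i.2⟩ : P.active z))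
    fun i j hij => Subtype.ext (congrArg (fun k : P.active z => (k : Fin m)) hij)

/-- If the rows of `A` in `J` are linearly independent, then vectors supported on `J` depend
linearly on their images under `Aᵀ`. -/
theorem exists_leftInverse {J : Set (Fin m)} (hJ : LinearIndependent ℝ (fun i : J => P.A i)) :
    ∃ G : (Fin n → ℝ) →L[ℝ] (Fin m → ℝ), ∀ y, (∀ i ∉ J, y i = 0) → G (P.Aᵀ *ᵥ y) = y := by
  classical
  let V : Submodule ℝ (Fin m → ℝ) :=
    { carrier := {y | ∀ i ∉ J, y i = 0}
      add_mem' := fun ha hb i hi => by simp [ha i hi, hb i hi]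
      zero_mem' := fun i _ => rfl
      smul_mem' := fun c y hy i hi => by simp [hy i hi] }
  -- Independence of the rows in `J` is injectivity of `Aᵀ` on vectors supported on `J`.
  have hker : (P.Aᵀ.mulVecLin ∘ₗ V.subtype).ker = ⊥ := by
    rw [LinearMap.ker_eq_bot']
    rintro ⟨y, hy⟩ h
    have h' : P.Aᵀ *ᵥ y = 0 := h
    rw [transpose_mulVec_eq_sum] at h'
    have h2 : ∑ i : J, y i • P.A i = 0 := by
      rw [← h']
      exact (sum_smul_eq_sum_subtype J y (fun i => P.A i) hy).symm
    have h3 := Fintype.linearIndependent_iff.1 hJ (fun i => y i) h2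
    ext i
    by_cases hi : i ∈ J
    · exact h3 ⟨i, hi⟩
    · exact hy i hi
  obtain ⟨g, hg⟩ := LinearMap.exists_leftInverse_of_injective _ hker
  refine ⟨LinearMap.toContinuousLinearMap (V.subtype ∘ₗ g), fun y hy => ?_⟩
  have := LinearMap.congr_fun hg ⟨y, hy⟩
  exact congrArg Subtype.val this

theorem IsMultiplier.eq {x : Fin n → ℝ} {l1 l2 : Fin m → ℝ}
    (hx : LinearIndependent ℝ (fun i : P.active x => P.A i)) (h1 : P.IsMultiplier x l1)
    (h2 : P.IsMultiplier x l2) : l1 = l2 := by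
  obtain ⟨G, hG⟩ := exists_leftInverse hx
  rw [← hG l1 h1.2, ← hG l2 h2.2, h1.1, h2.1]

/-- Under the assumptions of the theorem only finitely many vectors are multipliers of a
stationary point. -/
theorem finite_multipliers (hli : ∀ x ∈ P.feasible, LinearIndependent ℝ
    (fun i : P.active x => P.A i)) :
    {lam | ∃ x ∈ P.feasible, P.IsMultiplier x lam}.Finite := by
  refine (Set.finite_iUnion (f := fun J : Set (Fin m) =>
    {lam | ∃ x ∈ P.feasible, P.active x = J ∧ P.IsMultiplier x lam}) fun J => ?_).subset ?_
  -- The active set determines the multiplier. For two such points, both gradients are orthogonal to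
  -- `x - y`, so `(x - y)ᵀH(x - y) = 0`, whence the gradients agree and independence applies.
  · refine Set.Subsingleton.finite ?_
    rintro l1 ⟨x, hx, hxJ, h1⟩ l2 ⟨y, hy, hyJ, h2⟩
    have hA : ∀ i ∈ J, (P.A *ᵥ (x - y)) i = 0 := fun i hi => by
      rw [mulVec_sub_eq_slack, Pi.sub_apply, P.mem_active_iff.1 (hxJ ▸ hi),
        P.mem_active_iff.1 (hyJ ▸ hi), sub_zero]
    have horth : ∀ l : Fin m → ℝ, (∀ i ∉ J, l i = 0) → (P.Aᵀ *ᵥ l) ⬝ᵥ (x - y) = 0 := by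
      intro l hl
      rw [dotProduct_transpose_mulVec]
      refine Finset.sum_eq_zero fun i _ => ?_
      by_cases hi : i ∈ J
      · rw [hA i hi, mul_zero]
      · rw [hl i hi, zero_mul]
    have h3 : (P.grad x - P.grad y) ⬝ᵥ (x - y) = 0 := by
      rw [sub_dotProduct, ← h1.1, ← h2.1, horth l1 (hxJ ▸ h1.2), horth l2 (hyJ ▸ h2.2), sub_zero]
    have h4 : P.grad x - P.grad y = P.H *ᵥ (x - y) := by
      simp [grad, Matrix.mulVec_sub]
    have h5 : P.H *ᵥ (x - y) = 0 := by
      rw [← P.H_posSemidef.dotProduct_mulVec_zero_iff]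
      rw [h4, dotProduct_comm] at h3
      simpa using h3
    have h6 : P.grad x = P.grad y := by rwa [h5, sub_eq_zero] at h4
    exact IsMultiplier.eq (hli x hx) h1 ⟨h6 ▸ h2.1, fun i hi => h2.2 i (by rwa [hyJ, ← hxJ])⟩
  · rintro l ⟨x, hx, h⟩
    exact Set.mem_iUnion.2 ⟨P.active x, x, hx, rfl, h⟩

/-! ### Consequences of the second-order sufficient condition -/

/-- For another minimizer `y`, the difference `f(y) - f(x*) = 0` is a sum of the nonnegative terms
`λᵢ* (A(y - x*))ᵢ` and half the curvature. All of them vanish, so `y - x*` is a critical direction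
of zero curvature. -/
theorem SecondOrderSufficientStrict.primalSolutions_eq {xs : Fin n → ℝ} {lams : Fin m → ℝ}
    (h : P.SecondOrderSufficientStrict xs lams) : P.primalSolutions = {xs} := by
  obtain ⟨hk, hso, -⟩ := h
  have hxs := hk.mem_primalSolutions
  refine Set.eq_singleton_iff_unique_mem.2 ⟨hxs, fun y hy => ?_⟩
  obtain ⟨⟨hg, hc⟩, hf, hl⟩ := kkt_iff.1 hk
  by_contra hne
  have hd : y - xs ≠ 0 := sub_ne_zero.2 hne
  have h1 := P.f_add xs (y - xs)
  rw [add_sub_cancel] at h1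
  have hterm : ∀ i, 0 ≤ lams i * (P.A *ᵥ (y - xs)) i := fun i => by
    by_cases hi : i ∈ P.active xs
    · rw [mulVec_sub_eq_slack, Pi.sub_apply, P.mem_active_iff.1 hi, sub_zero]
      exact mul_nonneg (hl i) (P.mem_feasible_iff.1 hy.1 i)
    · simp [hc i hi]
  have h2 : P.grad xs ⬝ᵥ (y - xs) = ∑ i, lams i * (P.A *ᵥ (y - xs)) i := by
    rw [← hg, dotProduct_transpose_mulVec]; rfl
  have h3 : 0 ≤ ∑ i, lams i * (P.A *ᵥ (y - xs)) i := Finset.sum_nonneg fun i _ => hterm i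
  have h4 := P.H_quad_nonneg (y - xs)
  have h5 := hy.2 xs hxs.1
  have h6 : ∑ i, lams i * (P.A *ᵥ (y - xs)) i = 0 := by linarith
  have h7 := (Finset.sum_eq_zero_iff_of_nonneg fun i _ => hterm i).1 h6
  have := hso (y - xs) (fun i hi => ⟨?_, fun hpos => ?_⟩) hd
  · linarith
  · rw [mulVec_sub_eq_slack, Pi.sub_apply, P.mem_active_iff.1 hi, sub_zero]
    exact P.mem_feasible_iff.1 hy.1 i
  · exact (mul_eq_zero.1 (h7 i (Finset.mem_univ i))).resolve_left hpos.ne'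

theorem SecondOrderSufficientStrict.primalDualSolutions_eq {xs : Fin n → ℝ} {lams : Fin m → ℝ}
    (h : P.SecondOrderSufficientStrict xs lams)
    (hli : LinearIndependent ℝ (fun i : P.active xs => P.A i)) :
    P.primalDualSolutions = {(xs, lams)} := by
  refine Set.eq_singleton_iff_unique_mem.2 ⟨h.1, ?_⟩
  rintro ⟨x, lam⟩ hx
  have hx' : P.KKT x lam := hx
  have h1 : x = xs := by
    have := hx'.mem_primalSolutions
    rwa [h.primalSolutions_eq] at this
  subst h1
  rw [IsMultiplier.eq hli (kkt_iff.1 hx').1 (kkt_iff.1 h.1).1]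

theorem SecondOrderSufficientStrict.pos_of_active {xs : Fin n → ℝ} {lams : Fin m → ℝ}
    (h : P.SecondOrderSufficientStrict xs lams) {i : Fin m} (hi : i ∈ P.active xs) :
    0 < lams i := by
  have := h.2.2 i
  rwa [P.mem_active_iff.1 hi, zero_add] at this

/-- The second-order condition makes the Hessian positive definite once the squares of the
active constraints are added. -/
theorem SecondOrderSufficientStrict.exists_quad_bound {xs : Fin n → ℝ} {lams : Fin m → ℝ}
    (h : P.SecondOrderSufficientStrict xs lams) [Fintype (P.active xs)] : ∃ c > 0, ∀ d : Fin n → ℝ,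
      c * ‖d‖ ^ 2 ≤ d ⬝ᵥ (P.H *ᵥ d) + ∑ i : P.active xs, (P.A *ᵥ d) i ^ 2 := by
  refine exists_pos_mul_norm_pow_le 2 two_ne_zero _ ?_ (fun t v _ => ?_) fun v hv => ?_
  · have h1 : Continuous fun x : Fin n → ℝ => x ⬝ᵥ (P.H *ᵥ x) :=
      Continuous.dotProduct continuous_id (continuous_mulVec P.H)
    have h2 : ∀ i, Continuous fun x : Fin n → ℝ => (P.A *ᵥ x) i := fun i =>
      (continuous_apply i).comp (continuous_mulVec P.A)
    exact h1.add (continuous_finsetSum _ fun i _ => (h2 i).pow 2)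
  · simp only [Matrix.mulVec_smul, dotProduct_smul, smul_dotProduct, Pi.smul_apply, smul_eq_mul,
      mul_add, Finset.mul_sum, mul_pow]
    ring
  · have h0 : 0 ≤ ∑ i : P.active xs, (P.A *ᵥ v) i ^ 2 := Finset.sum_nonneg fun i _ => sq_nonneg _
    rcases h0.eq_or_lt with h1 | h1
    · have h2 := (Finset.sum_eq_zero_iff_of_nonneg fun (i : P.active xs) _ =>
        sq_nonneg ((P.A *ᵥ v) i)).1 h1.symm
      have h3 : ∀ i ∈ P.active xs, (P.A *ᵥ v) i = 0 := fun i hi =>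
        pow_eq_zero_iff two_ne_zero |>.1 (h2 ⟨i, hi⟩ (Finset.mem_univ _))
      have := h.2.1 v (fun i hi => ⟨(h3 i hi).ge, fun _ => h3 i hi⟩) hv
      linarith
    · linarith [P.H_quad_nonneg v]

end CQP

namespace CRMPC

variable {n m : ℕ} (P : CQP n m) (prm : Params P)

/-! ### The error function -/

theorem err_nonneg (x : Fin n → ℝ) (lam : Fin m → ℝ) : 0 ≤ err P prm x lam := prm.normE.nonneg _

theorem err_eq_zero_iff {x : Fin n → ℝ} {lam : Fin m → ℝ} :
    err P prm x lam = 0 ↔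
      P.Aᵀ *ᵥ lam = P.grad x ∧ ∀ i, P.slack x i = 0 ∨ lam i = 0 := by
  have hw : (∀ i, P.slack x i = 0 ∨ lam i = 0) ↔
      (fun i => min |P.slack x i| |lam i|) = (0 : Fin m → ℝ) := by
    rw [funext_iff]
    refine forall_congr' fun i => ?_
    constructor
    · rintro (h | h) <;> simp [h]
    · intro h
      rcases min_choice |P.slack x i| |lam i| with h' | h' <;> simp [h'] at h <;> simp [h]
  have hv : P.Aᵀ *ᵥ lam = P.grad x ↔ P.H *ᵥ x + P.c - P.Aᵀ *ᵥ lam = 0 := by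
    rw [sub_eq_zero, eq_comm]; rfl
  rw [hw, hv]
  constructor
  · intro h
    have h1 := prm.normE.eq_zero_of_map_eq_zero _ h
    have h2 := congrFun h1 0
    have h3 := congrFun h1 1
    exact ⟨prm.normV.eq_zero_of_map_eq_zero _ h2, prm.normW.eq_zero_of_map_eq_zero _ h3⟩
  · rintro ⟨h1, h2⟩
    unfold err
    rw [h1, h2, VecNorm.map_zero', VecNorm.map_zero']
    convert prm.normE.map_zero' using 2
    ext i; fin_cases i <;> rfl

variable {P} in
theorem err_eq_zero_iff_kkt {x : Fin n → ℝ} {lam : Fin m → ℝ} (hx : x ∈ P.feasible)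
    (hl : ∀ i, 0 ≤ lam i) : err P prm x lam = 0 ↔ P.KKT x lam := by
  rw [err_eq_zero_iff, CQP.kkt_iff, CQP.IsMultiplier]
  simp only [P.mem_active_iff]
  refine ⟨fun h => ⟨⟨h.1, fun i hi => (h.2 i).resolve_left hi⟩, hx, hl⟩, fun h => ⟨h.1.1, ?_⟩⟩
  intro i
  by_cases hi : P.slack x i = 0
  · exact Or.inl hi
  · exact Or.inr (h.1.2 i hi)

theorem continuous_err : Continuous fun p : (Fin n → ℝ) × (Fin m → ℝ) => err P prm p.1 p.2 := by
  have h1 : Continuous fun p : (Fin n → ℝ) × (Fin m → ℝ) =>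
      prm.normV (P.H *ᵥ p.1 + P.c - P.Aᵀ *ᵥ p.2) :=
    prm.normV.continuous.comp ((P.continuous_grad.comp continuous_fst).sub
      ((CQP.continuous_mulVec P.Aᵀ).comp continuous_snd))
  have h2 : Continuous fun p : (Fin n → ℝ) × (Fin m → ℝ) =>
      prm.normW (fun i => min |P.slack p.1 i| |p.2 i|) := by
    refine prm.normW.continuous.comp (continuous_pi fun i => ?_)
    exact (((continuous_apply i).comp (P.continuous_slack.comp continuous_fst)).abs).min
      (((continuous_apply i).comp continuous_snd).abs)
  refine prm.normE.continuous.comp (continuous_pi fun i => ?_)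
  fin_cases i
  · exact h1
  · exact h2

/-! ### Step sizes -/

section StepSize

variable {κ δ : ℝ} {Q : Finset (Fin m)} {u v : Fin m → ℝ}

theorem stepSize_le_one (S : Set ℝ) : stepSize κ δ S ≤ 1 := by
  unfold stepSize
  split_ifs
  · exact min_le_left _ _
  · exact le_rfl

theorem le_stepSize {S : Set ℝ} (hκ : 0 ≤ κ) {r : ℝ} (hr : r ∈ S) :
    min 1 (max (κ * r) (r - δ)) ≤ stepSize κ δ S := by
  unfold stepSize
  split_ifs with h
  · have := le_csSup h hr
    gcongr
  · exact min_le_left _ _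

theorem exists_pos_step (hu : ∀ i ∈ Q, 0 < u i) : ∃ r > 0, ∀ i ∈ Q, 0 ≤ u i + r * v i := by
  have h : ∀ᶠ r in 𝓝[>] (0 : ℝ), ∀ i ∈ Q, 0 ≤ u i + r * v i := by
    rw [Filter.eventually_all_finset]
    intro i hi
    have hc : Continuous fun r : ℝ => u i + r * v i := by fun_prop
    have := hc.tendsto 0
    simp only [zero_mul, add_zero] at this
    filter_upwards [nhdsWithin_le_nhds (this.eventually (lt_mem_nhds (hu i hi)))] with r hr
    exact hr.le
  obtain ⟨r, hr, hr0⟩ := (h.and self_mem_nhdsWithin).exists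
  exact ⟨r, hr0, hr⟩

theorem stepSize_pos (hκ : 0 < κ) (hu : ∀ i ∈ Q, 0 < u i) :
    0 < stepSize κ δ {α | ∀ i ∈ Q, 0 ≤ u i + α * v i} := by
  obtain ⟨r, hr, hS⟩ := exists_pos_step (v := v) hu
  refine lt_of_lt_of_le ?_ (le_stepSize hκ.le (r := r) hS)
  exact lt_min one_pos (lt_max_of_lt_left (mul_pos hκ hr))

/-- Since `κ < 1` and `δ > 0`, the step is strictly shorter than some admissible step `r`. Hence the
new value lies strictly between a positive number and a nonnegative one, or does not fall below the
positive one. -/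
theorem add_stepSize_mul_pos (hκ0 : 0 < κ) (hκ1 : κ < 1) (hδ : 0 < δ) (hu : ∀ i ∈ Q, 0 < u i)
    {i : Fin m} (hi : i ∈ Q) :
    0 < u i + stepSize κ δ {α | ∀ i ∈ Q, 0 ≤ u i + α * v i} * v i := by
  have h0 := stepSize_pos (δ := δ) (v := v) hκ0 hu
  obtain ⟨r, hrS, hr⟩ : ∃ r ∈ {α | ∀ i ∈ Q, 0 ≤ u i + α * v i},
      stepSize κ δ {α | ∀ i ∈ Q, 0 ≤ u i + α * v i} < r := by
    obtain ⟨r0, hr0, hS0⟩ := exists_pos_step (v := v) hu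
    by_cases hb : BddAbove {α | ∀ i ∈ Q, 0 ≤ u i + α * v i}
    · refine exists_lt_of_lt_csSup ⟨r0, hS0⟩ ?_
      have hpos : 0 < sSup {α | ∀ i ∈ Q, 0 ≤ u i + α * v i} := hr0.trans_le (le_csSup hb hS0)
      rw [stepSize, if_pos hb]
      exact (min_le_right _ _).trans_lt (max_lt (by nlinarith) (by linarith))
    · rw [not_bddAbove_iff] at hb
      obtain ⟨r, hrS, hr⟩ := hb 1
      exact ⟨r, hrS, (stepSize_le_one _).trans_lt hr⟩
  have h1 := hrS i hi
  have h2 := hu i hi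
  rcases le_or_gt 0 (v i) with hv | hv
  · nlinarith
  · nlinarith

end StepSize

/-! ### One iteration -/

/-- The properties of an iterate at which the algorithm is well defined and makes progress. -/
structure Regular (z : Iterate n m) : Prop where
  slack_pos : ∀ i, 0 < P.slack z.x i
  lam_pos : ∀ i, 0 < z.lam i
  grad_ne : P.grad z.x ≠ 0

/-- The affine-scaling estimate `λ_Q + Δλᵃ_Q` of the multipliers, extended by zero. -/
noncomputable def lamAff (Q : Finset (Fin m)) (z : Iterate n m) : Fin m → ℝ := fun i =>
  if i ∈ Q then z.lam i + dlamAff P prm Q z i else 0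

variable {P} {prm}

theorem R_quad_nonneg (d : Fin n → ℝ) : 0 ≤ d ⬝ᵥ (prm.R *ᵥ d) := by
  simpa using prm.R_posSemidef.dotProduct_mulVec_nonneg d

variable (prm) in
theorem exists_HR_bound : ∃ c > 0, ∀ d : Fin n → ℝ,
    c * ‖d‖ ^ 2 ≤ d ⬝ᵥ (P.H *ᵥ d) + d ⬝ᵥ (prm.R *ᵥ d) := by
  refine exists_pos_mul_norm_pow_le 2 two_ne_zero _ ?_ (fun t v _ => ?_) fun v hv => ?_
  · have h : ∀ B : Matrix (Fin n) (Fin n) ℝ, Continuous fun x : Fin n → ℝ => x ⬝ᵥ (B *ᵥ x) :=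
      fun B => Continuous.dotProduct continuous_id (CQP.continuous_mulVec B)
    exact (h _).add (h _)
  · simp only [Matrix.mulVec_smul, dotProduct_smul, smul_dotProduct, smul_eq_mul]
    ring
  · have := prm.HR_posDef.dotProduct_mulVec_pos hv
    simpa [Matrix.add_mulVec, dotProduct_add] using this

section Iteration

variable {Q : Finset (Fin m)} {z : Iterate n m}

theorem W_mulVec (d : Fin n → ℝ) :
    W P prm z *ᵥ d = P.H *ᵥ d + rho P prm z • (prm.R *ᵥ d) := by
  rw [W, Matrix.add_mulVec, Matrix.smul_mulVec]

theorem M_mulVec (d : Fin n → ℝ) : M P prm Q z *ᵥ d =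
    W P prm z *ᵥ d + ∑ i ∈ Q, (z.lam i / P.slack z.x i * (P.A *ᵥ d) i) • P.A i := by
  rw [M, Matrix.add_mulVec, Matrix.sum_mulVec]
  congr 1
  refine Finset.sum_congr rfl fun i _ => ?_
  rw [Matrix.smul_mulVec, Matrix.vecMulVec_mulVec]
  ext j
  simp only [Matrix.mulVec, Pi.smul_apply, smul_eq_mul, MulOpposite.smul_eq_mul_unop,
    MulOpposite.unop_op]
  ring

theorem M_quad (d : Fin n → ℝ) : d ⬝ᵥ (M P prm Q z *ᵥ d) = d ⬝ᵥ (P.H *ᵥ d) +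
    rho P prm z * (d ⬝ᵥ (prm.R *ᵥ d)) +
    ∑ i ∈ Q, z.lam i / P.slack z.x i * (P.A *ᵥ d) i ^ 2 := by
  rw [M_mulVec, W_mulVec, dotProduct_add, dotProduct_add, dotProduct_smul, smul_eq_mul,
    dotProduct_sum]
  congr 1
  refine Finset.sum_congr rfl fun i _ => ?_
  have : d ⬝ᵥ P.A i = (P.A *ᵥ d) i := dotProduct_comm _ _
  rw [dotProduct_smul, smul_eq_mul, this]
  ring

theorem rho_nonneg : 0 ≤ rho P prm z :=
  le_min zero_le_one (div_nonneg (err_nonneg _ _ _ _) prm.Ebar_pos.le)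

theorem rho_le_one : rho P prm z ≤ 1 := min_le_left _ _

/-- As `m > 0`, there is a constraint with positive slack and positive multiplier, so
complementarity fails. -/
theorem Regular.err_pos (hz : Regular P z) : 0 < err P prm z.x z.lam := by
  refine lt_of_le_of_ne (err_nonneg _ _ _ _) fun h => ?_
  rcases ((err_eq_zero_iff P prm).1 h.symm).2 ⟨0, P.m_pos⟩ with h | h
  · exact (hz.slack_pos _).ne' h
  · exact (hz.lam_pos _).ne' h

theorem Regular.rho_pos (hz : Regular P z) : 0 < rho P prm z :=
  lt_min one_pos (div_pos hz.err_pos prm.Ebar_pos)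

theorem Regular.H_quad_le (hz : Regular P z) (d : Fin n → ℝ) :
    d ⬝ᵥ (P.H *ᵥ d) ≤ d ⬝ᵥ (M P prm Q z *ᵥ d) := by
  rw [M_quad]
  have h1 : 0 ≤ ∑ i ∈ Q, z.lam i / P.slack z.x i * (P.A *ᵥ d) i ^ 2 := Finset.sum_nonneg
    fun i _ => mul_nonneg (div_nonneg (hz.lam_pos i).le (hz.slack_pos i).le) (sq_nonneg _)
  have h2 := mul_nonneg (rho_nonneg (P := P) (prm := prm) (z := z)) (R_quad_nonneg (prm := prm) d)
  linarith

/-- Because `ϱ ≤ 1`, `H` dominates `ϱH`. With `exists_HR_bound`, a lower bound on `ϱ` makes `M`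
uniformly positive definite, whatever the working set is. -/
theorem Regular.rho_mul_le (hz : Regular P z) (d : Fin n → ℝ) :
    rho P prm z * (d ⬝ᵥ (P.H *ᵥ d) + d ⬝ᵥ (prm.R *ᵥ d)) ≤ d ⬝ᵥ (M P prm Q z *ᵥ d) := by
  rw [M_quad]
  have h1 : 0 ≤ ∑ i ∈ Q, z.lam i / P.slack z.x i * (P.A *ᵥ d) i ^ 2 := Finset.sum_nonneg
    fun i _ => mul_nonneg (div_nonneg (hz.lam_pos i).le (hz.slack_pos i).le) (sq_nonneg _)
  have h2 := mul_le_mul_of_nonneg_right (rho_le_one (P := P) (prm := prm) (z := z))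
    (P.H_quad_nonneg d)
  linarith

theorem Regular.M_quad_pos (hz : Regular P z) {d : Fin n → ℝ} (hd : d ≠ 0) :
    0 < d ⬝ᵥ (M P prm Q z *ᵥ d) := by
  obtain ⟨c, hc, h⟩ := exists_HR_bound prm
  have h1 : 0 < ‖d‖ := norm_pos_iff.2 hd
  exact (mul_pos hz.rho_pos ((by positivity : 0 < c * ‖d‖ ^ 2).trans_le (h d))).trans_le
    (hz.rho_mul_le d)

theorem Regular.isUnit_det (hz : Regular P z) : IsUnit (M P prm Q z).det := by
  rw [isUnit_iff_ne_zero]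
  intro h
  obtain ⟨v, hv, h0⟩ := Matrix.exists_mulVec_eq_zero_iff.2 h
  have := hz.M_quad_pos (prm := prm) (Q := Q) hv
  rw [h0, dotProduct_zero] at this
  exact this.false

theorem Regular.M_mulVec_dxAff (hz : Regular P z) :
    M P prm Q z *ᵥ dxAff P prm Q z = -P.grad z.x := by
  rw [dxAff, Matrix.mulVec_mulVec, Matrix.mul_nonsing_inv _ hz.isUnit_det, Matrix.one_mulVec]

theorem Regular.dxAff_ne_zero (hz : Regular P z) : dxAff P prm Q z ≠ 0 := by
  intro h
  have := hz.M_mulVec_dxAff (prm := prm) (Q := Q)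
  rw [h, Matrix.mulVec_zero, eq_comm, neg_eq_zero] at this
  exact hz.grad_ne this

theorem Regular.grad_dot_dxAff (hz : Regular P z) : P.grad z.x ⬝ᵥ dxAff P prm Q z =
    -(dxAff P prm Q z ⬝ᵥ (M P prm Q z *ᵥ dxAff P prm Q z)) := by
  rw [hz.M_mulVec_dxAff, dotProduct_neg, neg_neg, dotProduct_comm]

theorem dlamAff_of_mem {i : Fin m} (hi : i ∈ Q) : dlamAff P prm Q z i =
    lamAff P prm Q z i - z.lam i := by
  simp [lamAff, hi]

theorem lamAff_of_mem {i : Fin m} (hi : i ∈ Q) : lamAff P prm Q z i =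
    -(z.lam i / P.slack z.x i * dsAff P prm Q z i) := by
  simp only [lamAff, dlamAff, hi, if_true]; ring

theorem lamAff_of_notMem {i : Fin m} (hi : i ∉ Q) : lamAff P prm Q z i = 0 := by
  simp [lamAff, hi]

theorem transpose_mulVec_eq_sum_of_support {y : Fin m → ℝ} (hy : ∀ i ∉ Q, y i = 0) :
    P.Aᵀ *ᵥ y = ∑ i ∈ Q, y i • P.A i := by
  rw [CQP.transpose_mulVec_eq_sum]
  refine (Finset.sum_subset (Finset.subset_univ Q) fun i _ hi => ?_).symm
  rw [hy i hi, zero_smul]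

/-- The dual-feasibility row of the Newton system. Through independence of the active rows it turns
control of `Δxᵃ` into control of the multiplier estimates. -/
theorem Regular.transpose_mulVec_lamAff (hz : Regular P z) :
    P.Aᵀ *ᵥ lamAff P prm Q z = W P prm z *ᵥ dxAff P prm Q z + P.grad z.x := by
  have h := hz.M_mulVec_dxAff (prm := prm) (Q := Q)
  rw [M_mulVec] at h
  rw [transpose_mulVec_eq_sum_of_support fun i hi => lamAff_of_notMem hi,
    eq_sub_of_add_eq h, sub_add_eq_add_sub, neg_add_cancel, zero_sub, ← Finset.sum_neg_distrib]
  refine Finset.sum_congr rfl fun i hi => ?_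
  rw [lamAff_of_mem hi, neg_smul]
  rfl

theorem Regular.transpose_mulVec_dlamCor (hz : Regular P z) :
    P.Aᵀ *ᵥ dlamCor P prm Q z = W P prm z *ᵥ dxCor P prm Q z :=
  (sub_eq_zero.1 (corrector_solves P prm Q z hz.isUnit_det fun i _ => (hz.slack_pos i).ne').1).symm

theorem Regular.slack_mul_dlamCor (hz : Regular P z) {i : Fin m} (hi : i ∈ Q) :
    P.slack z.x i * dlamCor P prm Q z i = sigma P prm Q z * mu P Q z -
      dsAff P prm Q z i * dlamAff P prm Q z i - z.lam i * dsCor P prm Q z i := by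
  have := (corrector_solves P prm Q z hz.isUnit_det fun i _ => (hz.slack_pos i).ne').2.2 i hi
  linarith

theorem dlamCor_of_notMem {i : Fin m} (hi : i ∉ Q) : dlamCor P prm Q z i = 0 := by
  simp [dlamCor, hi]

/-! #### The centering parameter -/

theorem alphaAff_le_one : alphaAff P prm Q z ≤ 1 :=
  Real.sSup_le (fun _ h => h.2.1) zero_le_one

theorem le_alphaAff {r : ℝ} (h0 : 0 ≤ r) (h1 : r ≤ 1)
    (hs : ∀ i, 0 ≤ P.slack z.x i + r * dsAff P prm Q z i)
    (hl : ∀ i ∈ Q, 0 ≤ z.lam i + r * dlamAff P prm Q z i) : r ≤ alphaAff P prm Q z :=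
  le_csSup ⟨1, fun _ h => h.2.1⟩ ⟨h0, h1, hs, hl⟩

theorem Regular.alphaAff_nonneg (hz : Regular P z) : 0 ≤ alphaAff P prm Q z :=
  le_alphaAff le_rfl zero_le_one (fun i => by simpa using (hz.slack_pos i).le)
    fun i _ => by simpa using (hz.lam_pos i).le

theorem sigma_nonneg : 0 ≤ sigma P prm Q z :=
  pow_nonneg (sub_nonneg.2 alphaAff_le_one) 3

theorem Regular.sigma_le_one (hz : Regular P z) : sigma P prm Q z ≤ 1 :=
  pow_le_one₀ (sub_nonneg.2 alphaAff_le_one)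
    (by linarith [hz.alphaAff_nonneg (prm := prm) (Q := Q)])

theorem dualityMeasure_nonneg {s l : Fin m → ℝ} (hs : ∀ i, 0 ≤ s i) (hl : ∀ i ∈ Q, 0 ≤ l i) :
    0 ≤ dualityMeasure Q s l := by
  unfold dualityMeasure
  split_ifs
  · exact le_rfl
  · exact div_nonneg (Finset.sum_nonneg fun i hi => mul_nonneg (hs i) (hl i hi)) (Nat.cast_nonneg _)

theorem dualityMeasure_le {s l : Fin m → ℝ} {C : ℝ} (hC : 0 ≤ C) (h : ∀ i ∈ Q, s i * l i ≤ C) :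
    dualityMeasure Q s l ≤ C := by
  unfold dualityMeasure
  split_ifs with hQ
  · exact hC
  · have : (0 : ℝ) < Q.card := by
      exact_mod_cast Finset.card_pos.2 (Finset.nonempty_iff_ne_empty.2 hQ)
    rw [div_le_iff₀ this]
    calc ∑ i ∈ Q, s i * l i ≤ ∑ i ∈ Q, C := Finset.sum_le_sum h
      _ = C * Q.card := by simp [mul_comm]

theorem Regular.mu_nonneg (hz : Regular P z) : 0 ≤ mu P Q z :=
  dualityMeasure_nonneg (fun i => (hz.slack_pos i).le) fun i _ => (hz.lam_pos i).le

/-! #### The mixing parameter -/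

/-- Along `Δxᵃ` the linear term of `f` is `-ΔxᵃᵀMΔxᵃ`, and the quadratic term is at most half of
that in size because `H ≼ M`. -/
theorem Regular.f_sub_dxAff (hz : Regular P z) :
    1 / 2 * (dxAff P prm Q z ⬝ᵥ (M P prm Q z *ᵥ dxAff P prm Q z)) ≤
      P.f z.x - P.f (z.x + dxAff P prm Q z) := by
  rw [CQP.f_add, hz.grad_dot_dxAff]
  have := hz.H_quad_le (prm := prm) (Q := Q) (dxAff P prm Q z)
  linarith

/-- The admissible mixing parameters of Step 8. -/
theorem gamma1_spec (h0 : 0 ≤ P.f z.x - P.f (z.x + dxAff P prm Q z)) :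
    0 ≤ gamma1 P prm Q z ∧ gamma1 P prm Q z ≤ 1 ∧
      prm.ω * (P.f z.x - P.f (z.x + dxAff P prm Q z)) ≤
        P.f z.x - P.f (z.x + dxAff P prm Q z + gamma1 P prm Q z • dxCor P prm Q z) := by
  have hcl : IsClosed {g : ℝ | 0 ≤ g ∧ g ≤ 1 ∧
      prm.ω * (P.f z.x - P.f (z.x + dxAff P prm Q z)) ≤
        P.f z.x - P.f (z.x + dxAff P prm Q z + g • dxCor P prm Q z)} := by
    have hc : Continuous fun g : ℝ =>
        P.f z.x - P.f (z.x + dxAff P prm Q z + g • dxCor P prm Q z) :=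
      continuous_const.sub (P.continuous_f.comp (by fun_prop))
    exact (isClosed_le continuous_const continuous_id).inter
      ((isClosed_le continuous_id continuous_const).inter (isClosed_le continuous_const hc))
  -- The value `g = 0` is admissible because `ω ≤ 1`, and closedness makes the supremum attained.
  exact hcl.csSup_mem ⟨0, le_rfl, zero_le_one, by
    rw [zero_smul, add_zero]
    nlinarith [prm.ω_mem.2]⟩ ⟨1, fun _ h => h.2.1⟩

/-- The other terms of the minimum may push `γ` below `γ₁`. The decrease condition survives: it
holds at `0` and at `γ₁`, hence in between by convexity of `f`. -/
theorem Regular.gamma_spec (hz : Regular P z) :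
    0 ≤ gamma P prm Q z ∧ gamma P prm Q z ≤ 1 ∧
      gamma P prm Q z * prm.normX (dxCor P prm Q z) ≤ prm.τ * prm.normX (dxAff P prm Q z) ∧
      prm.ω * (P.f z.x - P.f (z.x + dxAff P prm Q z)) ≤
        P.f z.x - P.f (z.x + dx P prm Q z) := by
  have hM := hz.M_quad_pos (prm := prm) (Q := Q) (hz.dxAff_ne_zero (prm := prm) (Q := Q))
  have hdec := hz.f_sub_dxAff (prm := prm) (Q := Q)
  have hf0 : 0 ≤ P.f z.x - P.f (z.x + dxAff P prm Q z) := by linarith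
  have hω : prm.ω * (P.f z.x - P.f (z.x + dxAff P prm Q z)) ≤
      P.f z.x - P.f (z.x + dxAff P prm Q z) := by nlinarith [prm.ω_mem.2]
  have hτ : 0 ≤ prm.τ * prm.normX (dxAff P prm Q z) :=
    mul_nonneg prm.τ_mem.1 (prm.normX.nonneg _)
  by_cases hQ : Q = ∅
  · have hg : gamma P prm Q z = 0 := by rw [gamma, if_pos hQ]
    simp only [dx, hg, zero_smul, add_zero, zero_mul]
    exact ⟨le_rfl, zero_le_one, hτ, hω⟩
  by_cases hc : dxCor P prm Q z = 0
  · have hg : gamma P prm Q z = 1 := by rw [gamma, if_neg hQ, if_pos hc]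
    simp only [dx, hg, hc, smul_zero, add_zero, one_mul, VecNorm.map_zero']
    exact ⟨zero_le_one, le_rfl, hτ, hω⟩
  have hcpos := prm.normX.pos_of_ne_zero hc
  obtain ⟨h0, h1, h2⟩ := gamma1_spec (P := P) (prm := prm) (Q := Q) (z := z) hf0
  have hle : gamma P prm Q z ≤ gamma1 P prm Q z ∧ gamma P prm Q z ≤
      prm.τ * prm.normX (dxAff P prm Q z) / prm.normX (dxCor P prm Q z) ∧
      0 ≤ gamma P prm Q z := by
    have hdiv : 0 ≤ prm.τ * prm.normX (dxAff P prm Q z) / prm.normX (dxCor P prm Q z) :=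
      div_nonneg hτ hcpos.le
    rw [gamma, if_neg hQ, if_neg hc]
    split_ifs with hs
    · exact ⟨min_le_left _ _, min_le_right _ _, le_min h0 hdiv⟩
    · exact ⟨min_le_left _ _, (min_le_right _ _).trans (min_le_left _ _),
        le_min h0 (le_min hdiv (div_nonneg hτ (mul_nonneg sigma_nonneg hz.mu_nonneg)))⟩
  obtain ⟨hg1, hg2, hg0⟩ := hle
  refine ⟨hg0, hg1.trans h1, (le_div_iff₀ hcpos).1 hg2, ?_⟩
  rcases h0.eq_or_lt with h | h
  · have hg : gamma P prm Q z = 0 := le_antisymm (by rwa [← h] at hg1) hg0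
    simpa only [dx, hg, zero_smul, add_zero] using hω
  · have ht0 : 0 ≤ gamma P prm Q z / gamma1 P prm Q z := div_nonneg hg0 h.le
    have ht1 : gamma P prm Q z / gamma1 P prm Q z ≤ 1 := (div_le_one h).2 hg1
    have h3 := P.f_add_smul_le (z.x + dxAff P prm Q z) (gamma1 P prm Q z • dxCor P prm Q z) ht0 ht1
    rw [smul_smul, div_mul_cancel₀ _ h.ne'] at h3
    rw [dx, ← add_assoc]
    nlinarith [mul_le_mul_of_nonneg_left h2 ht0,
      mul_le_mul_of_nonneg_left hω (sub_nonneg.2 ht1)]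

/-! #### The search direction and the next iterate -/

/-- Since `τ < 1`, the weighted corrector is too short to cancel `Δxᵃ`. This positivity keeps the
step sizes strictly below the step to the boundary. -/
theorem Regular.normX_dx_pos (hz : Regular P z) : 0 < prm.normX (dx P prm Q z) := by
  obtain ⟨h0, -, h2, -⟩ := hz.gamma_spec (prm := prm) (Q := Q)
  have h3 := prm.normX.map_add_le (dx P prm Q z) (-(gamma P prm Q z) • dxCor P prm Q z)
  rw [VecNorm.map_smul, abs_neg, abs_of_nonneg h0] at h3
  have h4 : dx P prm Q z + -(gamma P prm Q z) • dxCor P prm Q z = dxAff P prm Q z := by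
    rw [dx, neg_smul, add_neg_cancel_right]
  rw [h4] at h3
  have := prm.normX.pos_of_ne_zero (hz.dxAff_ne_zero (prm := prm) (Q := Q))
  nlinarith [prm.τ_mem.2]

theorem ds_eq : ds P prm Q z = P.A *ᵥ dx P prm Q z := by
  rw [ds, dx, Matrix.mulVec_add, Matrix.mulVec_smul]
  rfl

theorem slack_xNext : P.slack (xNext P prm Q z) =
    P.slack z.x + alphaPrimal P prm Q z • ds P prm Q z := by
  rw [xNext, CQP.slack_add_smul, ds_eq]

theorem alphaPrimal_eq : alphaPrimal P prm Q z = stepSize prm.κ (prm.normX (dx P prm Q z))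
    {α | ∀ i ∈ Finset.univ, 0 ≤ P.slack z.x i + α * ds P prm Q z i} := by
  simp [alphaPrimal]

theorem Regular.alphaPrimal_pos (hz : Regular P z) : 0 < alphaPrimal P prm Q z := by
  rw [alphaPrimal_eq]
  exact stepSize_pos prm.κ_mem.1 fun i _ => hz.slack_pos i

theorem alphaPrimal_le_one : alphaPrimal P prm Q z ≤ 1 := stepSize_le_one _

theorem alphaDual_le_one : alphaDual P prm Q z ≤ 1 := stepSize_le_one _

theorem Regular.slack_xNext_pos (hz : Regular P z) (i : Fin m) :
    0 < P.slack (xNext P prm Q z) i := by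
  rw [slack_xNext, alphaPrimal_eq]
  exact add_stepSize_mul_pos prm.κ_mem.1 prm.κ_mem.2 hz.normX_dx_pos
    (fun i _ => hz.slack_pos i) (Finset.mem_univ i)

/-- By convexity a step of length `α_p` realizes at least the fraction `α_p` of the decrease of the
full step. -/
theorem Regular.f_xNext_le (hz : Regular P z) :
    P.f (xNext P prm Q z) + alphaPrimal P prm Q z * (prm.ω / 2 *
      (dxAff P prm Q z ⬝ᵥ (M P prm Q z *ᵥ dxAff P prm Q z))) ≤ P.f z.x := by
  have h1 := P.f_add_smul_le z.x (dx P prm Q z)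
    (hz.alphaPrimal_pos (prm := prm) (Q := Q)).le alphaPrimal_le_one
  have h2 := (hz.gamma_spec (prm := prm) (Q := Q)).2.2.2
  have h3 := mul_le_mul_of_nonneg_left (hz.f_sub_dxAff (prm := prm) (Q := Q)) prm.ω_mem.1.le
  have h4 := mul_le_mul_of_nonneg_left (h3.trans h2)
    (hz.alphaPrimal_pos (prm := prm) (Q := Q)).le
  rw [xNext]
  linarith

theorem chi_nonneg : 0 ≤ chi P prm Q z :=
  add_nonneg (Real.rpow_nonneg (prm.normX.nonneg _) _) (Real.rpow_nonneg (prm.normL.nonneg _) _)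

theorem Regular.chi_pos (hz : Regular P z) : 0 < chi P prm Q z :=
  add_pos_of_pos_of_nonneg (Real.rpow_pos_of_pos (prm.normX.pos_of_ne_zero hz.dxAff_ne_zero) _)
    (Real.rpow_nonneg (prm.normL.nonneg _) _)

theorem chi_eq : chi P prm Q z = prm.normX (dxAff P prm Q z) ^ prm.ν +
    prm.normL (fun i => min (lamAff P prm Q z i) 0) ^ prm.ν := by
  unfold chi
  congr 3
  ext i
  by_cases hi : i ∈ Q <;> simp [lamAff, hi]

/-- The safeguard of Step 10: as long as `χ` stays away from zero, so do all the next multipliers.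
-/
theorem min_chi_le_lam_next (i : Fin m) :
    min (chi P prm Q z) prm.lamLow ≤ (next P prm Q z).lam i := by
  simp only [next]
  split_ifs
  · exact le_max_right _ _
  · exact le_max_right _ _

theorem lam_next_le (i : Fin m) : (next P prm Q z).lam i ≤ prm.lamMax := by
  have h : min (chi P prm Q z) prm.lamLow ≤ prm.lamMax :=
    (min_le_right _ _).trans prm.lamLow_mem.2.le
  simp only [next]
  split_ifs
  · exact max_le (min_le_right _ _) h
  · exact max_le (min_le_right _ _) h

theorem Regular.next (hz : Regular P z) (hg : P.grad (next P prm Q z).x ≠ 0) :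
    Regular P (next P prm Q z) where
  slack_pos := hz.slack_xNext_pos
  lam_pos i := (lt_min hz.chi_pos prm.lamLow_mem.1).trans_le (min_chi_le_lam_next i)
  grad_ne := hg

end Iteration

end CRMPC

/-! ### Bounded and vanishing families -/

section Asymptotics

open Asymptotics

variable {ι : Type*} {ℱ : Filter ι} {n m : ℕ}

theorem tendsto_zero_mul_of_isBigO_one {f g : ι → ℝ} (hf : Tendsto f ℱ (𝓝 0))
    (hg : g =O[ℱ] fun _ => (1 : ℝ)) : Tendsto (fun k => f k * g k) ℱ (𝓝 0) := by
  have h := ((isLittleO_one_iff ℝ).2 hf).mul_isBigO hg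
  simp only [mul_one] at h
  exact (isLittleO_one_iff ℝ).1 h

theorem isBigO_one_mul {f g : ι → ℝ} (hf : f =O[ℱ] fun _ => (1 : ℝ))
    (hg : g =O[ℱ] fun _ => (1 : ℝ)) : (fun k => f k * g k) =O[ℱ] fun _ => (1 : ℝ) := by
  simpa using hf.mul hg

theorem isBigO_one_of_abs_le {f : ι → ℝ} {C : ℝ} (h : ∀ᶠ k in ℱ, |f k| ≤ C) :
    f =O[ℱ] fun _ => (1 : ℝ) :=
  IsBigO.of_bound C (by simpa using h)

theorem exists_abs_le_of_isBigO_one {f : ι → ℝ} (h : f =O[ℱ] fun _ => (1 : ℝ)) :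
    ∃ C, 0 < C ∧ ∀ᶠ k in ℱ, |f k| ≤ C := by
  obtain ⟨C, hC, h'⟩ := h.exists_pos
  exact ⟨C, hC, by simpa using h'.bound⟩

theorem isBigO_one_mulVec {p q : ℕ} (B : Matrix (Fin p) (Fin q) ℝ) {d : ι → Fin q → ℝ}
    (hd : d =O[ℱ] fun _ => (1 : ℝ)) : (fun k => B *ᵥ d k) =O[ℱ] fun _ => (1 : ℝ) :=
  ((LinearMap.toContinuousLinearMap B.mulVecLin).isBigO_comp d ℱ).trans hd

theorem tendsto_mulVec {p q : ℕ} (B : Matrix (Fin p) (Fin q) ℝ) {d : ι → Fin q → ℝ}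
    {e : Fin q → ℝ} (hd : Tendsto d ℱ (𝓝 e)) : Tendsto (fun k => B *ᵥ d k) ℱ (𝓝 (B *ᵥ e)) :=
  ((CQP.continuous_mulVec B).tendsto e).comp hd

theorem isBigO_one_apply {p : ℕ} {d : ι → Fin p → ℝ} (hd : d =O[ℱ] fun _ => (1 : ℝ)) (i : Fin p) :
    (fun k => d k i) =O[ℱ] fun _ => (1 : ℝ) := isBigO_pi.1 hd i

theorem tendsto_apply_zero {p : ℕ} {d : ι → Fin p → ℝ} (hd : Tendsto d ℱ (𝓝 0)) (i : Fin p) :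
    Tendsto (fun k => d k i) ℱ (𝓝 0) := by
  simpa using (tendsto_pi_nhds.1 hd) i

variable {P : CQP n m} {J : Set (Fin m)} {y : ι → Fin m → ℝ}

/-- Subtracting the components outside `J` leaves a vector supported on `J`, which the left inverse
of `exists_leftInverse` recovers from its image under `Aᵀ`. -/
theorem isBigO_one_of_transpose (hJ : LinearIndependent ℝ (fun i : J => P.A i))
    (h1 : (fun k => P.Aᵀ *ᵥ y k) =O[ℱ] fun _ => (1 : ℝ))
    (h2 : ∀ i ∉ J, (fun k => y k i) =O[ℱ] fun _ => (1 : ℝ)) : y =O[ℱ] fun _ => (1 : ℝ) := by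
  classical
  obtain ⟨G, hG⟩ := CQP.exists_leftInverse hJ
  let w : ι → Fin m → ℝ := fun k i => if i ∈ J then 0 else y k i
  have hw : w =O[ℱ] fun _ => (1 : ℝ) := isBigO_pi.2 fun i => by
    by_cases hi : i ∈ J
    · rw [show (fun k => w k i) = fun _ => (0 : ℝ) from funext fun k => by simp [w, hi]]
      exact isBigO_zero _ _
    · simpa [w, hi] using h2 i hi
  have hy : ∀ k, y k = G (P.Aᵀ *ᵥ y k - P.Aᵀ *ᵥ w k) + w k := fun k => by
    rw [← Matrix.mulVec_sub, hG _ fun i hi => by simp [w, hi], sub_add_cancel]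
  rw [show y = fun k => G (P.Aᵀ *ᵥ y k - P.Aᵀ *ᵥ w k) + w k from funext hy]
  exact ((G.isBigO_comp _ ℱ).trans (h1.sub (isBigO_one_mulVec _ hw))).add hw

/-- The argument of `isBigO_one_of_transpose` with limits: continuity of the left inverse yields
convergence, which is not assumed on `J`. -/
theorem tendsto_of_transpose [ℱ.NeBot] (hJ : LinearIndependent ℝ (fun i : J => P.A i))
    {g : Fin n → ℝ} (h1 : Tendsto (fun k => P.Aᵀ *ᵥ y k) ℱ (𝓝 g))
    (h2 : ∀ i ∉ J, Tendsto (fun k => y k i) ℱ (𝓝 0)) :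
    ∃ lam : Fin m → ℝ, P.Aᵀ *ᵥ lam = g ∧ (∀ i ∉ J, lam i = 0) ∧ Tendsto y ℱ (𝓝 lam) := by
  classical
  obtain ⟨G, hG⟩ := CQP.exists_leftInverse hJ
  let w : ι → Fin m → ℝ := fun k i => if i ∈ J then 0 else y k i
  have hw : Tendsto w ℱ (𝓝 0) := tendsto_pi_nhds.2 fun i => by
    by_cases hi : i ∈ J
    · simp [w, hi]
    · simpa [w, hi] using h2 i hi
  have hy : ∀ k, y k = G (P.Aᵀ *ᵥ y k - P.Aᵀ *ᵥ w k) + w k := fun k => by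
    rw [← Matrix.mulVec_sub, hG _ fun i hi => by simp [w, hi], sub_add_cancel]
  have hlim : Tendsto y ℱ (𝓝 (G g)) := by
    rw [show y = fun k => G (P.Aᵀ *ᵥ y k - P.Aᵀ *ᵥ w k) + w k from funext hy]
    have h3 := (((G.continuous.tendsto _).comp (h1.sub (tendsto_mulVec P.Aᵀ hw)))).add hw
    simpa using h3
  refine ⟨G g, tendsto_nhds_unique (tendsto_mulVec P.Aᵀ hlim) h1, fun i hi => ?_, hlim⟩
  exact tendsto_nhds_unique (tendsto_pi_nhds.1 hlim i) (h2 i hi)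

theorem tendsto_zero_of_transpose [ℱ.NeBot] (hJ : LinearIndependent ℝ (fun i : J => P.A i))
    (h1 : Tendsto (fun k => P.Aᵀ *ᵥ y k) ℱ (𝓝 0))
    (h2 : ∀ i ∉ J, Tendsto (fun k => y k i) ℱ (𝓝 0)) : Tendsto y ℱ (𝓝 0) := by
  obtain ⟨lam, h3, h4, h5⟩ := tendsto_of_transpose hJ h1 h2
  obtain ⟨G, hG⟩ := CQP.exists_leftInverse hJ
  rw [← hG lam h4, h3, map_zero] at h5
  exact h5

end Asymptotics

/-! ### Families of iterates that approach a point: boundedness and primal steps -/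

namespace CRMPC

open Asymptotics

variable {n m : ℕ} {P : CQP n m} {prm : Params P}

/-- With `q` the sum of the relative slack changes, the step `1/(1 + q)` keeps the slacks
nonnegative; it keeps `λ_Q` nonnegative too because `Δλᵃᵢ = -λᵢ(1 + Δsᵃᵢ/sᵢ)`. It forces `αᵃ → 1`
when all relative changes vanish. -/
theorem Regular.le_alphaAff {Q : Finset (Fin m)} {z : Iterate n m} (hz : Regular P z) :
    (1 + ∑ i, |dsAff P prm Q z i / P.slack z.x i|)⁻¹ ≤ alphaAff P prm Q z := by
  set q := ∑ i, |dsAff P prm Q z i / P.slack z.x i| with hq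
  have hq0 : 0 ≤ q := Finset.sum_nonneg fun i _ => abs_nonneg _
  have hqi : ∀ i, |dsAff P prm Q z i / P.slack z.x i| ≤ q := fun i =>
    Finset.single_le_sum (f := fun i => |dsAff P prm Q z i / P.slack z.x i|)
      (fun i _ => abs_nonneg _) (Finset.mem_univ i)
  have hr0 : 0 < (1 + q)⁻¹ := by positivity
  have hr : (1 + q)⁻¹ * (1 + q) = 1 := inv_mul_cancel₀ (by positivity)
  set r := (1 + q)⁻¹
  have hr1 : r ≤ 1 := by nlinarith
  refine CRMPC.le_alphaAff hr0.le hr1 (fun i => ?_) fun i hi => ?_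
  · have h1 : dsAff P prm Q z i = P.slack z.x i * (dsAff P prm Q z i / P.slack z.x i) :=
      (mul_div_cancel₀ _ (hz.slack_pos i).ne').symm
    have h2 := (abs_le.1 (hqi i)).1
    have h3 : 0 ≤ 1 + r * (dsAff P prm Q z i / P.slack z.x i) := by nlinarith
    rw [h1]
    nlinarith [mul_nonneg (hz.slack_pos i).le h3]
  · have h1 : dlamAff P prm Q z i =
        -z.lam i - z.lam i * (dsAff P prm Q z i / P.slack z.x i) := by
      rw [dlamAff_of_mem hi, lamAff_of_mem hi]; ring
    have h2 := (abs_le.1 (hqi i)).2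
    have h3 : 0 ≤ 1 - r - r * (dsAff P prm Q z i / P.slack z.x i) := by nlinarith
    rw [h1]
    nlinarith [mul_nonneg (hz.lam_pos i).le h3]

/-- A family of iterates and working sets whose primal parts approach `xl`, the working sets
containing the constraints active at `xl`. -/
structure Approach {ι : Type*} (ℱ : Filter ι) (P : CQP n m) (z : ι → Iterate n m)
    (Q : ι → Finset (Fin m)) (xl : Fin n → ℝ) : Prop where
  reg : ∀ k, Regular P (z k)
  tendsto : Tendsto (fun k => (z k).x) ℱ (𝓝 xl)
  act : ∀ᶠ k in ℱ, ∀ i ∈ P.active xl, i ∈ Q k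
  lam_isBigO : (fun k => (z k).lam) =O[ℱ] fun _ => (1 : ℝ)
  li : LinearIndependent ℝ (fun i : P.active xl => P.A i)

section

variable {ι : Type*} {ℱ : Filter ι} {z : ι → Iterate n m} {Q : ι → Finset (Fin m)}

theorem rho_isBigO : (fun k => rho P prm (z k)) =O[ℱ] fun _ => (1 : ℝ) :=
  isBigO_one_of_abs_le (C := 1) (Eventually.of_forall fun k => by
    rw [abs_of_nonneg rho_nonneg]; exact rho_le_one)

theorem W_mulVec_isBigO {d : ι → Fin n → ℝ} (hd : d =O[ℱ] fun _ => (1 : ℝ)) :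
    (fun k => W P prm (z k) *ᵥ d k) =O[ℱ] fun _ => (1 : ℝ) := by
  simp only [W_mulVec]
  refine (isBigO_one_mulVec _ hd).add ?_
  simpa using rho_isBigO.smul (isBigO_one_mulVec prm.R hd)

theorem W_mulVec_tendsto {d : ι → Fin n → ℝ} (hd : Tendsto d ℱ (𝓝 0)) :
    Tendsto (fun k => W P prm (z k) *ᵥ d k) ℱ (𝓝 0) := by
  rw [← isLittleO_one_iff ℝ]
  simp only [W_mulVec]
  have h : ∀ B : Matrix (Fin n) (Fin n) ℝ, (fun k => B *ᵥ d k) =o[ℱ] fun _ => (1 : ℝ) := fun B =>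
    (isLittleO_one_iff ℝ).2 (by simpa using tendsto_mulVec B hd)
  refine (h _).add ?_
  simpa using rho_isBigO.smul_isLittleO (h prm.R)

end

namespace Approach

variable {ι : Type*} {ℱ : Filter ι} {z : ι → Iterate n m} {Q : ι → Finset (Fin m)}
  {xl : Fin n → ℝ}

section

variable (h : Approach ℱ P z Q xl)
include h

theorem slack_tendsto (i : Fin m) :
    Tendsto (fun k => P.slack (z k).x i) ℱ (𝓝 (P.slack xl i)) :=
  tendsto_pi_nhds.1 ((P.continuous_slack.tendsto xl).comp h.tendsto) i

theorem slack_isBigO (i : Fin m) : (fun k => P.slack (z k).x i) =O[ℱ] fun _ => (1 : ℝ) :=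
  (h.slack_tendsto i).isBigO_one ℝ

theorem inv_slack_isBigO {i : Fin m} (hi : i ∉ P.active xl) :
    (fun k => (P.slack (z k).x i)⁻¹) =O[ℱ] fun _ => (1 : ℝ) :=
  ((h.slack_tendsto i).inv₀ fun h0 => hi (P.mem_active_iff.2 h0)).isBigO_one ℝ

theorem lam_apply_isBigO (i : Fin m) : (fun k => (z k).lam i) =O[ℱ] fun _ => (1 : ℝ) :=
  isBigO_one_apply h.lam_isBigO i

theorem grad_tendsto : Tendsto (fun k => P.grad (z k).x) ℱ (𝓝 (P.grad xl)) :=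
  (P.continuous_grad.tendsto xl).comp h.tendsto

theorem sigma_isBigO : (fun k => sigma P prm (Q k) (z k)) =O[ℱ] fun _ => (1 : ℝ) :=
  isBigO_one_of_abs_le (C := 1) (Eventually.of_forall fun k => by
    rw [abs_of_nonneg sigma_nonneg]; exact (h.reg k).sigma_le_one)

theorem gamma_isBigO : (fun k => gamma P prm (Q k) (z k)) =O[ℱ] fun _ => (1 : ℝ) :=
  isBigO_one_of_abs_le (C := 1) (Eventually.of_forall fun k => by
    rw [abs_of_nonneg (h.reg k).gamma_spec.1]; exact (h.reg k).gamma_spec.2.1)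

theorem mu_isBigO : (fun k => mu P (Q k) (z k)) =O[ℱ] fun _ => (1 : ℝ) := by
  have h1 : (fun k => ∑ i, P.slack (z k).x i * (z k).lam i) =O[ℱ] fun _ => (1 : ℝ) :=
    IsBigO.fun_sum fun i _ => isBigO_one_mul (h.slack_isBigO i) (h.lam_apply_isBigO i)
  refine (isBigO_of_le ℱ fun k => ?_).trans h1
  have hnn : ∀ i, 0 ≤ P.slack (z k).x i * (z k).lam i := fun i =>
    mul_nonneg ((h.reg k).slack_pos i).le ((h.reg k).lam_pos i).le
  have h0 : 0 ≤ ∑ i, P.slack (z k).x i * (z k).lam i := Finset.sum_nonneg fun i _ => hnn i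
  rw [Real.norm_of_nonneg (h.reg k).mu_nonneg, Real.norm_of_nonneg h0]
  exact dualityMeasure_le h0 fun i _ => Finset.single_le_sum
    (f := fun i => P.slack (z k).x i * (z k).lam i) (fun i _ => hnn i) (Finset.mem_univ i)

section Bounded

variable (hd : (fun k => dxAff P prm (Q k) (z k)) =O[ℱ] fun _ => (1 : ℝ))
include hd

omit h in
theorem dsAff_isBigO (i : Fin m) :
    (fun k => dsAff P prm (Q k) (z k) i) =O[ℱ] fun _ => (1 : ℝ) :=
  isBigO_one_apply (isBigO_one_mulVec P.A hd) i

/-- The image under `Aᵀ` is bounded by the dual-feasibility row; inactive components are zero or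
`-λᵢΔsᵃᵢ/sᵢ`, with `sᵢ` bounded away from zero. -/
theorem lamAff_isBigO : (fun k => lamAff P prm (Q k) (z k)) =O[ℱ] fun _ => (1 : ℝ) := by
  refine isBigO_one_of_transpose h.li ?_ fun i hi => ?_
  · simp only [(h.reg _).transpose_mulVec_lamAff]
    exact (W_mulVec_isBigO hd).add (h.grad_tendsto.isBigO_one ℝ)
  · refine (isBigO_of_le ℱ fun k => ?_).trans (isBigO_one_mul
      (isBigO_one_mul (h.lam_apply_isBigO i) (h.inv_slack_isBigO hi)) (dsAff_isBigO hd i))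
    by_cases hQ : i ∈ Q k
    · rw [lamAff_of_mem hQ, norm_neg, div_eq_mul_inv]
    · rw [lamAff_of_notMem hQ, norm_zero]; positivity

theorem dlamAff_isBigO (i : Fin m) :
    (fun k => dlamAff P prm (Q k) (z k) i) =O[ℱ] fun _ => (1 : ℝ) := by
  refine (isBigO_of_le ℱ fun k => ?_).trans
    ((isBigO_one_apply (h.lamAff_isBigO hd) i).sub (h.lam_apply_isBigO i))
  by_cases hQ : i ∈ Q k
  · rw [dlamAff_of_mem hQ]
  · simp [dlamAff, hQ]

/-- Only the product with `γ` is controlled, through `γ‖Δxᶜ‖ ≤ τ‖Δxᵃ‖`; no bound on the corrector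
itself is used. -/
theorem gamma_smul_dxCor_isBigO :
    (fun k => gamma P prm (Q k) (z k) • dxCor P prm (Q k) (z k)) =O[ℱ] fun _ => (1 : ℝ) := by
  obtain ⟨c, hc, hcN⟩ := prm.normX.exists_mul_norm_le
  obtain ⟨C, hC, hCN⟩ := prm.normX.exists_le_mul_norm
  refine IsBigO.trans (IsBigO.of_bound (c⁻¹ * C) (Eventually.of_forall fun k => ?_)) hd
  rw [mul_assoc, le_inv_mul_iff₀ hc]
  obtain ⟨h0, -, h2, -⟩ := (h.reg k).gamma_spec (prm := prm) (Q := Q k)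
  have h3 := hcN (gamma P prm (Q k) (z k) • dxCor P prm (Q k) (z k))
  rw [VecNorm.map_smul, abs_of_nonneg h0] at h3
  have h4 := hCN (dxAff P prm (Q k) (z k))
  have h5 := prm.normX.nonneg (dxAff P prm (Q k) (z k))
  nlinarith [prm.τ_mem.2]

theorem gamma_mul_dsCor_isBigO (i : Fin m) :
    (fun k => gamma P prm (Q k) (z k) * dsCor P prm (Q k) (z k) i) =O[ℱ] fun _ => (1 : ℝ) := by
  have := isBigO_one_apply (isBigO_one_mulVec P.A (h.gamma_smul_dxCor_isBigO hd)) i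
  refine this.congr_left fun k => ?_
  rw [Matrix.mulVec_smul]
  rfl

theorem gamma_smul_dlamCor_isBigO :
    (fun k => gamma P prm (Q k) (z k) • dlamCor P prm (Q k) (z k)) =O[ℱ] fun _ => (1 : ℝ) := by
  refine isBigO_one_of_transpose h.li ?_ fun i hi => ?_
  · simp only [Matrix.mulVec_smul, (h.reg _).transpose_mulVec_dlamCor]
    simp only [← Matrix.mulVec_smul]
    exact W_mulVec_isBigO (h.gamma_smul_dxCor_isBigO hd)
  · have h1 : (fun k => (P.slack (z k).x i)⁻¹ * (gamma P prm (Q k) (z k) *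
        (sigma P prm (Q k) (z k) * mu P (Q k) (z k)) - gamma P prm (Q k) (z k) *
        (dsAff P prm (Q k) (z k) i * dlamAff P prm (Q k) (z k) i) -
        (z k).lam i * (gamma P prm (Q k) (z k) * dsCor P prm (Q k) (z k) i))) =O[ℱ]
        fun _ => (1 : ℝ) :=
      isBigO_one_mul (h.inv_slack_isBigO hi) (((isBigO_one_mul h.gamma_isBigO
        (isBigO_one_mul h.sigma_isBigO h.mu_isBigO)).sub (isBigO_one_mul h.gamma_isBigO
        (isBigO_one_mul (dsAff_isBigO hd i) (h.dlamAff_isBigO hd i)))).sub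
        (isBigO_one_mul (h.lam_apply_isBigO i) (h.gamma_mul_dsCor_isBigO hd i)))
    change (fun k => gamma P prm (Q k) (z k) * dlamCor P prm (Q k) (z k) i) =O[ℱ] _
    refine (isBigO_of_le ℱ fun k => ?_).trans h1
    by_cases hQ : i ∈ Q k
    · refine le_of_eq (congrArg _ ?_)
      rw [eq_inv_mul_iff_mul_eq₀ ((h.reg k).slack_pos i).ne', mul_left_comm,
        (h.reg k).slack_mul_dlamCor hQ]
      ring
    · rw [dlamCor_of_notMem hQ, mul_zero, norm_zero]; positivity

/-- The primal steps do not collapse where the multiplier estimates of the active constraints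
stay positive. -/
theorem exists_le_alphaPrimal {δ : ℝ} (hδ : 0 < δ)
    (hl : ∀ᶠ k in ℱ, ∀ i ∈ P.active xl, δ ≤ (z k).lam i) :
    ∃ a > 0, ∀ᶠ k in ℱ, a ≤ alphaPrimal P prm (Q k) (z k) := by
  -- It is enough to bound `-Δsᵢ/sᵢ` from above. For active `i`, dividing the complementarity rows
  -- by `λᵢ ≥ δ` writes `Δsᵢ` as `sᵢ` times a bounded quantity plus a centering term, which is
  -- nonnegative and may be dropped. For inactive `i`, `sᵢ` is bounded away from zero.
  have key : ∀ i, ∃ C, 0 < C ∧ ∀ᶠ k in ℱ,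
      -C * P.slack (z k).x i ≤ ds P prm (Q k) (z k) i := by
    intro i
    by_cases hi : i ∈ P.active xl
    · have hinv : (fun k => ((z k).lam i)⁻¹) =O[ℱ] fun _ => (1 : ℝ) := by
        refine isBigO_one_of_abs_le (C := δ⁻¹) ?_
        filter_upwards [hl] with k hk
        rw [abs_of_pos (inv_pos.2 ((h.reg k).lam_pos i))]
        exact inv_anti₀ hδ (hk i hi)
      have hla := isBigO_one_apply (h.lamAff_isBigO hd) i
      have hB : (fun k => ((z k).lam i)⁻¹ * (-lamAff P prm (Q k) (z k) i -
          gamma P prm (Q k) (z k) * dlamCor P prm (Q k) (z k) i +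
          gamma P prm (Q k) (z k) * (((z k).lam i)⁻¹ * lamAff P prm (Q k) (z k) i *
            dlamAff P prm (Q k) (z k) i))) =O[ℱ] fun _ => (1 : ℝ) := by
        refine isBigO_one_mul hinv ((hla.neg_left.sub
          (isBigO_one_apply (h.gamma_smul_dlamCor_isBigO hd) i)).add
          (isBigO_one_mul h.gamma_isBigO (isBigO_one_mul (isBigO_one_mul hinv hla)
            (h.dlamAff_isBigO hd i))))
      obtain ⟨C, hC, hCB⟩ := exists_abs_le_of_isBigO_one hB
      refine ⟨C, hC, ?_⟩
      filter_upwards [hCB, h.act] with k hk hact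
      have hz := h.reg k
      have hQ := hact i hi
      have hs := hz.slack_pos i
      have hlam := hz.lam_pos i
      have hk' := (abs_le.1 hk).1
      have e1 : dsAff P prm (Q k) (z k) i =
          -(((z k).lam i)⁻¹ * lamAff P prm (Q k) (z k) i) * P.slack (z k).x i := by
        rw [lamAff_of_mem hQ]; field_simp
      have e2 := hz.slack_mul_dlamCor (prm := prm) hQ
      have e3 : gamma P prm (Q k) (z k) * dsCor P prm (Q k) (z k) i = ((z k).lam i)⁻¹ *
          (gamma P prm (Q k) (z k) * (sigma P prm (Q k) (z k) * mu P (Q k) (z k)) +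
          P.slack (z k).x i * (-(gamma P prm (Q k) (z k) * dlamCor P prm (Q k) (z k) i) +
          gamma P prm (Q k) (z k) * (((z k).lam i)⁻¹ * lamAff P prm (Q k) (z k) i *
            dlamAff P prm (Q k) (z k) i))) := by
        rw [e1] at e2
        rw [eq_inv_mul_iff_mul_eq₀ hlam.ne']
        linear_combination gamma P prm (Q k) (z k) * e2
      have e4 : 0 ≤ ((z k).lam i)⁻¹ * (gamma P prm (Q k) (z k) *
          (sigma P prm (Q k) (z k) * mu P (Q k) (z k))) :=
        mul_nonneg (inv_pos.2 hlam).le (mul_nonneg hz.gamma_spec.1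
          (mul_nonneg sigma_nonneg hz.mu_nonneg))
      have e5 : ds P prm (Q k) (z k) i = dsAff P prm (Q k) (z k) i +
          gamma P prm (Q k) (z k) * dsCor P prm (Q k) (z k) i := rfl
      rw [e5, e3, e1]
      have e6 := mul_le_mul_of_nonneg_right hk' hs.le
      linarith
    · have hB : (fun k => (P.slack (z k).x i)⁻¹ * (dsAff P prm (Q k) (z k) i +
          gamma P prm (Q k) (z k) * dsCor P prm (Q k) (z k) i)) =O[ℱ] fun _ => (1 : ℝ) :=
        isBigO_one_mul (h.inv_slack_isBigO hi)
          ((dsAff_isBigO hd i).add (h.gamma_mul_dsCor_isBigO hd i))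
      obtain ⟨C, hC, hCB⟩ := exists_abs_le_of_isBigO_one hB
      refine ⟨C, hC, ?_⟩
      filter_upwards [hCB] with k hk
      have hs := (h.reg k).slack_pos i
      have hk' := (abs_le.1 hk).1
      rw [le_inv_mul_iff₀ hs] at hk'
      have e5 : ds P prm (Q k) (z k) i = dsAff P prm (Q k) (z k) i +
          gamma P prm (Q k) (z k) * dsCor P prm (Q k) (z k) i := rfl
      rw [e5]
      linarith
  choose C hC0 hC using key
  set D := 1 + ∑ i, C i with hD
  have hCD : ∀ i, C i ≤ D := fun i => by
    have := Finset.single_le_sum (f := C) (fun i _ => (hC0 i).le) (Finset.mem_univ i)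
    linarith
  have hD0 : 0 < D := by
    have : 0 ≤ ∑ i, C i := Finset.sum_nonneg fun i _ => (hC0 i).le
    linarith
  -- The step `D⁻¹` is feasible for all slacks, and the rule takes at least the fraction `κ` of it,
  -- up to the cap `1`.
  refine ⟨min 1 (prm.κ * D⁻¹), lt_min one_pos (mul_pos prm.κ_mem.1 (inv_pos.2 hD0)), ?_⟩
  filter_upwards [eventually_all.2 hC] with k hk
  refine le_trans (min_le_min le_rfl (le_max_left _ _)) (le_stepSize prm.κ_mem.1.le fun i => ?_)
  have hs := (h.reg k).slack_pos i
  have h1 : -D * P.slack (z k).x i ≤ ds P prm (Q k) (z k) i := by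
    refine le_trans ?_ (hk i)
    nlinarith [hCD i]
  have h2 := mul_le_mul_of_nonneg_left h1 (inv_pos.2 hD0).le
  have h3 : D⁻¹ * (-D * P.slack (z k).x i) = -P.slack (z k).x i := by
    field_simp
  linarith

end Bounded

/-- Pair `MΔxᵃ = -∇f(x)` with `Δxᵃ`. The factor `n` bounds the dot product by the product of sup
norms. -/
theorem dxAff_isBigO {c : ℝ} (hc : 0 < c) (hM : ∀ᶠ k in ℱ, ∀ d : Fin n → ℝ,
    c * ‖d‖ ^ 2 ≤ d ⬝ᵥ (M P prm (Q k) (z k) *ᵥ d)) :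
    (fun k => dxAff P prm (Q k) (z k)) =O[ℱ] fun _ => (1 : ℝ) := by
  refine IsBigO.trans (g := fun k => P.grad (z k).x) (IsBigO.of_bound (c⁻¹ * n) ?_)
    (h.grad_tendsto.isBigO_one ℝ)
  filter_upwards [hM] with k hk
  have h1 := hk (dxAff P prm (Q k) (z k))
  rw [(h.reg k).M_mulVec_dxAff] at h1
  have h2 : dxAff P prm (Q k) (z k) ⬝ᵥ -P.grad (z k).x ≤
      n * (‖dxAff P prm (Q k) (z k)‖ * ‖P.grad (z k).x‖) := by
    calc dxAff P prm (Q k) (z k) ⬝ᵥ -P.grad (z k).x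
        ≤ ∑ i : Fin n, ‖dxAff P prm (Q k) (z k)‖ * ‖P.grad (z k).x‖ := by
          refine Finset.sum_le_sum fun i _ => ?_
          refine (le_abs_self _).trans ?_
          rw [abs_mul]
          refine mul_le_mul (norm_le_pi_norm (dxAff P prm (Q k) (z k)) i) ?_ (abs_nonneg _)
            (norm_nonneg _)
          rw [Pi.neg_apply, abs_neg]
          exact norm_le_pi_norm (P.grad (z k).x) i
      _ = _ := by simp
  have h3 : 0 < ‖dxAff P prm (Q k) (z k)‖ := norm_pos_iff.2 (h.reg k).dxAff_ne_zero
  rw [mul_assoc, le_inv_mul_iff₀ hc]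
  nlinarith

/-- Where the multiplier estimates of the active constraints stay positive, vanishing progress
forces the affine-scaling directions to vanish. -/
theorem dxAff_tendsto_zero {c δ : ℝ} (hc : 0 < c) (hM : ∀ᶠ k in ℱ, ∀ d : Fin n → ℝ,
    c * ‖d‖ ^ 2 ≤ d ⬝ᵥ (M P prm (Q k) (z k) *ᵥ d)) (hδ : 0 < δ)
    (hl : ∀ᶠ k in ℱ, ∀ i ∈ P.active xl, δ ≤ (z k).lam i)
    (hf : Tendsto (fun k => P.f (z k).x - P.f (next P prm (Q k) (z k)).x) ℱ (𝓝 0)) :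
    Tendsto (fun k => dxAff P prm (Q k) (z k)) ℱ (𝓝 0) := by
  obtain ⟨a, ha, hal⟩ := h.exists_le_alphaPrimal (h.dxAff_isBigO hc hM) hδ hl
  have hω := prm.ω_mem.1
  have hb : 0 < a * (prm.ω / 2 * c) := by positivity
  rw [tendsto_zero_iff_norm_tendsto_zero]
  -- The decrease of `f` is at least `a · (ω/2) · c · ‖Δxᵃ‖²`.
  have hsq : Tendsto (fun k => ‖dxAff P prm (Q k) (z k)‖ ^ 2) ℱ (𝓝 0) := by
    refine squeeze_zero' (Eventually.of_forall fun _ => sq_nonneg _) ?_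
      (by simpa using hf.const_mul (a * (prm.ω / 2 * c))⁻¹ :
        Tendsto (fun k => (a * (prm.ω / 2 * c))⁻¹ *
          (P.f (z k).x - P.f (next P prm (Q k) (z k)).x)) ℱ (𝓝 0))
    filter_upwards [hal, hM] with k hk1 hk2
    rw [le_inv_mul_iff₀ hb]
    have h1 := (h.reg k).f_xNext_le (prm := prm) (Q := Q k)
    have h2 := hk2 (dxAff P prm (Q k) (z k))
    have h3 : a * (prm.ω / 2 * (c * ‖dxAff P prm (Q k) (z k)‖ ^ 2)) ≤
        alphaPrimal P prm (Q k) (z k) * (prm.ω / 2 * (dxAff P prm (Q k) (z k) ⬝ᵥ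
          (M P prm (Q k) (z k) *ᵥ dxAff P prm (Q k) (z k)))) := by
      have := ((h.reg k).alphaPrimal_pos (prm := prm) (Q := Q k)).le
      gcongr
    have h4 : (next P prm (Q k) (z k)).x = xNext P prm (Q k) (z k) := rfl
    rw [h4]
    linarith
  have := hsq.sqrt
  simpa [Real.sqrt_sq (norm_nonneg _)] using this

end

end Approach
-- Multiplier estimates and the dual step size
section Single

variable {Q : Finset (Fin m)} {z : Iterate n m}

theorem lamT_next : (next P prm Q z).lamT =
    lamAff P prm Q z + gamma P prm Q z • dlamCor P prm Q z := by
  ext i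
  by_cases hi : i ∈ Q
  · simp only [next, hi, if_true, dlam, Pi.add_apply, dlamAff_of_mem hi]; ring
  · simp [next, hi, lamAff, dlamCor]

theorem add_dlam_of_mem {i : Fin m} (hi : i ∈ Q) :
    z.lam i + dlam P prm Q z i = (next P prm Q z).lamT i := by
  simp [next, hi]

/-- A lower bound on the dual step size by the relative decrease of the multiplier estimates. -/
theorem le_alphaDual {q : ℝ} (hq : 0 ≤ q)
    (h : ∀ i ∈ Q, -(q * z.lam i) ≤ z.lam i + dlam P prm Q z i) :
    min 1 ((1 + q)⁻¹ - prm.normX (dx P prm Q z)) ≤ alphaDual P prm Q z := by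
  have hr0 : 0 < (1 + q)⁻¹ := by positivity
  have hr : (1 + q)⁻¹ * (1 + q) = 1 := inv_mul_cancel₀ (by positivity)
  refine le_trans (min_le_min le_rfl (le_max_right _ _)) (le_stepSize prm.κ_mem.1.le fun i hi => ?_)
  set r := (1 + q)⁻¹
  have h1 := mul_le_mul_of_nonneg_left (h i hi) hr0.le
  have h2 : z.lam i + r * dlam P prm Q z i =
      (r * (1 + q) - r) * z.lam i + r * (z.lam i + dlam P prm Q z i) := by rw [hr]; ring
  rw [h2]
  linarith

/-- The relative decrease of the multiplier estimates is governed by the relative changes of the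
slacks. -/
theorem Regular.neg_mul_lam_le (hz : Regular P z) {i : Fin m} (hi : i ∈ Q) :
    -((2 * |dsAff P prm Q z i / P.slack z.x i| + (dsAff P prm Q z i / P.slack z.x i) ^ 2 +
      |gamma P prm Q z * dsCor P prm Q z i / P.slack z.x i|) * z.lam i) ≤
      z.lam i + dlam P prm Q z i := by
  have hs := hz.slack_pos i
  have hl := hz.lam_pos i
  obtain ⟨hg0, hg1, -⟩ := hz.gamma_spec (prm := prm) (Q := Q)
  -- With the relative slack changes `e` and `u`, the new estimate is `λᵢ(-e + γ(e + e²) - u) +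
  -- γσμ/sᵢ`, whose last term only helps.
  set e := dsAff P prm Q z i / P.slack z.x i with he
  set g := gamma P prm Q z with hg
  set u := g * dsCor P prm Q z i / P.slack z.x i with hu
  have h1 : lamAff P prm Q z i = -(z.lam i * e) := by
    rw [lamAff_of_mem hi, he]; ring
  have h2 : dlamAff P prm Q z i = -z.lam i - z.lam i * e := by
    rw [dlamAff_of_mem hi, h1]; ring
  have h3 := hz.slack_mul_dlamCor (prm := prm) hi
  have h4 : g * dlamCor P prm Q z i = g * (sigma P prm Q z * mu P Q z) / P.slack z.x i +
      g * (z.lam i * (e + e ^ 2)) - z.lam i * u := by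
    have h5 : dlamCor P prm Q z i = (sigma P prm Q z * mu P Q z -
      dsAff P prm Q z i * dlamAff P prm Q z i - z.lam i * dsCor P prm Q z i) /
        P.slack z.x i := by
      rw [eq_div_iff hs.ne', mul_comm]; exact h3
    rw [h5, h2, hu, he]
    field_simp
    ring
  have h6 : 0 ≤ g * (sigma P prm Q z * mu P Q z) / P.slack z.x i :=
    div_nonneg (mul_nonneg hg0 (mul_nonneg sigma_nonneg hz.mu_nonneg)) hs.le
  rw [add_dlam_of_mem hi, lamT_next, Pi.add_apply, Pi.smul_apply, smul_eq_mul, ← hg, h4, h1]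
  have h7 : -(|e| + e ^ 2) ≤ g * (e + e ^ 2) := by
    have := neg_abs_le e
    nlinarith [abs_nonneg e, sq_nonneg e, mul_nonneg hg0 (by linarith : 0 ≤ e + |e|),
      mul_nonneg hg0 (sq_nonneg e), mul_nonneg (sub_nonneg.2 hg1) (abs_nonneg e)]
  have h8 := le_abs_self e
  have h9 := le_abs_self u
  have h10 : 0 ≤ g * (e + e ^ 2) + (|e| + e ^ 2) + (|e| - e) + (|u| - u) := by linarith
  have := mul_nonneg hl.le h10
  linarith

theorem muNext_nonneg (hz : Regular P z) : 0 ≤ muNext P prm Q z :=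
  dualityMeasure_nonneg (fun i => (hz.slack_xNext_pos i).le) fun _ _ =>
    (le_min chi_nonneg prm.lamLow_mem.1.le).trans (le_max_right _ _)

end Single

/-- A sum of positive powers of two norms vanishes in the limit exactly when both norms do. The
first condition makes limits stationary, the second makes their multipliers nonnegative. -/
theorem chi_tendsto_zero_iff {ι : Type*} {ℱ : Filter ι} {z : ι → Iterate n m}
    {Q : ι → Finset (Fin m)} : Tendsto (fun k => chi P prm (Q k) (z k)) ℱ (𝓝 0) ↔
      Tendsto (fun k => dxAff P prm (Q k) (z k)) ℱ (𝓝 0) ∧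
      Tendsto (fun k i => min (lamAff P prm (Q k) (z k) i) 0) ℱ (𝓝 (0 : Fin m → ℝ)) := by
  have hν : 0 < prm.ν := by linarith [prm.ν_ge]
  have hiff : ∀ a : ι → ℝ, (∀ k, 0 ≤ a k) →
      (Tendsto (fun k => a k ^ prm.ν) ℱ (𝓝 0) ↔ Tendsto a ℱ (𝓝 0)) := by
    intro a ha
    constructor
    · intro h
      have := h.rpow_const (p := prm.ν⁻¹) (Or.inr (inv_pos.2 hν).le)
      rw [Real.zero_rpow (inv_pos.2 hν).ne'] at this
      refine this.congr fun k => ?_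
      rw [← Real.rpow_mul (ha k), mul_inv_cancel₀ hν.ne', Real.rpow_one]
    · intro h
      have := h.rpow_const (p := prm.ν) (Or.inr hν.le)
      rwa [Real.zero_rpow hν.ne'] at this
  rw [← prm.normX.tendsto_zero_iff, ← prm.normL.tendsto_zero_iff,
    ← hiff _ fun k => prm.normX.nonneg _, ← hiff _ fun k => prm.normL.nonneg _]
  simp only [chi_eq]
  have h1 : ∀ k, 0 ≤ prm.normX (dxAff P prm (Q k) (z k)) ^ prm.ν := fun k =>
    Real.rpow_nonneg (prm.normX.nonneg _) _
  have h2 : ∀ k, 0 ≤ prm.normL (fun i => min (lamAff P prm (Q k) (z k) i) 0) ^ prm.ν := fun k =>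
    Real.rpow_nonneg (prm.normL.nonneg _) _
  refine ⟨fun h => ⟨squeeze_zero h1 (fun k => le_add_of_nonneg_right (h2 k)) h,
    squeeze_zero h2 (fun k => le_add_of_nonneg_left (h1 k)) h⟩, fun h => ?_⟩
  simpa using h.1.add h.2

/-! ### Consequences of vanishing affine-scaling directions -/

namespace Approach

variable {ι : Type*} {ℱ : Filter ι} {z : ι → Iterate n m} {Q : ι → Finset (Fin m)}
  {xl : Fin n → ℝ} (h : Approach ℱ P z Q xl)
  (hd : Tendsto (fun k => dxAff P prm (Q k) (z k)) ℱ (𝓝 0))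
include h hd

omit h in
theorem dsAff_tendsto (i : Fin m) : Tendsto (fun k => dsAff P prm (Q k) (z k) i) ℱ (𝓝 0) :=
  tendsto_apply_zero (by simpa [dsAff] using tendsto_mulVec P.A hd :
    Tendsto (fun k => P.A *ᵥ dxAff P prm (Q k) (z k)) ℱ (𝓝 0)) i

/-- The dual-feasibility row tends to `Aᵀλ = ∇f` at the limit point, and the inactive components
vanish with `Δsᵃ`. -/
theorem lamAff_tendsto [ℱ.NeBot] : ∃ lam, P.IsMultiplier xl lam ∧
    Tendsto (fun k => lamAff P prm (Q k) (z k)) ℱ (𝓝 lam) := by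
  have h1 : Tendsto (fun k => P.Aᵀ *ᵥ lamAff P prm (Q k) (z k)) ℱ (𝓝 (P.grad xl)) := by
    simp only [(h.reg _).transpose_mulVec_lamAff]
    simpa using (W_mulVec_tendsto hd).add h.grad_tendsto
  obtain ⟨lam, h2, h3, h4⟩ := tendsto_of_transpose h.li h1 fun i hi => by
    have hlim := tendsto_zero_mul_of_isBigO_one (dsAff_tendsto hd i)
      (isBigO_one_mul (h.lam_apply_isBigO i) (h.inv_slack_isBigO hi))
    refine squeeze_zero_norm (fun k => ?_) (tendsto_norm_zero.comp hlim)
    by_cases hQ : i ∈ Q k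
    · rw [lamAff_of_mem hQ, norm_neg, Function.comp_apply, div_eq_mul_inv, mul_comm]
    · rw [lamAff_of_notMem hQ, norm_zero]; exact norm_nonneg _
  exact ⟨lam, ⟨h2, h3⟩, h4⟩

theorem gamma_smul_dxCor_tendsto :
    Tendsto (fun k => gamma P prm (Q k) (z k) • dxCor P prm (Q k) (z k)) ℱ (𝓝 0) := by
  rw [← prm.normX.tendsto_zero_iff] at hd ⊢
  refine squeeze_zero (fun _ => prm.normX.nonneg _) (fun k => ?_) hd
  obtain ⟨h0, -, h2, -⟩ := (h.reg k).gamma_spec (prm := prm) (Q := Q k)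
  rw [VecNorm.map_smul, abs_of_nonneg h0]
  nlinarith [prm.τ_mem.2, prm.normX.nonneg (dxAff P prm (Q k) (z k))]

theorem gamma_mul_dsCor_tendsto (i : Fin m) :
    Tendsto (fun k => gamma P prm (Q k) (z k) * dsCor P prm (Q k) (z k) i) ℱ (𝓝 0) := by
  have h1 := tendsto_apply_zero
    (by simpa using tendsto_mulVec P.A (h.gamma_smul_dxCor_tendsto hd)) i
  refine h1.congr fun k => ?_
  rw [Matrix.mulVec_smul]
  rfl

theorem dx_tendsto : Tendsto (fun k => dx P prm (Q k) (z k)) ℱ (𝓝 0) := by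
  simpa [dx] using hd.add (h.gamma_smul_dxCor_tendsto hd)

theorem xNext_tendsto : Tendsto (fun k => (next P prm (Q k) (z k)).x) ℱ (𝓝 xl) := by
  have h1 : Tendsto (fun k => alphaPrimal P prm (Q k) (z k) • dx P prm (Q k) (z k)) ℱ (𝓝 0) := by
    refine squeeze_zero_norm (fun k => ?_) (tendsto_norm_zero.comp (h.dx_tendsto hd))
    rw [norm_smul, Real.norm_of_nonneg (h.reg k).alphaPrimal_pos.le]
    exact mul_le_of_le_one_left (norm_nonneg _) alphaPrimal_le_one
  simpa [next, xNext] using h.tendsto.add h1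

/-- The weighted centering parameter vanishes together with the affine-scaling direction. -/
theorem gamma_mul_sigma_mul_mu_tendsto : Tendsto (fun k => gamma P prm (Q k) (z k) *
    (sigma P prm (Q k) (z k) * mu P (Q k) (z k))) ℱ (𝓝 0) := by
  have hdO := hd.isBigO_one ℝ
  by_cases hA : ∃ i, i ∈ P.active xl
  -- An active constraint lies in the working sets; in its corrector row, scaled by `γ`, every term
  -- except the centering term has a factor that vanishes and otherwise bounded factors.
  · obtain ⟨i, hi⟩ := hA
    have h1 : Tendsto (fun k => P.slack (z k).x i *
        (gamma P prm (Q k) (z k) * dlamCor P prm (Q k) (z k) i) +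
        (dsAff P prm (Q k) (z k) i *
          (gamma P prm (Q k) (z k) * dlamAff P prm (Q k) (z k) i) +
        gamma P prm (Q k) (z k) * dsCor P prm (Q k) (z k) i * (z k).lam i)) ℱ (𝓝 0) := by
      have hs := h.slack_tendsto i
      rw [P.mem_active_iff.1 hi] at hs
      simpa using (tendsto_zero_mul_of_isBigO_one hs
        (isBigO_one_apply (h.gamma_smul_dlamCor_isBigO hdO) i)).add
        ((tendsto_zero_mul_of_isBigO_one (dsAff_tendsto hd i)
          (isBigO_one_mul h.gamma_isBigO (h.dlamAff_isBigO hdO i))).add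
        (tendsto_zero_mul_of_isBigO_one (h.gamma_mul_dsCor_tendsto hd i) (h.lam_apply_isBigO i)))
    refine h1.congr' ?_
    filter_upwards [h.act] with k hk
    have := (h.reg k).slack_mul_dlamCor (prm := prm) (hk i hi)
    linear_combination gamma P prm (Q k) (z k) * this
  -- Without active constraints all relative slack changes vanish, so `αᵃ → 1` and `σ → 0`.
  · push Not at hA
    have hq : Tendsto (fun k => ∑ i, |dsAff P prm (Q k) (z k) i / P.slack (z k).x i|)
        ℱ (𝓝 0) := by
      rw [← Finset.sum_const_zero (s := (Finset.univ : Finset (Fin m)))]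
      refine tendsto_finsetSum _ fun i _ => ?_
      have := (tendsto_zero_mul_of_isBigO_one (dsAff_tendsto hd i) (h.inv_slack_isBigO (hA i))).abs
      simpa [div_eq_mul_inv] using this
    have hα : Tendsto (fun k => alphaAff P prm (Q k) (z k)) ℱ (𝓝 1) := by
      have h2 := (hq.const_add 1).inv₀ (by norm_num)
      rw [add_zero, inv_one] at h2
      exact tendsto_of_tendsto_of_tendsto_of_le_of_le h2 tendsto_const_nhds
        (fun k => (h.reg k).le_alphaAff) fun k => alphaAff_le_one
    have hσ : Tendsto (fun k => sigma P prm (Q k) (z k)) ℱ (𝓝 0) := by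
      simpa [sigma] using ((tendsto_const_nhds (x := (1 : ℝ))).sub hα).pow 3
    have := tendsto_zero_mul_of_isBigO_one hσ
      (isBigO_one_mul (h.gamma_isBigO (prm := prm)) h.mu_isBigO)
    refine this.congr fun k => by ring

theorem gamma_smul_dlamCor_tendsto [ℱ.NeBot] :
    Tendsto (fun k => gamma P prm (Q k) (z k) • dlamCor P prm (Q k) (z k)) ℱ (𝓝 0) := by
  have hdO := hd.isBigO_one ℝ
  refine tendsto_zero_of_transpose h.li ?_ fun i hi => ?_
  · simp only [Matrix.mulVec_smul, (h.reg _).transpose_mulVec_dlamCor]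
    simp only [← Matrix.mulVec_smul]
    exact W_mulVec_tendsto (h.gamma_smul_dxCor_tendsto hd)
  · have h1 : Tendsto (fun k => (gamma P prm (Q k) (z k) *
        (sigma P prm (Q k) (z k) * mu P (Q k) (z k)) - dsAff P prm (Q k) (z k) i *
        (gamma P prm (Q k) (z k) * dlamAff P prm (Q k) (z k) i) -
        gamma P prm (Q k) (z k) * dsCor P prm (Q k) (z k) i * (z k).lam i) *
        (P.slack (z k).x i)⁻¹) ℱ (𝓝 0) := by
      refine tendsto_zero_mul_of_isBigO_one ?_ (h.inv_slack_isBigO hi)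
      simpa using ((h.gamma_mul_sigma_mul_mu_tendsto hd).sub
        (tendsto_zero_mul_of_isBigO_one (dsAff_tendsto hd i)
          (isBigO_one_mul h.gamma_isBigO (h.dlamAff_isBigO hdO i)))).sub
        (tendsto_zero_mul_of_isBigO_one (h.gamma_mul_dsCor_tendsto hd i) (h.lam_apply_isBigO i))
    refine squeeze_zero_norm (fun k => ?_) (tendsto_norm_zero.comp h1)
    rw [Function.comp_apply, Pi.smul_apply, smul_eq_mul]
    by_cases hQ : i ∈ Q k
    · refine le_of_eq (congrArg _ ?_)
      rw [eq_mul_inv_iff_mul_eq₀ ((h.reg k).slack_pos i).ne']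
      have := (h.reg k).slack_mul_dlamCor (prm := prm) hQ
      linear_combination gamma P prm (Q k) (z k) * this
    · rw [dlamCor_of_notMem hQ, mul_zero, norm_zero]; exact norm_nonneg _

theorem lamT_next_tendsto [ℱ.NeBot] {lam : Fin m → ℝ}
    (hl : Tendsto (fun k => lamAff P prm (Q k) (z k)) ℱ (𝓝 lam)) :
    Tendsto (fun k => (next P prm (Q k) (z k)).lamT) ℱ (𝓝 lam) := by
  simp only [lamT_next]
  simpa using hl.add (h.gamma_smul_dlamCor_tendsto hd)

section Strict

variable {lams : Fin m → ℝ} (hm : P.IsMultiplier xl lams) (hpos : ∀ i ∈ P.active xl, 0 < lams i)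
include hm hpos

omit h hd in
theorem lams_nonneg (i : Fin m) : 0 ≤ lams i := by
  by_cases hi : i ∈ P.active xl
  · exact (hpos i hi).le
  · exact (hm.2 i hi).ge

omit hpos in
theorem lamAff_tendsto_of_isMultiplier [ℱ.NeBot] :
    Tendsto (fun k => lamAff P prm (Q k) (z k)) ℱ (𝓝 lams) := by
  obtain ⟨lam, hlam, ht⟩ := h.lamAff_tendsto hd
  rwa [CQP.IsMultiplier.eq h.li hlam hm] at ht

theorem chi_tendsto [ℱ.NeBot] : Tendsto (fun k => chi P prm (Q k) (z k)) ℱ (𝓝 0) := by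
  refine chi_tendsto_zero_iff.2 ⟨hd, tendsto_pi_nhds.2 fun i => ?_⟩
  have := (tendsto_pi_nhds.1 (h.lamAff_tendsto_of_isMultiplier hd hm) i).min
    (tendsto_const_nhds (x := (0 : ℝ)))
  rwa [min_eq_right (lams_nonneg hm hpos i)] at this

/-- Estimates of active multipliers become positive and do not restrict the step. On inactive
constraints the relative decrease is at most `q'`, which vanishes. The alternative `ᾱ - ‖Δx‖` in the
step-size rule then gives the limit `1`, because `Δx → 0`. -/
theorem alphaDual_tendsto [ℱ.NeBot] :
    Tendsto (fun k => alphaDual P prm (Q k) (z k)) ℱ (𝓝 1) := by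
  classical
  let q : ι → Fin m → ℝ := fun k i => 2 * |dsAff P prm (Q k) (z k) i / P.slack (z k).x i| +
    (dsAff P prm (Q k) (z k) i / P.slack (z k).x i) ^ 2 +
    |gamma P prm (Q k) (z k) * dsCor P prm (Q k) (z k) i / P.slack (z k).x i|
  have hq0 : ∀ k i, 0 ≤ q k i := fun k i => by positivity
  have hq : ∀ i ∉ P.active xl, Tendsto (fun k => q k i) ℱ (𝓝 0) := fun i hi => by
    have h1 := tendsto_zero_mul_of_isBigO_one (dsAff_tendsto hd i) (h.inv_slack_isBigO hi)
    have h2 := tendsto_zero_mul_of_isBigO_one (h.gamma_mul_dsCor_tendsto hd i)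
      (h.inv_slack_isBigO hi)
    simpa [q, div_eq_mul_inv] using ((h1.abs.const_mul 2).add (h1.pow 2)).add h2.abs
  let q' : ι → ℝ := fun k => ∑ i with i ∉ P.active xl, q k i
  have hq' : Tendsto q' ℱ (𝓝 0) := by
    rw [← Finset.sum_const_zero (s := Finset.univ.filter fun i => i ∉ P.active xl)]
    exact tendsto_finsetSum _ fun i hi => hq i (by simpa using hi)
  have hq'0 : ∀ k, 0 ≤ q' k := fun k => Finset.sum_nonneg fun i _ => hq0 k i
  have hlow : Tendsto (fun k => min 1 ((1 + q' k)⁻¹ - prm.normX (dx P prm (Q k) (z k)))) ℱ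
      (𝓝 1) := by
    have h1 := (hq'.const_add 1).inv₀ (by norm_num)
    have h2 := prm.normX.tendsto_zero_iff.2 (h.dx_tendsto hd)
    simpa using (tendsto_const_nhds (x := (1 : ℝ))).min (h1.sub h2)
  have hact : ∀ᶠ k in ℱ, ∀ i ∈ P.active xl, 0 < (next P prm (Q k) (z k)).lamT i := by
    have h1 := h.lamT_next_tendsto hd (h.lamAff_tendsto_of_isMultiplier hd hm)
    rw [eventually_all]
    intro i
    by_cases hi : i ∈ P.active xl
    · filter_upwards [(tendsto_pi_nhds.1 h1 i).eventually (lt_mem_nhds (hpos i hi))] with k hk _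
      exact hk
    · exact Eventually.of_forall fun k hk => (hi hk).elim
  refine tendsto_of_tendsto_of_tendsto_of_le_of_le' hlow tendsto_const_nhds ?_
    (Eventually.of_forall fun k => alphaDual_le_one)
  filter_upwards [hact] with k hk
  refine le_alphaDual (hq'0 k) fun i hi => ?_
  have hl := (h.reg k).lam_pos i
  by_cases hia : i ∈ P.active xl
  · rw [add_dlam_of_mem hi]
    have := hk i hia
    have := mul_nonneg (hq'0 k) hl.le
    linarith
  · refine le_trans ?_ ((h.reg k).neg_mul_lam_le hi)
    have : q k i ≤ q' k := Finset.single_le_sum (f := q k) (fun i _ => hq0 k i) (by simpa using hia)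
    have := mul_le_mul_of_nonneg_right this hl.le
    simp only [q] at this
    linarith

/-- Near a strictly complementary solution, the multiplier estimates approach the truncated
optimal multipliers as soon as the affine-scaling directions vanish. -/
theorem lam_next_tendsto [ℱ.NeBot] :
    Tendsto (fun k => (next P prm (Q k) (z k)).lam) ℱ (𝓝 fun i => min (lams i) prm.lamMax) := by
  have hχ := h.chi_tendsto hd hm hpos
  have hα := h.alphaDual_tendsto hd hm hpos
  have hT := h.lamT_next_tendsto hd (h.lamAff_tendsto_of_isMultiplier hd hm)
  have hfl : Tendsto (fun k => min (chi P prm (Q k) (z k)) prm.lamLow) ℱ (𝓝 0) := by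
    have := hχ.min (tendsto_const_nhds (x := prm.lamLow))
    rwa [min_eq_left prm.lamLow_mem.1.le] at this
  have hξ : ∀ i, 0 ≤ min (lams i) prm.lamMax := fun i =>
    le_min (lams_nonneg hm hpos i) prm.lamMax_pos.le
  -- The update formula for indices in `Q`, used at all indices, with `λ + α_dΔλ` written as `(1 -
  -- α_d)λ + α_dλ̃⁺`.
  let w : ι → Fin m → ℝ := fun k i => max (min ((1 - alphaDual P prm (Q k) (z k)) * (z k).lam i +
    alphaDual P prm (Q k) (z k) * (next P prm (Q k) (z k)).lamT i) prm.lamMax)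
    (min (chi P prm (Q k) (z k)) prm.lamLow)
  have hw0 : ∀ k i, 0 ≤ w k i := fun k i =>
    (le_min chi_nonneg prm.lamLow_mem.1.le).trans (le_max_right _ _)
  have hw : ∀ i, Tendsto (fun k => w k i) ℱ (𝓝 (min (lams i) prm.lamMax)) := by
    intro i
    have h1 : Tendsto (fun k => (1 - alphaDual P prm (Q k) (z k)) * (z k).lam i) ℱ (𝓝 0) :=
      tendsto_zero_mul_of_isBigO_one (by simpa using (tendsto_const_nhds (x := (1 : ℝ))).sub hα)
        (h.lam_apply_isBigO i)
    have h2 := ((h1.add (hα.mul (tendsto_pi_nhds.1 hT i))).min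
      (tendsto_const_nhds (x := prm.lamMax))).max hfl
    rwa [zero_add, one_mul, max_eq_left (hξ i)] at h2
  have hin : ∀ k, ∀ i ∈ Q k, lamNextIn P prm (Q k) (z k) i = w k i := by
    intro k i hi
    simp only [lamNextIn, w]
    congr 2
    rw [← add_dlam_of_mem hi]
    ring
  have hs : ∀ i, Tendsto (fun k => P.slack (xNext P prm (Q k) (z k)) i) ℱ (𝓝 (P.slack xl i)) :=
    fun i => tendsto_pi_nhds.1 ((P.continuous_slack.tendsto xl).comp (h.xNext_tendsto hd)) i
  have hμ : Tendsto (fun k => muNext P prm (Q k) (z k)) ℱ (𝓝 0) := by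
    -- The new duality measure is at most this sum, whose limit vanishes by complementarity.
    have h1 : Tendsto (fun k => ∑ i, P.slack (xNext P prm (Q k) (z k)) i * w k i) ℱ (𝓝 0) := by
      have h2 : ∑ i, P.slack xl i * min (lams i) prm.lamMax = 0 := by
        refine Finset.sum_eq_zero fun i _ => ?_
        by_cases hi : i ∈ P.active xl
        · rw [P.mem_active_iff.1 hi, zero_mul]
        · rw [hm.2 i hi, min_eq_left prm.lamMax_pos.le, mul_zero]
      rw [← h2]
      exact tendsto_finsetSum _ fun i _ => (hs i).mul (hw i)
    refine squeeze_zero (fun k => muNext_nonneg (h.reg k)) (fun k => ?_) h1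
    have hnn : ∀ i, 0 ≤ P.slack (xNext P prm (Q k) (z k)) i * w k i := fun i =>
      mul_nonneg ((h.reg k).slack_xNext_pos i).le (hw0 k i)
    refine dualityMeasure_le (Finset.sum_nonneg fun i _ => hnn i) fun i hi => ?_
    rw [hin k i hi]
    exact Finset.single_le_sum (f := fun i => P.slack (xNext P prm (Q k) (z k)) i * w k i)
      (fun i _ => hnn i) (Finset.mem_univ i)
  rw [tendsto_pi_nhds]
  intro i
  have heq : ∀ k, (next P prm (Q k) (z k)).lam i =
      if i ∈ Q k then w k i else lamNextOut P prm (Q k) (z k) i := fun k => by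
    by_cases hi : i ∈ Q k
    · simp only [next, hi, if_true, hin k i hi]
    · simp only [next, hi, if_false]
  simp only [heq]
  by_cases hi : i ∈ P.active xl
  · refine (hw i).congr' ?_
    filter_upwards [h.act] with k hk
    rw [if_pos (hk i hi)]
  -- An inactive index may enter and leave the working set; both update formulas tend to zero.
  · refine (hw i).if' ?_
    have h0 : P.slack xl i ≠ 0 := fun h0 => hi (P.mem_active_iff.2 h0)
    have h2 := ((hμ.div (hs i) h0).min (tendsto_const_nhds (x := prm.lamMax))).max hfl
    rw [zero_div, min_eq_left prm.lamMax_pos.le, max_self] at h2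
    rw [hm.2 i hi, min_eq_left prm.lamMax_pos.le]
    exact h2

end Strict

end Approach

end CRMPC

/-! ### Ultrafilters and subsequences -/

/-- Ultrafilters replace successive extractions of subsequences: along one of them every sequence in
a compact set converges, and each property holds eventually or fails eventually. -/
theorem IsCompact.exists_tendsto_ultrafilter {ι X : Type*} [TopologicalSpace X] {S : Set X}
    (hS : IsCompact S) (ℱ : Ultrafilter ι) {u : ι → X} (hu : ∀ k, u k ∈ S) :
    ∃ a ∈ S, Tendsto u ℱ (𝓝 a) :=
  hS.ultrafilter_le_nhds (ℱ.map u) (le_principal_iff.2 (Filter.mem_map.2 (univ_mem' hu)))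

theorem exists_ultrafilter_of_frequently {ι : Type*} {ℱ : Filter ι} {p : ι → Prop}
    (h : ∃ᶠ k in ℱ, p k) :
    ∃ 𝒢 : Ultrafilter ι, (𝒢 : Filter ι) ≤ ℱ ∧ ∀ᶠ k in (𝒢 : Filter ι), p k := by
  have : (ℱ ⊓ 𝓟 {k | p k}).NeBot := frequently_mem_iff_neBot.1 h
  have hle := Ultrafilter.of_le (ℱ ⊓ 𝓟 {k | p k})
  exact ⟨_, hle.trans inf_le_left, le_principal_iff.1 (hle.trans inf_le_right)⟩

theorem exists_pos_le_of_not_mapClusterPt_zero {ι : Type*} {ℱ : Filter ι} {E : Type*}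
    [SeminormedAddCommGroup E] {u : ι → E} (h : ¬ MapClusterPt 0 ℱ u) :
    ∃ δ > 0, ∀ᶠ k in ℱ, δ ≤ ‖u k‖ := by
  rw [mapClusterPt_iff_frequently] at h
  push Not at h
  obtain ⟨s, hs, hev⟩ := h
  obtain ⟨δ, hδ, hball⟩ := Metric.mem_nhds_iff.1 hs
  refine ⟨δ, hδ, ?_⟩
  filter_upwards [hev] with k hk
  by_contra hlt
  exact hk (hball (by simpa using hlt))

theorem exists_pos_forall_le {ι : Type*} {ℱ : Filter ι} {p : ℕ} {S : Set (Fin p)}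
    {u : ι → Fin p → ℝ} (h : ∀ i ∈ S, ∃ δ > 0, ∀ᶠ k in ℱ, δ ≤ u k i) :
    ∃ δ > 0, ∀ᶠ k in ℱ, ∀ i ∈ S, δ ≤ u k i := by
  have h' : ∀ i, ∃ δ > 0, ∀ᶠ k in ℱ, i ∈ S → δ ≤ u k i := fun i => by
    by_cases hi : i ∈ S
    · obtain ⟨δ, hδ, hk⟩ := h i hi
      exact ⟨δ, hδ, hk.mono fun k hk _ => hk⟩
    · exact ⟨1, one_pos, Eventually.of_forall fun k hk => (hi hk).elim⟩
  choose δ hδ hk using h'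
  have hsum : ∀ i, (δ i)⁻¹ ≤ 1 + ∑ j, (δ j)⁻¹ := fun i => by
    have := Finset.single_le_sum (f := fun j => (δ j)⁻¹) (fun j _ => (inv_pos.2 (hδ j)).le)
      (Finset.mem_univ i)
    linarith
  have h0 : 0 ≤ ∑ j, (δ j)⁻¹ := Finset.sum_nonneg fun j _ => (inv_pos.2 (hδ j)).le
  refine ⟨(1 + ∑ j, (δ j)⁻¹)⁻¹, by positivity, ?_⟩
  filter_upwards [eventually_all.2 hk] with k hk i hi
  exact (inv_le_of_inv_le₀ (hδ i) (hsum i)).trans (hk i hi)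

/-- A property that holds along every convergent subsequence holds along ultrafilters. -/
theorem eventually_ultrafilter_of_subsequences {X : Type*} [PseudoMetricSpace X] {u : ℕ → X}
    {a : X} {p : ℕ → Prop} (h : ∀ K : Set ℕ, K.Infinite → Tendsto u (atTop ⊓ 𝓟 K) (𝓝 a) →
      ∀ᶠ k in atTop ⊓ 𝓟 K, p k) {ℱ : Ultrafilter ℕ} (hℱ : (ℱ : Filter ℕ) ≤ atTop)
    (hu : Tendsto u ℱ (𝓝 a)) : ∀ᶠ k in (ℱ : Filter ℕ), p k := by
  by_contra hp
  rw [← Ultrafilter.eventually_not] at hp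
  -- If `p` failed along the ultrafilter, a subsequence converging to `a` could be extracted on
  -- which `p` always fails; its range serves as `K`.
  have hfreq : ∀ j : ℕ, ∃ᶠ k in atTop, dist (u k) a < 1 / ((j : ℝ) + 1) ∧ ¬ p k := fun j =>
    ((hu.eventually (Metric.ball_mem_nhds a (by positivity))).and hp).frequently.filter_mono hℱ
  obtain ⟨φ, hφ, hφ'⟩ := extraction_forall_of_frequently hfreq
  have hmap : map φ atTop = atTop ⊓ 𝓟 (Set.range φ) := by
    rw [← map_comap, comap_embedding_atTop (fun _ _ => hφ.le_iff_le)
      fun c => ⟨c, hφ.id_le c⟩]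
  have htend : Tendsto u (atTop ⊓ 𝓟 (Set.range φ)) (𝓝 a) := by
    rw [← hmap, tendsto_map'_iff, tendsto_iff_dist_tendsto_zero]
    exact squeeze_zero (fun _ => dist_nonneg) (fun j => (hφ' j).1.le)
      tendsto_one_div_add_atTop_nhds_zero_nat
  have hev := h _ (Set.infinite_range_of_injective hφ.injective) htend
  rw [← hmap, eventually_map] at hev
  obtain ⟨j, hj⟩ := hev.exists
  exact (hφ' j).2 hj

/-! ### Infinite runs -/

namespace CRMPC

open Asymptotics

variable {n m : ℕ} {P : CQP n m} {prm : Params P}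

/-- Infinite sequences generated by the iteration that never meet the stopping test. -/
structure IsRun (prm : Params P) (z : ℕ → Iterate n m) (Q : ℕ → Finset (Fin m)) : Prop where
  succ : ∀ k, z (k + 1) = next P prm (Q k) (z k)
  reg : ∀ k, Regular P (z k)

namespace IsRun

variable {z : ℕ → Iterate n m} {Q : ℕ → Finset (Fin m)}

section

variable (h : IsRun prm z Q)
include h

theorem mem_feasible (k : ℕ) : (z k).x ∈ P.feasible :=
  P.mem_feasible_iff.2 fun i => ((h.reg k).slack_pos i).le

theorem antitone_f : Antitone fun k => P.f (z k).x := by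
  refine antitone_nat_of_succ_le fun k => ?_
  rw [h.succ]
  have h1 := (h.reg k).f_xNext_le (prm := prm) (Q := Q k)
  have h2 := (h.reg k).M_quad_pos (prm := prm) (Q := Q k) ((h.reg k).dxAff_ne_zero (prm := prm)
    (Q := Q k))
  have h3 := mul_nonneg ((h.reg k).alphaPrimal_pos (prm := prm) (Q := Q k)).le
    (mul_nonneg (half_pos prm.ω_mem.1).le h2.le)
  change P.f (xNext P prm (Q k) (z k)) ≤ _
  linarith

theorem mem_level (k : ℕ) : (z k).x ∈ P.level (P.f (z 0).x) :=
  ⟨h.mem_feasible k, h.antitone_f (Nat.zero_le k)⟩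

theorem lam_le (k : ℕ) (i : Fin m) : (z k).lam i ≤ max prm.lamMax ((z 0).lam i) := by
  cases k with
  | zero => exact le_max_right _ _
  | succ k => rw [h.succ]; exact (lam_next_le i).trans (le_max_left _ _)

theorem lam_mem_Icc (k : ℕ) :
    (z k).lam ∈ Set.Icc (0 : Fin m → ℝ) fun i => max prm.lamMax ((z 0).lam i) :=
  ⟨fun i => ((h.reg k).lam_pos i).le, fun i => h.lam_le k i⟩

theorem lam_isBigO {ι : Type*} {ℱ : Filter ι} (u : ι → ℕ) :
    (fun k => (z (u k)).lam) =O[ℱ] fun _ => (1 : ℝ) :=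
  isBigO_pi.2 fun i => isBigO_one_of_abs_le (C := max prm.lamMax ((z 0).lam i))
    (Eventually.of_forall fun k => by
      rw [abs_of_pos ((h.reg _).lam_pos i)]; exact h.lam_le _ i)

variable (hlev : ∀ r, IsCompact (P.level r))
include hlev

theorem exists_limit (ℱ : Ultrafilter ℕ) :
    ∃ x' ∈ P.feasible, Tendsto (fun k => (z k).x) ℱ (𝓝 x') := by
  obtain ⟨a, ha, hta⟩ := (hlev _).exists_tendsto_ultrafilter ℱ h.mem_level
  exact ⟨a, ha.1, hta⟩

theorem exists_f_tendsto : ∃ L, Tendsto (fun k => P.f (z k).x) atTop (𝓝 L) := by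
  obtain ⟨B, hB⟩ := ((hlev (P.f (z 0).x)).image P.continuous_f).bddBelow
  exact ⟨_, tendsto_atTop_ciInf h.antitone_f
    ⟨B, by rintro _ ⟨k, rfl⟩; exact hB ⟨_, h.mem_level k, rfl⟩⟩⟩

theorem f_sub_tendsto :
    Tendsto (fun k => P.f (z k).x - P.f (next P prm (Q k) (z k)).x) atTop (𝓝 0) := by
  obtain ⟨L, hL⟩ := h.exists_f_tendsto hlev
  simp only [← h.succ]
  simpa using hL.sub ((tendsto_add_atTop_iff_nat 1).2 hL)

/-- If the objective values of a run come arbitrarily close to the minimum, the run converges to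
the primal solution set. -/
theorem infDist_tendsto {xs : Fin n → ℝ} (hxs : xs ∈ P.primalSolutions)
    (hf : ∀ η > 0, ∃ k, P.f (z k).x ≤ P.f xs + η) :
    Tendsto (fun k => Metric.infDist (z k).x P.primalSolutions) atTop (𝓝 0) := by
  obtain ⟨L, hL⟩ := h.exists_f_tendsto hlev
  have hLs : L ≤ P.f xs := le_of_forall_pos_le_add fun η hη => by
    obtain ⟨k, hk⟩ := hf η hη
    exact (h.antitone_f.le_of_tendsto hL k).trans hk
  -- Every ultrafilter limit of the iterates is feasible with value at most the minimum, hence a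
  -- minimizer.
  rw [tendsto_iff_ultrafilter]
  intro ℱ hℱ
  obtain ⟨x', hx', ht⟩ := h.exists_limit hlev ℱ
  have h1 : P.f x' = L := tendsto_nhds_unique ((P.continuous_f.tendsto x').comp ht)
    (hL.mono_left hℱ)
  have h2 : x' ∈ P.primalSolutions := ⟨hx', fun y hy => h1 ▸ hLs.trans (hxs.2 y hy)⟩
  have := ((Metric.continuous_infDist_pt P.primalSolutions).tendsto x').comp ht
  rwa [Metric.infDist_zero_of_mem h2] at this

end

end IsRun

/-! ### Coercive runs: limit points and convergence -/

/-- A run along which the normal matrices are uniformly positive definite and the working sets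
eventually contain the constraints active at limit points. -/
structure IsCoerciveRun (prm : Params P) (z : ℕ → Iterate n m) (Q : ℕ → Finset (Fin m)) : Prop
    extends IsRun prm z Q where
  level_compact : ∀ r, IsCompact (P.level r)
  licq : ∀ x ∈ P.feasible, LinearIndependent ℝ (fun i : P.active x => P.A i)
  coercive : ∃ c > 0, ∀ᶠ k in atTop, ∀ d : Fin n → ℝ,
    c * ‖d‖ ^ 2 ≤ d ⬝ᵥ (M P prm (Q k) (z k) *ᵥ d)
  active_subset : ∀ ℱ : Ultrafilter ℕ, (ℱ : Filter ℕ) ≤ atTop → ∀ x',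
    Tendsto (fun k => (z k).x) ℱ (𝓝 x') → ∀ᶠ k in (ℱ : Filter ℕ), ∀ i ∈ P.active x', i ∈ Q k

namespace IsCoerciveRun

variable {z : ℕ → Iterate n m} {Q : ℕ → Finset (Fin m)} (h : IsCoerciveRun prm z Q)
include h

theorem approach {ℱ : Ultrafilter ℕ} (hℱ : (ℱ : Filter ℕ) ≤ atTop) {x' : Fin n → ℝ}
    (hx' : x' ∈ P.feasible) (ht : Tendsto (fun k => (z k).x) ℱ (𝓝 x')) :
    Approach (ℱ : Filter ℕ) P z Q x' where
  reg := h.reg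
  tendsto := ht
  act := h.active_subset ℱ hℱ x' ht
  lam_isBigO := h.lam_isBigO id
  li := h.licq x' hx'

theorem approach_succ {ℱ : Ultrafilter ℕ} (hℱ : (ℱ : Filter ℕ) ≤ atTop) {x' : Fin n → ℝ}
    (hx' : x' ∈ P.feasible) (ht : Tendsto (fun k => (z (k + 1)).x) ℱ (𝓝 x')) :
    Approach (ℱ : Filter ℕ) P (fun k => z (k + 1)) (fun k => Q (k + 1)) x' where
  reg k := h.reg (k + 1)
  tendsto := ht
  act := h.active_subset (ℱ.map (· + 1))
    ((tendsto_add_atTop_nat 1).mono_left hℱ) x' (tendsto_map'_iff.2 ht)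
  lam_isBigO := h.lam_isBigO (· + 1)
  li := h.licq x' hx'

theorem dxAff_succ_tendsto_of_le {ℱ : Ultrafilter ℕ} (hℱ : (ℱ : Filter ℕ) ≤ atTop)
    {x' : Fin n → ℝ} (hx' : x' ∈ P.feasible)
    (ht : Tendsto (fun k => (z (k + 1)).x) ℱ (𝓝 x')) {δ : ℝ} (hδ : 0 < δ)
    (hl : ∀ᶠ k in (ℱ : Filter ℕ), ∀ i ∈ P.active x', δ ≤ (z (k + 1)).lam i) :
    Tendsto (fun k => dxAff P prm (Q (k + 1)) (z (k + 1))) ℱ (𝓝 0) := by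
  obtain ⟨c, hc, hM⟩ := h.coercive
  have hsh : Tendsto (fun k : ℕ => k + 1) ℱ atTop := (tendsto_add_atTop_nat 1).mono_left hℱ
  exact (h.approach_succ hℱ hx' ht).dxAff_tendsto_zero hc (hsh.eventually hM) hδ hl
    ((h.f_sub_tendsto h.level_compact).comp hsh)

/-- The index shift arises because the floor computed from `χ` at iteration `k` acts on the
multipliers of iterate `k + 1`. -/
theorem dxAff_succ_tendsto_of_chi {ℱ : Ultrafilter ℕ} (hℱ : (ℱ : Filter ℕ) ≤ atTop) {δ : ℝ}
    (hδ : 0 < δ) (hχ : ∀ᶠ k in (ℱ : Filter ℕ), δ ≤ chi P prm (Q k) (z k)) :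
    Tendsto (fun k => dxAff P prm (Q (k + 1)) (z (k + 1))) ℱ (𝓝 0) := by
  obtain ⟨x', hx', ht⟩ := h.exists_limit h.level_compact (ℱ.map (· + 1))
  refine h.dxAff_succ_tendsto_of_le hℱ hx' (tendsto_map'_iff.1 ht)
    (lt_min hδ prm.lamLow_mem.1) ?_
  filter_upwards [hχ] with k hk i _
  rw [h.succ]
  exact (min_le_min hk le_rfl).trans (min_chi_le_lam_next i)

/-- Along a coercive run the quantities `χ` cluster at zero. -/
theorem mapClusterPt_chi : MapClusterPt 0 atTop fun k => chi P prm (Q k) (z k) := by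
  by_contra hcl
  obtain ⟨δ, hδ, hχ'⟩ := exists_pos_le_of_not_mapClusterPt_zero hcl
  have hχ : ∀ᶠ k in atTop, δ ≤ chi P prm (Q k) (z k) := by
    filter_upwards [hχ'] with k hk
    rwa [Real.norm_of_nonneg chi_nonneg] at hk
  have hd : Tendsto (fun k => dxAff P prm (Q k) (z k)) atTop (𝓝 0) := by
    rw [← tendsto_add_atTop_iff_nat 1, tendsto_iff_ultrafilter]
    exact fun ℱ hℱ => h.dxAff_succ_tendsto_of_chi hℱ hδ (hχ.filter_mono hℱ)
  -- the negative parts of the affine estimates stay away from zero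
  obtain ⟨η, hη, hneg⟩ : ∃ η > 0, ∀ᶠ k in atTop, ∃ i, lamAff P prm (Q k) (z k) i ≤ -η := by
    have hn : ¬ MapClusterPt (0 : Fin m → ℝ) atTop
        fun k i => min (lamAff P prm (Q k) (z k) i) 0 := by
      intro hcl'
      obtain ⟨ℱ, hℱ, ht⟩ := mapClusterPt_iff_ultrafilter.1 hcl'
      have h0 := chi_tendsto_zero_iff.2 ⟨hd.mono_left hℱ, ht⟩
      exact absurd (ge_of_tendsto h0 (hχ.filter_mono hℱ)) (not_le.2 hδ)
    obtain ⟨η, hη, hev⟩ := exists_pos_le_of_not_mapClusterPt_zero hn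
    refine ⟨η, hη, ?_⟩
    filter_upwards [hev] with k hk
    by_contra hno
    push Not at hno
    refine absurd hk (not_le.2 ((pi_norm_lt_iff hη).2 fun i => ?_))
    rw [Real.norm_eq_abs, abs_of_nonpos (min_le_right _ _)]
    have := hno i
    rcases min_choice (lamAff P prm (Q k) (z k) i) 0 with h' | h' <;> rw [h'] <;> linarith
  -- a level that separates the components of the finitely many possible multipliers
  obtain ⟨c, ⟨hc0, hcη⟩, hc⟩ : ∃ c ∈ Set.Ioo 0 η,
      c ∉ ⋃ i : Fin m, (fun lam : Fin m → ℝ => -lam i) ''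
        {lam | ∃ x ∈ P.feasible, P.IsMultiplier x lam} :=
    (Set.Ioo_infinite hη).exists_notMem_finite
      (Set.finite_iUnion fun i => (CQP.finite_multipliers h.licq).image _)
  have hcmul : ∀ x ∈ P.feasible, ∀ lam, P.IsMultiplier x lam → ∀ i, lam i ≠ -c := by
    intro x hx lam hlam i hi
    exact hc (Set.mem_iUnion.2 ⟨i, lam, ⟨x, hx, hlam⟩, by simp [hi]⟩)
  -- Since `Δx → 0`, iterates `k` and `k + 1` share their limit and, by uniqueness, the limiting
  -- multiplier. Crossing the level `-c` infinitely often would give some multiplier the component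
  -- `-c`.
  have hpers : ∀ i, ∀ᶠ k in atTop, lamAff P prm (Q k) (z k) i < -c →
      lamAff P prm (Q (k + 1)) (z (k + 1)) i < -c := by
    intro i
    by_contra hno
    obtain ⟨ℱ, hℱ, hbad⟩ := exists_ultrafilter_of_frequently (not_eventually.1 hno)
    obtain ⟨x', hx', ht⟩ := h.exists_limit h.level_compact ℱ
    have hap := h.approach hℱ hx' ht
    have ht2 : Tendsto (fun k => (z (k + 1)).x) ℱ (𝓝 x') := by
      simp only [h.succ]
      exact hap.xNext_tendsto (hd.mono_left hℱ)
    have hap2 := h.approach_succ hℱ hx' ht2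
    have hd2 : Tendsto (fun k => dxAff P prm (Q (k + 1)) (z (k + 1))) ℱ (𝓝 0) :=
      hd.comp ((tendsto_add_atTop_nat 1).mono_left hℱ)
    obtain ⟨l1, hm1, hl1⟩ := hap.lamAff_tendsto (hd.mono_left hℱ)
    obtain ⟨l2, hm2, hl2⟩ := hap2.lamAff_tendsto hd2
    rw [CQP.IsMultiplier.eq hap.li hm2 hm1] at hl2
    refine hcmul x' hx' l1 hm1 i (le_antisymm ?_ ?_)
    · refine le_of_tendsto (tendsto_pi_nhds.1 hl1 i) (hbad.mono fun k hk => ?_)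
      push Not at hk
      exact hk.1.le
    · refine ge_of_tendsto (tendsto_pi_nhds.1 hl2 i) (hbad.mono fun k hk => ?_)
      push Not at hk
      exact hk.2
  have hcor : Tendsto (fun k => gamma P prm (Q k) (z k) • dlamCor P prm (Q k) (z k)) atTop
      (𝓝 0) := by
    rw [tendsto_iff_ultrafilter]
    intro ℱ hℱ
    obtain ⟨x', hx', ht⟩ := h.exists_limit h.level_compact ℱ
    exact (h.approach hℱ hx' ht).gamma_smul_dlamCor_tendsto (hd.mono_left hℱ)
  obtain ⟨k0, hk0⟩ := eventually_atTop.1 ((eventually_all.2 hpers).and (hneg.and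
    (hcor.eventually (Metric.ball_mem_nhds 0 hc0))))
  obtain ⟨i, hi⟩ := (hk0 k0 le_rfl).2.1
  have hlt : ∀ k, k0 ≤ k → lamAff P prm (Q k) (z k) i < -c := fun k hk => by
    induction k, hk using Nat.le_induction with
    | base => linarith
    | succ k hk ih => exact (hk0 k hk).1 i ih
  -- An estimate below `-c`, with a corrector smaller than `c`, forces `Δsᵢ ≥ 0`.
  have hinc : ∀ k, k0 ≤ k → P.slack (z k0).x i ≤ P.slack (z k).x i := fun k hk => by
    induction k, hk using Nat.le_induction with
    | base => exact le_rfl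
    | succ k hk ih =>
      refine ih.trans ?_
      rw [h.succ]
      change _ ≤ P.slack (xNext P prm (Q k) (z k)) i
      rw [slack_xNext, Pi.add_apply, Pi.smul_apply, smul_eq_mul]
      refine le_add_of_nonneg_right (mul_nonneg (h.reg k).alphaPrimal_pos.le ?_)
      have hl := hlt k hk
      have hz := h.reg k
      have hs := hz.slack_pos i
      have hlam := hz.lam_pos i
      have hQ : i ∈ Q k := by
        by_contra hQ
        rw [lamAff_of_notMem hQ] at hl
        linarith
      have hb : |gamma P prm (Q k) (z k) * dlamCor P prm (Q k) (z k) i| < c := by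
        have h1 := (hk0 k hk).2.2
        rw [dist_zero_right, pi_norm_lt_iff hc0] at h1
        exact h1 i
      have hb' := (abs_lt.1 hb).2
      have e1 : dsAff P prm (Q k) (z k) i =
          (P.slack (z k).x i / (z k).lam i) * -lamAff P prm (Q k) (z k) i := by
        rw [lamAff_of_mem hQ]; field_simp
      have e2 : 0 ≤ dsAff P prm (Q k) (z k) i := by
        rw [e1]; exact mul_nonneg (div_pos hs hlam).le (by linarith)
      have e3 : dlamAff P prm (Q k) (z k) i ≤ 0 := by
        rw [dlamAff_of_mem hQ]; linarith
      have e4 := hz.slack_mul_dlamCor (prm := prm) hQ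
      have e5 : ds P prm (Q k) (z k) i = dsAff P prm (Q k) (z k) i +
          gamma P prm (Q k) (z k) * dsCor P prm (Q k) (z k) i := rfl
      -- The complementarity rows combined. Both summands are nonnegative, since `Δsᵃᵢ ≥ 0` and
      -- `Δλᵃᵢ ≤ 0`.
      have e6 : (z k).lam i * ds P prm (Q k) (z k) i =
          P.slack (z k).x i * (-lamAff P prm (Q k) (z k) i -
            gamma P prm (Q k) (z k) * dlamCor P prm (Q k) (z k) i) +
          gamma P prm (Q k) (z k) * (sigma P prm (Q k) (z k) * mu P (Q k) (z k) +
            dsAff P prm (Q k) (z k) i * -dlamAff P prm (Q k) (z k) i) := by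
        have e7 : (z k).lam i * dsAff P prm (Q k) (z k) i =
            P.slack (z k).x i * -lamAff P prm (Q k) (z k) i := by
          rw [e1]; field_simp
        rw [e5]
        linear_combination e7 + gamma P prm (Q k) (z k) * e4
      have e8 : 0 ≤ (z k).lam i * ds P prm (Q k) (z k) i := by
        rw [e6]
        refine add_nonneg (mul_nonneg hs.le (by linarith)) (mul_nonneg hz.gamma_spec.1
          (add_nonneg (mul_nonneg sigma_nonneg hz.mu_nonneg) (mul_nonneg e2 (by linarith))))
      exact nonneg_of_mul_nonneg_right e8 hlam
  let ℱ : Ultrafilter ℕ := Ultrafilter.of atTop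
  have hℱ : (ℱ : Filter ℕ) ≤ atTop := Ultrafilter.of_le atTop
  obtain ⟨x', hx', ht⟩ := h.exists_limit h.level_compact ℱ
  have hap := h.approach hℱ hx' ht
  obtain ⟨l1, hm1, hl1⟩ := hap.lamAff_tendsto (hd.mono_left hℱ)
  have hle : l1 i ≤ -c := le_of_tendsto (tendsto_pi_nhds.1 hl1 i)
    (Eventually.filter_mono hℱ (eventually_atTop.2 ⟨k0, fun k hk => (hlt k hk).le⟩))
  -- A nonzero limiting multiplier makes constraint `i` active in the limit, while its slack has not
  -- decreased since `k0`.
  have hact : i ∈ P.active x' := by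
    by_contra hno
    rw [hm1.2 i hno] at hle
    linarith
  have hs := hap.slack_tendsto i
  rw [P.mem_active_iff.1 hact] at hs
  exact absurd (ge_of_tendsto hs (Eventually.filter_mono hℱ (eventually_atTop.2 ⟨k0, hinc⟩)))
    (not_le.2 ((h.reg k0).slack_pos i))

/-- A coercive run approaches a primal-dual solution along some ultrafilter. -/
theorem exists_kkt_limit : ∃ ℱ : Ultrafilter ℕ, (ℱ : Filter ℕ) ≤ atTop ∧ ∃ x' lam', P.KKT x' lam' ∧
    Tendsto (fun k => (z k).x) ℱ (𝓝 x') ∧ Tendsto (fun k => (z (k + 1)).x) ℱ (𝓝 x') ∧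
    Tendsto (fun k => (z (k + 1)).lamT) ℱ (𝓝 lam') := by
  obtain ⟨ℱ, hℱ, hχ⟩ := mapClusterPt_iff_ultrafilter.1 h.mapClusterPt_chi
  obtain ⟨hd, hn⟩ := chi_tendsto_zero_iff.1 hχ
  obtain ⟨x', hx', ht⟩ := h.exists_limit h.level_compact ℱ
  have hap := h.approach hℱ hx' ht
  obtain ⟨lam, hm, hl⟩ := hap.lamAff_tendsto hd
  refine ⟨ℱ, hℱ, x', lam, CQP.kkt_iff.2 ⟨hm, hx', fun i => ?_⟩, ht, ?_, ?_⟩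
  · have h1 := (tendsto_pi_nhds.1 hl i).min (tendsto_const_nhds (x := (0 : ℝ)))
    have h2 := tendsto_nhds_unique h1 (tendsto_pi_nhds.1 hn i)
    exact min_eq_right_iff.1 h2
  · simp only [h.succ]; exact hap.xNext_tendsto hd
  · simp only [h.succ]; exact hap.lamT_next_tendsto hd hl

/-- Convergence of a coercive run near a strictly complementary solution. -/
theorem tendsto_of_strict {xs : Fin n → ℝ} {lams : Fin m → ℝ} (hxs : xs ∈ P.feasible)
    (hm : P.IsMultiplier xs lams) (hpos : ∀ i ∈ P.active xs, 0 < lams i)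
    (hx : Tendsto (fun k => (z k).x) atTop (𝓝 xs))
    (hact : ∀ᶠ k in atTop, ∀ i ∈ P.active xs, i ∈ Q k) :
    Tendsto (fun k => (z k).lamT) atTop (𝓝 lams) ∧
      Tendsto (fun k => (z k).lam) atTop (𝓝 fun i => min (lams i) prm.lamMax) := by
  have hd : Tendsto (fun k => dxAff P prm (Q k) (z k)) atTop (𝓝 0) := by
    rw [← tendsto_add_atTop_iff_nat 1, tendsto_iff_ultrafilter]
    intro ℱ hℱ
    -- Either way the active components of `λ^{k+1}` are bounded below: if `χ → 0`, they approach
    -- positive truncated multipliers; otherwise the floor bounds them.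
    by_cases hχ : MapClusterPt 0 ℱ fun k => chi P prm (Q k) (z k)
    · have hχ' : Tendsto (fun k => chi P prm (Q k) (z k)) ℱ (𝓝 0) := by
        obtain ⟨𝒢, h𝒢, ht⟩ := mapClusterPt_iff_ultrafilter.1 hχ
        rwa [Ultrafilter.coe_le_coe.1 h𝒢] at ht
      have hd := (chi_tendsto_zero_iff.1 hχ').1
      have hap := h.approach hℱ hxs (hx.mono_left hℱ)
      have hlam := hap.lam_next_tendsto hd hm hpos
      simp only [← h.succ] at hlam
      obtain ⟨δ, hδ, hl⟩ := exists_pos_forall_le (ℱ := (ℱ : Filter ℕ)) (S := P.active xs)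
        (u := fun k => (z (k + 1)).lam) fun i hi => by
          have h0 : 0 < min (lams i) prm.lamMax := lt_min (hpos i hi) prm.lamMax_pos
          refine ⟨_, half_pos h0, ?_⟩
          filter_upwards [(tendsto_pi_nhds.1 hlam i).eventually (lt_mem_nhds (half_lt_self h0))]
            with k hk using hk.le
      exact h.dxAff_succ_tendsto_of_le hℱ hxs
        (((tendsto_add_atTop_iff_nat 1).2 hx).mono_left hℱ) hδ hl
    · obtain ⟨δ, hδ, hev⟩ := exists_pos_le_of_not_mapClusterPt_zero hχ
      refine h.dxAff_succ_tendsto_of_chi hℱ hδ ?_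
      filter_upwards [hev] with k hk
      rwa [Real.norm_of_nonneg chi_nonneg] at hk
  have hap : Approach atTop P z Q xs := ⟨h.reg, hx, hact, h.lam_isBigO id, h.licq xs hxs⟩
  rw [← tendsto_add_atTop_iff_nat 1, ← tendsto_add_atTop_iff_nat (f := fun k => (z k).lam) 1]
  simp only [h.succ]
  exact ⟨hap.lamT_next_tendsto hd (hap.lamAff_tendsto_of_isMultiplier hd hm),
    hap.lam_next_tendsto hd hm hpos⟩

end IsCoerciveRun

end CRMPC

/-! ### Sources of coercivity -/

namespace CRMPC

variable {n m : ℕ} {P : CQP n m} {prm : Params P}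

namespace IsRun

variable {z : ℕ → Iterate n m} {Q : ℕ → Finset (Fin m)} (h : IsRun prm z Q)
  (hlev : ∀ r, IsCompact (P.level r))
include h hlev

/-- A lower bound on the error function away from the primal-dual solutions. -/
theorem exists_le_err {δ : ℝ} (hδ : 0 < δ)
    (haway : ∀ k, ∀ p ∈ P.primalDualSolutions, δ ≤ dist ((z k).x, (z k).lam) p) :
    ∃ e > 0, ∀ k, e ≤ err P prm (z k).x (z k).lam := by
  have hcl : IsClosed {q : (Fin n → ℝ) × (Fin m → ℝ) |
      ∀ p ∈ P.primalDualSolutions, δ ≤ dist q p} := by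
    simp only [Set.ofPred_forall]
    exact isClosed_iInter fun p => isClosed_iInter fun _ =>
      isClosed_le continuous_const (continuous_id.dist continuous_const)
  obtain ⟨q, ⟨⟨hq1, hq2⟩, hq3⟩, hmin⟩ :=
    (((hlev (P.f (z 0).x)).prod (isCompact_Icc (a := (0 : Fin m → ℝ))
      (b := fun i => max prm.lamMax ((z 0).lam i)))).inter_right hcl).exists_isMinOn
      ⟨((z 0).x, (z 0).lam), ⟨h.mem_level 0, h.lam_mem_Icc 0⟩, haway 0⟩
      (continuous_err P prm).continuousOn
  refine ⟨err P prm q.1 q.2, lt_of_le_of_ne (err_nonneg _ _ _ _) fun h0 => ?_, fun k =>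
    isMinOn_iff.1 hmin ((z k).x, (z k).lam) ⟨⟨h.mem_level k, h.lam_mem_Icc k⟩, haway k⟩⟩
  have hk : q ∈ P.primalDualSolutions :=
    (err_eq_zero_iff_kkt prm hq1.1 fun i => hq2.1 i).1 h0.symm
  have := hq3 q hk
  rw [dist_self] at this
  exact absurd this (not_le.2 hδ)

/-- A sequence on which the error function is bounded below stays away from the solutions. -/
theorem exists_le_dist {ε : ℝ} (hε : 0 < ε) (he : ∀ k, ε ≤ err P prm (z k).x (z k).lam) :
    ∃ δ > 0, ∀ k, ∀ p ∈ P.primalDualSolutions, δ ≤ dist ((z k).x, (z k).lam) p := by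
  have hcl : IsClosed {q : (Fin n → ℝ) × (Fin m → ℝ) | ε ≤ err P prm q.1 q.2} :=
    isClosed_le continuous_const (continuous_err P prm)
  have hC := ((hlev (P.f (z 0).x)).prod (isCompact_Icc (a := (0 : Fin m → ℝ))
      (b := fun i => max prm.lamMax ((z 0).lam i)))).inter_right hcl
  have hdisj := Set.disjoint_left.2 (fun q (hq : q ∈ (P.level (P.f (z 0).x) ×ˢ
      Set.Icc (0 : Fin m → ℝ) fun i => max prm.lamMax ((z 0).lam i)) ∩
      {q | ε ≤ err P prm q.1 q.2}) (hq' : q ∈ P.primalDualSolutions) => by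
    have h1 : ε ≤ err P prm q.1 q.2 := hq.2
    rw [(err_eq_zero_iff_kkt prm hq.1.1.1 fun i => hq.1.2.1 i).2 hq'] at h1
    linarith)
  obtain ⟨δ, hδ, hd⟩ := hC.exists_thickening_subset_open CQP.isClosed_primalDualSolutions.isOpen_compl
    hdisj.subset_compl_right
  refine ⟨δ, hδ, fun k p hp => ?_⟩
  by_contra hlt
  rw [not_le, dist_comm] at hlt
  exact hd (Metric.mem_thickening_iff.2
    ⟨((z k).x, (z k).lam), ⟨⟨h.mem_level k, h.lam_mem_Icc k⟩, he k⟩, hlt⟩) hp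

/-- Away from the solutions `E`, hence `ϱ`, is bounded below, and `M` dominates `ϱ(H + R)`. -/
theorem isCoerciveRun_of_away (hli : ∀ x ∈ P.feasible, LinearIndependent ℝ
      (fun i : P.active x => P.A i)) {δ : ℝ} (hδ : 0 < δ)
    (haway : ∀ k, ∀ p ∈ P.primalDualSolutions, δ ≤ dist ((z k).x, (z k).lam) p)
    (hact : ∀ ℱ : Ultrafilter ℕ, (ℱ : Filter ℕ) ≤ atTop → ∀ x',
      Tendsto (fun k => (z k).x) ℱ (𝓝 x') →
        ∀ᶠ k in (ℱ : Filter ℕ), ∀ i ∈ P.active x', i ∈ Q k) : IsCoerciveRun prm z Q where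
  toIsRun := h
  level_compact := hlev
  licq := hli
  active_subset := hact
  coercive := by
    obtain ⟨e, he0, he⟩ := h.exists_le_err hlev hδ haway
    obtain ⟨c, hc, hHR⟩ := exists_HR_bound prm
    have hr : 0 < min 1 (e / prm.Ebar) :=
      lt_min one_pos (div_pos he0 prm.Ebar_pos)
    refine ⟨min 1 (e / prm.Ebar) * c, mul_pos hr hc,
      Eventually.of_forall fun k d => le_trans ?_ ((h.reg k).rho_mul_le d)⟩
    have hρ : min 1 (e / prm.Ebar) ≤ rho P prm (z k) :=
      min_le_min le_rfl (div_le_div_of_nonneg_right (he k) prm.Ebar_pos.le)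
    rw [mul_assoc]
    exact mul_le_mul hρ (hHR d) (by positivity) rho_nonneg

/-- Here `ϱ` may vanish. Indices `k` at which some active `λᵢ` is below `sᵢ` keep `E`, hence `ϱ`,
bounded below. At the others `λᵢ/sᵢ ≥ 1` on the active set, and `M` dominates the form of
`exists_quad_bound`. -/
theorem isCoerciveRun_of_strict (hli : ∀ x ∈ P.feasible, LinearIndependent ℝ
      (fun i : P.active x => P.A i)) {xs : Fin n → ℝ} {lams : Fin m → ℝ}
    (hso : P.SecondOrderSufficientStrict xs lams)
    (hx : Tendsto (fun k => (z k).x) atTop (𝓝 xs))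
    (hact : ∀ᶠ k in atTop, ∀ i ∈ P.active xs, i ∈ Q k) : IsCoerciveRun prm z Q where
  toIsRun := h
  level_compact := hlev
  licq := hli
  active_subset := by
    intro ℱ hℱ x' hx'
    rw [tendsto_nhds_unique hx' (hx.mono_left hℱ)]
    exact hact.filter_mono hℱ
  coercive := by
    classical
    have hxs : xs ∈ P.feasible := (CQP.kkt_iff.1 hso.1).2.1
    have huniq := hso.primalDualSolutions_eq (hli xs hxs)
    let B : Set ℕ := {k | ∃ i ∈ P.active xs, (z k).lam i < P.slack (z k).x i}
    -- If `E` clustered at zero on `B`, then `(x^k, λ^k)` would tend to `(x*, λ*)` along an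
    -- ultrafilter. There active slacks vanish while their multipliers have positive limits, which
    -- excludes `B`.
    have hcl : ¬ MapClusterPt 0 (atTop ⊓ 𝓟 B) fun k => err P prm (z k).x (z k).lam := by
      intro hcl
      obtain ⟨ℱ, hℱ0, he⟩ := mapClusterPt_iff_ultrafilter.1 hcl
      have hℱ : (ℱ : Filter ℕ) ≤ atTop := hℱ0.trans inf_le_left
      have hB : ∀ᶠ k in (ℱ : Filter ℕ), k ∈ B := le_principal_iff.1 (hℱ0.trans inf_le_right)
      obtain ⟨l, hl, hlt⟩ := isCompact_Icc.exists_tendsto_ultrafilter ℱ h.lam_mem_Icc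
      have hxF := hx.mono_left hℱ
      have he' := ((continuous_err P prm).tendsto (xs, l)).comp (hxF.prodMk_nhds hlt)
      have h0 : err P prm xs l = 0 := tendsto_nhds_unique he' he
      have hk : (xs, l) ∈ P.primalDualSolutions :=
        (err_eq_zero_iff_kkt prm hxs fun i => hl.1 i).1 h0
      rw [huniq, Set.mem_singleton_iff, Prod.mk.injEq] at hk
      rw [hk.2] at hlt
      have hgood : ∀ᶠ k in (ℱ : Filter ℕ), ∀ i, i ∈ P.active xs →
          P.slack (z k).x i < (z k).lam i := by
        rw [eventually_all]
        intro i
        by_cases hi : i ∈ P.active xs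
        · have hs := tendsto_pi_nhds.1 ((P.continuous_slack.tendsto xs).comp hxF) i
          rw [P.mem_active_iff.1 hi] at hs
          filter_upwards [hs.eventually_lt (tendsto_pi_nhds.1 hlt i) (hso.pos_of_active hi)]
            with k hk _ using hk
        · exact Eventually.of_forall fun k hk => (hi hk).elim
      obtain ⟨k, ⟨i, hi, hk1⟩, hk2⟩ := (hB.and hgood).exists
      exact lt_asymm hk1 (hk2 i hi)
    obtain ⟨e0, he0, hev⟩ := exists_pos_le_of_not_mapClusterPt_zero hcl
    rw [eventually_inf_principal] at hev
    obtain ⟨c1, hc1, hHR⟩ := exists_HR_bound prm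
    obtain ⟨c2, hc2, hHA⟩ := hso.exists_quad_bound
    have hr : 0 < min 1 (e0 / prm.Ebar) := lt_min one_pos (div_pos he0 prm.Ebar_pos)
    refine ⟨min (min 1 (e0 / prm.Ebar) * c1) c2, lt_min (mul_pos hr hc1) hc2, ?_⟩
    filter_upwards [hev, hact] with k hk hQ d
    by_cases hkB : k ∈ B
    · have hle := hk hkB
      rw [Real.norm_of_nonneg (err_nonneg _ _ _ _)] at hle
      have hρ : min 1 (e0 / prm.Ebar) ≤ rho P prm (z k) :=
        min_le_min le_rfl (div_le_div_of_nonneg_right hle prm.Ebar_pos.le)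
      refine le_trans ?_ ((h.reg k).rho_mul_le d)
      refine (mul_le_mul_of_nonneg_right (min_le_left _ _) (sq_nonneg _)).trans ?_
      rw [mul_assoc]
      exact mul_le_mul hρ (hHR d) (by positivity) rho_nonneg
    · refine (mul_le_mul_of_nonneg_right (min_le_right _ _) (sq_nonneg _)).trans
        ((hHA d).trans ?_)
      rw [M_quad]
      have h1 : ∑ i : P.active xs, (P.A *ᵥ d) i ^ 2 ≤
          ∑ i ∈ Q k, (z k).lam i / P.slack (z k).x i * (P.A *ᵥ d) i ^ 2 := by
        rw [← Finset.sum_subtype (Finset.univ.filter (· ∈ P.active xs)) (by simp)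
          fun i => (P.A *ᵥ d) i ^ 2]
        calc ∑ i with i ∈ P.active xs, (P.A *ᵥ d) i ^ 2
            ≤ ∑ i with i ∈ P.active xs, (z k).lam i / P.slack (z k).x i * (P.A *ᵥ d) i ^ 2 := by
              refine Finset.sum_le_sum fun i hi => ?_
              have hi' : i ∈ P.active xs := by simpa using hi
              have hle : P.slack (z k).x i ≤ (z k).lam i := by
                by_contra hlt
                exact hkB ⟨i, hi', not_le.1 hlt⟩
              exact le_mul_of_one_le_left (sq_nonneg _)
                ((one_le_div ((h.reg k).slack_pos i)).2 hle)
          _ ≤ _ := Finset.sum_le_sum_of_subset_of_nonneg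
              (fun i hi => hQ i (by simpa using hi)) fun i _ _ => mul_nonneg
                (div_nonneg ((h.reg k).lam_pos i).le ((h.reg k).slack_pos i).le) (sq_nonneg _)
      have h2 := mul_nonneg (rho_nonneg (P := P) (prm := prm) (z := z k))
        (R_quad_nonneg (prm := prm) d)
      linarith

/-- A run that is not bounded away from the primal-dual solutions has objective values
arbitrarily close to the minimum. -/
theorem exists_f_le_of_close
    (hclose : ∀ δ > 0, ∃ k, ∃ p ∈ P.primalDualSolutions, dist ((z k).x, (z k).lam) p < δ)
    {xs : Fin n → ℝ} (hxs : xs ∈ P.primalSolutions) {η : ℝ} (hη : 0 < η) :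
    ∃ k, P.f (z k).x ≤ P.f xs + η := by
  have huc : UniformContinuousOn P.f (P.level (P.f (z 0).x)) :=
    (hlev _).uniformContinuousOn_of_continuous P.continuous_f.continuousOn
  obtain ⟨δ, hδ, hf⟩ := Metric.uniformContinuousOn_iff.1 huc η hη
  obtain ⟨k, p, hp, hd⟩ := hclose δ hδ
  have hp1 : p.1 ∈ P.primalSolutions := CQP.KKT.mem_primalSolutions (lam := p.2) hp
  have hpl : p.1 ∈ P.level (P.f (z 0).x) := ⟨hp1.1, hp1.2 _ (h.mem_feasible 0)⟩
  have h1 := hf _ (h.mem_level k) _ hpl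
    (lt_of_le_of_lt ((le_max_left _ _).trans (Prod.dist_eq (x := ((z k).x, (z k).lam))).ge) hd)
  rw [Real.dist_eq] at h1
  have h2 := (abs_lt.1 h1).2
  have h3 := hp1.2 xs hxs.1
  exact ⟨k, by linarith⟩

end IsRun

/-! ### Runs of the algorithm and the theorem -/

section Theorem

variable {rule : SelectionRule n m} {x0 : Fin n → ℝ} {lam0 : Fin m → ℝ}

theorem isRun_of_neverStops (hx0 : x0 ∈ P.strictlyFeasible) (hlam0 : ∀ i, 0 < lam0 i)
    (hns : NeverStops P prm rule x0 lam0) :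
    IsRun prm (iter P prm rule x0 lam0) (workingSet P prm rule x0 lam0) where
  succ := iter_succ P prm rule x0 lam0
  reg k := by
    have hg : ∀ k, P.grad (iter P prm rule x0 lam0 k).x ≠ 0 := fun k h => hns k (Or.inl h)
    induction k with
    | zero => exact ⟨P.mem_strictlyFeasible_iff.1 hx0, hlam0, hg 0⟩
    | succ k ih =>
      have := hg (k + 1)
      rw [iter_succ] at this ⊢
      exact ih.next this

theorem isCoerciveRun_of_boundedAway (hrule : SatisfiesCSR P prm rule)
    (hx0 : x0 ∈ P.strictlyFeasible) (hlam0 : ∀ i, 0 < lam0 i)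
    (hns : NeverStops P prm rule x0 lam0) (hlev : ∀ r, IsCompact (P.level r))
    (hli : ∀ x ∈ P.feasible, LinearIndependent ℝ (fun i : P.active x => P.A i))
    (haway : BoundedAwayFromSolutions P prm rule x0 lam0) :
    IsCoerciveRun prm (iter P prm rule x0 lam0) (workingSet P prm rule x0 lam0) := by
  have hr := isRun_of_neverStops hx0 hlam0 hns
  have hcsr := (hrule x0 lam0 hx0 hlam0 hns).1 haway
  obtain ⟨δ, hδ, hδ'⟩ := haway
  exact hr.isCoerciveRun_of_away hlev hli hδ hδ' fun ℱ hℱ x' hx' =>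
    eventually_ultrafilter_of_subsequences (fun K hK hKt => hcsr x' K hK hKt) hℱ hx'

end Theorem

end CRMPC

theorem theorem1 {n m : ℕ} (P : CQP n m) (prm : Params P) (rule : CRMPC.SelectionRule n m)
    (hrule : CRMPC.SatisfiesCSR P prm rule)
    (hsol : P.StrictlyFeasibleBoundedSolutions) (hind : P.StationaryLinearlyIndependent)
    (x0 : Fin n → ℝ) (hx0 : x0 ∈ P.strictlyFeasible)
    (lam0 : Fin m → ℝ) (hlam0 : ∀ i, 0 < lam0 i) :
    (prm.ε = 0 → CRMPC.NeverStops P prm rule x0 lam0 →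
      Tendsto (fun k => Metric.infDist (CRMPC.iter P prm rule x0 lam0 k).x P.primalSolutions)
        atTop (𝓝 0) ∧
      ∀ (xs : Fin n → ℝ) (lams : Fin m → ℝ), P.SecondOrderSufficientStrict xs lams →
        P.primalDualSolutions = {(xs, lams)} ∧
        Tendsto (fun k => ((CRMPC.iter P prm rule x0 lam0 k).x,
          (CRMPC.iter P prm rule x0 lam0 k).lamT)) atTop (𝓝 (xs, lams)) ∧
        Tendsto (fun k => ((CRMPC.iter P prm rule x0 lam0 k).x,
          (CRMPC.iter P prm rule x0 lam0 k).lam)) atTop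
          (𝓝 (xs, fun i => min (lams i) prm.lamMax)) ∧
        ∀ᶠ k in atTop, P.active xs ⊆ CRMPC.workingSet P prm rule x0 lam0 k) ∧
    (0 < prm.ε → ∃ k, CRMPC.Stops P prm (CRMPC.iter P prm rule x0 lam0 k)) := by
  obtain ⟨-, hne, hb⟩ := hsol
  have hlev : ∀ r, IsCompact (P.level r) := fun r => CQP.isCompact_level hne hb r
  have hli : ∀ x ∈ P.feasible, LinearIndependent ℝ (fun i : P.active x => P.A i) :=
    fun x hx => CQP.licq_of_feasible hne hb hind hx
  constructor
  · intro _ hns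
    have hr := CRMPC.isRun_of_neverStops hx0 hlam0 hns
    have hconv : Tendsto (fun k => Metric.infDist (CRMPC.iter P prm rule x0 lam0 k).x
        P.primalSolutions) atTop (𝓝 0) := by
      obtain ⟨xs, hxs⟩ := hne
      -- In both cases the objective values come arbitrarily close to the minimum, and monotonicity
      -- extends this to the whole sequence.
      by_cases haway : CRMPC.BoundedAwayFromSolutions P prm rule x0 lam0
      · obtain ⟨ℱ, hℱ, x', lam', hk, ht, -⟩ := (CRMPC.isCoerciveRun_of_boundedAway hrule hx0 hlam0
          hns hlev hli haway).exists_kkt_limit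
        refine hr.infDist_tendsto hlev hk.mem_primalSolutions fun η hη => ?_
        exact ((((P.continuous_f.tendsto x').comp ht).eventually
          (gt_mem_nhds (lt_add_of_pos_right _ hη))).mono fun k hk => le_of_lt hk).exists
      · refine hr.infDist_tendsto hlev hxs fun η hη =>
          hr.exists_f_le_of_close hlev (fun δ hδ => ?_) hxs hη
        by_contra hno
        push Not at hno
        exact haway ⟨δ, hδ, hno⟩
    refine ⟨hconv, fun xs lams hso => ?_⟩
    obtain ⟨hm, hxs, -⟩ := CQP.kkt_iff.1 hso.1
    have huniq := hso.primalDualSolutions_eq (hli xs hxs)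
    have hx : Tendsto (fun k => (CRMPC.iter P prm rule x0 lam0 k).x) atTop (𝓝 xs) := by
      rw [hso.primalSolutions_eq] at hconv
      simpa only [Metric.infDist_singleton, ← tendsto_iff_dist_tendsto_zero] using hconv
    have hact := (hrule x0 lam0 hx0 hlam0 hns).2 xs lams huniq hso.2.2 hx
    obtain ⟨h1, h2⟩ := (hr.isCoerciveRun_of_strict hlev hli hso hx hact).tendsto_of_strict hxs hm
      (fun i hi => hso.pos_of_active hi) hx hact
    exact ⟨huniq, hx.prodMk_nhds h1, hx.prodMk_nhds h2, hact⟩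
  · intro hε
    by_contra hns
    push Not at hns
    have hr := CRMPC.isRun_of_neverStops hx0 hlam0 hns
    have he : ∀ k, prm.ε ≤ CRMPC.err P prm (CRMPC.iter P prm rule x0 lam0 k).x
        (CRMPC.iter P prm rule x0 lam0 k).lam ∧
        prm.ε ≤ CRMPC.err P prm (CRMPC.iter P prm rule x0 lam0 k).x
          fun i => max ((CRMPC.iter P prm rule x0 lam0 k).lamT i) 0 := fun k => by
      have := hns k
      rw [CRMPC.Stops, not_or, not_lt, le_min_iff] at this
      exact this.2
    have haway : CRMPC.BoundedAwayFromSolutions P prm rule x0 lam0 :=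
      hr.exists_le_dist hlev hε fun k => (he k).1
    obtain ⟨ℱ, hℱ, x', lam', hk, -, ht, hT⟩ := (CRMPC.isCoerciveRun_of_boundedAway hrule hx0 hlam0
      hns hlev hli haway).exists_kkt_limit
    obtain ⟨-, hx', hl'⟩ := CQP.kkt_iff.1 hk
    -- The estimate `λ̃^{k+1}` is paired with `x^{k+1}` in the stopping test; taking positive parts
    -- does not change the limit, which is nonnegative.
    have hT' : Tendsto (fun k i => max ((CRMPC.iter P prm rule x0 lam0 (k + 1)).lamT i) 0) ℱ
        (𝓝 lam') := by
      refine tendsto_pi_nhds.2 fun i => ?_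
      have := (tendsto_pi_nhds.1 hT i).max (tendsto_const_nhds (x := (0 : ℝ)))
      rwa [max_eq_left (hl' i)] at this
    have hlim := ((CRMPC.continuous_err P prm).tendsto (x', lam')).comp (ht.prodMk_nhds hT')
    have hge : prm.ε ≤ CRMPC.err P prm x' lam' :=
      ge_of_tendsto hlim (Eventually.of_forall fun k => (he (k + 1)).2)
    rw [(CRMPC.err_eq_zero_iff_kkt prm hx' hl').2 hk] at hge
    linarith
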